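/- Fix a prime $p$. **Frames and windows.** A frame $\underline S=(S,\mathrm{Fil}\,S,R,\sigma,\sigma_1)$ consists of a commutative ring $S$, an ideal $\mathrm{Fil}\,S$ with quotient $R=S/\mathrm{Fil}\,S$ such that $pS+\mathrm{Fil}\,S\subseteq\mathrm{Rad}\,S$, a ring endomorphism $\sigma$ of $S$ with $\sigma(x)\equiv x^p$ modulo $pS$, and a $\sigma$-linear map $\sigma_1:\mathrm{Fil}\,S\to S$ whose image generates the unit ideal. A frame homomorphism $\alpha:\underline S\to\underline S'$ is a ring homomorphism $\alpha:S\to S'$ with $\alpha(\mathrm{Fil}\,S)\subseteq\mathrm{Fil}\,S'$, $\sigma'\alpha=\alpha\sigma$ and $\sigma_1'\alpha=u\cdot\alpha\sigma_1$ for a unit $u\in S'$. A window over $\underline S$ is a quadruple $(P,Q,F,F_1)$ where $P$ is a finitely generated projective $S$-module, $Q\subseteq P$ is a submodule such that there is a decomposition $P=L\oplus T$ with $Q=L\oplus \mathrm{Fil}\,S\cdot T$, and $F:P\to P$ and $F_1:Q\to P$ are $\sigma$-linear maps with $F_1(ax)=\sigma_1(a)F(x)$ for $a\in\mathrm{Fil}\,S$,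 $x\in P$, such that $F_1(Q)$ generates $P$. Homomorphisms of windows are linear maps that preserve $Q$ and commute with $F$ and $F_1$. A frame homomorphism $\alpha$ induces a base change functor on windows, $P\mapsto P'=S'\otimes_SP$, where $Q'$ is generated by the image of $Q$ and by $\mathrm{Fil}\,S'\cdot P'$, $F'=\sigma'\otimes F$, and $F_1'$ is the $\sigma'$-linear map with $F_1'(1\otimes x)=u\otimes F_1(x)$ for $x\in Q$ and $F'_1(ay)=\sigma'_1(a)F'(y)$ for $a\in\mathrm{Fil}\,S'$, $y\in P'$. The homomorphism $\alpha$ is called crystalline if this functor is an equivalence of categories. **The frame $A_{\mathrm{cris}}(R)$.** Let $R\neq 0$ be a semiperfect ring, that is, a commutative $\mathbb F_p$-algebra whose Frobenius $\phi$ is surjective. Let $R^\flat=\varprojlim(R,\phi)$ and $J=\mathrm{Ker}(R^\flat\to R)$. Let $A_{\mathrm{cris}}(R)$ be the $p$-adic completion of the divided power envelope $D$ of the ideal $I=\mathrm{Ker}(W(R^\flat)\to R)$, with divided powers compatible with those of $p\mathbb Z_p$. It is a frame with $\mathrm{Fil}\,A_{\mathrm{cris}}(R)=\mathrm{Ker}(A_{\mathrm{cris}}(R)\to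 R)$, with $\sigma$ induced by the Frobenius of $W(R^\flat)$ and satisfying $\sigma(i^{[n]})=\sigma(i)^{[n]}$ for $i\in I$, and with the canonical $\sigma$-linear map $\sigma_1$ such that $p\sigma_1=\sigma$, which is determined by $$\sigma_1(i^{[n]})=\frac{p^{n-1}}{n!}\bigl((p-1)!\,i^{[p]}+\tfrac{\sigma(i)-i^p}{p}\bigr)^n\qquad(i\in I,\ n\ge 1);$$ in particular $\sigma_1([a]^{[n]})=\frac{(pn)!}{p\cdot n!}[a]^{[pn]}$ for $a\in J$. **Lifts.** A lift of $R$ is a $p$-adically complete and $p$-torsion free ring $A$ with $A/pA=R$ together with a ring endomorphism $\sigma$ that induces $\phi$ on $R$. It gives the frame $\underline A=(A,pA,R,\sigma,p^{-1}\sigma)$. There is a unique homomorphism $\psi:W(R^\flat)\to A$ over $R$, and $\psi$ is surjective; let $J'=\mathrm{Ker}(\psi)$. The lift $A$ is called straight if the set of all $a\in J$ with $[a]\in J'$ generates the ideal $J$. **Statement.** Let $A$ be a straight lift of the semiperfect ring $R$. Then there is a unique ring homomorphism $\varkappa:A_{\mathrm{cris}}(R)\to A$ over $R$, it is a frame homomorphism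 from the frame $A_{\mathrm{cris}}(R)$ to $\underline A$, and this frame homomorphism is crystalline: base change along $\varkappa$ is an equivalence from the category of windows over $A_{\mathrm{cris}}(R)$ to the category of windows over $\underline A$. -/

import Mathlib

universe u

noncomputable section

set_option linter.all false

open scoped TensorProduct Nat

namespace Lau

section Semilinear

variable {S S' P : Type*} [CommRing S] [CommRing S'] [AddCommGroup P] [Module S P]

/-- `σ₁` is `σ`-linear on the ideal `I` and `P` is finite projective: the rule
`a • x ↦ σ₁ a • F x` for `a ∈ I` and `x ∈ P` is a well defined `σ`-linear map on `I P`. -/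
theorem exists_theta [Module.Finite S P] [Module.Projective S P] (I : Ideal S) (σ : S →+* S)
    (σ₁ : I →ₛₗ[σ] S) (F : P →ₛₗ[σ] P) :
    ∃ Θ : (I • ⊤ : Submodule S P) →ₛₗ[σ] P, ∀ (a : S) (ha : a ∈ I) (x : P),
      Θ ⟨a • x, Submodule.smul_mem_smul ha trivial⟩ = σ₁ ⟨a, ha⟩ • F x := by
  obtain ⟨n, f, hf⟩ := Module.Finite.exists_fin' S P
  obtain ⟨g, hg⟩ := Module.projective_lifting_property f LinearMap.id hf
  have hmem : ∀ y : (I • ⊤ : Submodule S P), ∀ j, g y j ∈ I := by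
    rintro ⟨y, hy⟩ j
    have : (I • ⊤ : Submodule S P) ≤ Submodule.comap ((LinearMap.proj j).comp g) I := by
      rw [Submodule.smul_le]
      intro a ha x _
      simpa using I.mul_mem_right _ ha
    exact this hy
  refine ⟨{ toFun := fun y => ∑ j, σ₁ ⟨g y j, hmem y j⟩ • F (f (Pi.single j 1))
            map_add' := ?_, map_smul' := ?_ }, ?_⟩
  · intro x y
    rw [← Finset.sum_add_distrib]
    refine Finset.sum_congr rfl fun j _ => ?_
    rw [← add_smul, ← map_add]
    congr 2
    ext
    simp
  · intro c y
    rw [Finset.smul_sum]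
    refine Finset.sum_congr rfl fun j _ => ?_
    rw [smul_smul, ← smul_eq_mul, ← map_smulₛₗ σ₁]
    congr 2
    ext
    simp
  · intro a ha x
    have h1 : x = ∑ j, g x j • f (Pi.single j 1) := by
      conv_lhs => rw [← LinearMap.id_apply (R := S) x, ← hg, LinearMap.comp_apply]
      conv_lhs => rw [pi_eq_sum_univ' (g x), map_sum]
      refine Finset.sum_congr rfl fun j _ => ?_
      rw [map_smul]
    conv_rhs => rw [h1, map_sum, Finset.smul_sum]
    change ∑ j, σ₁ ⟨g (a • x) j, _⟩ • F (f (Pi.single j 1)) = _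
    refine Finset.sum_congr rfl fun j _ => ?_
    rw [map_smulₛₗ F, smul_smul, mul_comm, ← smul_eq_mul (σ _), ← map_smulₛₗ σ₁]
    congr 2
    ext
    simp [mul_comm]

variable [Algebra S S']

/-- For a `σ`-linear map `f : P → P` the `σ'`-linear map `s ⊗ x ↦ σ' s ⊗ f x` of `S' ⊗ P`. -/
def semilinearBaseChange {σ : S →+* S} {σ' : S' →+* S'}
    (hσ : ∀ s, σ' (algebraMap S S' s) = algebraMap S S' (σ s)) (f : P →ₛₗ[σ] P) :
    S' ⊗[S] P →ₛₗ[σ'] S' ⊗[S] P :=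
  let σ'' : S' →ₛₗ[σ] S' :=
    { toFun := σ'
      map_add' := map_add σ'
      map_smul' := fun s t => by simp [Algebra.smul_def, hσ] }
  { TensorProduct.map σ'' f with
    map_smul' := fun s y => by
      change TensorProduct.map σ'' f (s • y) = σ' s • TensorProduct.map σ'' f y
      induction y with
      | zero => simp
      | add y z hy hz => rw [smul_add, map_add, map_add, smul_add, hy, hz]
      | tmul t x => simp [TensorProduct.smul_tmul', σ''] }

@[simp]
theorem semilinearBaseChange_tmul {σ : S →+* S} {σ' : S' →+* S'}
    (hσ : ∀ s, σ' (algebraMap S S' s) = algebraMap S S' (σ s)) (f : P →ₛₗ[σ] P) (s : S') (x : P) :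
    semilinearBaseChange hσ f (s ⊗ₜ x) = σ' s ⊗ₜ f x := rfl

end Semilinear

/-- A frame `(S, Fil S, S / Fil S, σ, σ₁)`. -/
structure Frame (p : ℕ) where
  S : Type u
  [commRing : CommRing S]
  Fil : Ideal S
  σ : S →+* S
  σ₁ : Fil →ₛₗ[σ] S
  le_jacobson : Ideal.span {(p : S)} ⊔ Fil ≤ Ideal.jacobson ⊥
  frobenius_lift : ∀ x, σ x - x ^ p ∈ Ideal.span {(p : S)}
  span_range_σ₁ : Ideal.span (Set.range σ₁) = ⊤

attribute [instance] Frame.commRing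

/-- A window `(P, Q, F, F₁)` over a frame. -/
structure Window {p : ℕ} (𝓢 : Frame.{u} p) where
  P : Type u
  [addCommGroup : AddCommGroup P]
  [module : Module 𝓢.S P]
  [finite : Module.Finite 𝓢.S P]
  [projective : Module.Projective 𝓢.S P]
  Q : Submodule 𝓢.S P
  F : P →ₛₗ[𝓢.σ] P
  F₁ : Q →ₛₗ[𝓢.σ] P
  exists_normal_decomposition : ∃ L T : Submodule 𝓢.S P, IsCompl L T ∧ Q = L ⊔ 𝓢.Fil • T
  smul_mem (a : 𝓢.Fil) (x : P) : (a : 𝓢.S) • x ∈ Q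
  F₁_smul (a : 𝓢.Fil) (x : P) : F₁ ⟨(a : 𝓢.S) • x, smul_mem a x⟩ = 𝓢.σ₁ a • F x
  span_range_F₁ : Submodule.span 𝓢.S (Set.range F₁) = ⊤

attribute [instance] Window.addCommGroup Window.module Window.finite Window.projective

namespace Window

variable {p : ℕ} {𝓢 : Frame.{u} p}

/-- Homomorphisms of windows: linear maps that preserve `Q` and commute with `F` and `F₁`. -/
@[ext]
structure Hom (X Y : Window 𝓢) where
  toLinearMap : X.P →ₗ[𝓢.S] Y.P
  map_Q (x : X.P) : x ∈ X.Q → toLinearMap x ∈ Y.Q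
  map_F (x : X.P) : toLinearMap (X.F x) = Y.F (toLinearMap x)
  map_F₁ (x : X.Q) : toLinearMap (X.F₁ x) = Y.F₁ ⟨toLinearMap x, map_Q x x.2⟩

instance : CategoryTheory.Category (Window 𝓢) where
  Hom X Y := Hom X Y
  id X := ⟨LinearMap.id, fun _ h => h, fun _ => rfl, fun _ => rfl⟩
  comp f g := ⟨g.toLinearMap ∘ₗ f.toLinearMap, fun x h => g.map_Q _ (f.map_Q x h),
    fun x => by simp [f.map_F, g.map_F], fun x => by simp [f.map_F₁, g.map_F₁]⟩

@[ext]
theorem hom_ext {X Y : Window 𝓢} {f g : X ⟶ Y}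
    (h : Hom.toLinearMap f = Hom.toLinearMap g) : f = g :=
  Hom.ext h

end Window

/-- A frame homomorphism, with the unit `u` such that `σ₁' α = u · α σ₁`. -/
structure FrameHom {p : ℕ} (𝓢 𝓢' : Frame.{u} p) where
  toRingHom : 𝓢.S →+* 𝓢'.S
  map_Fil (a : 𝓢.S) : a ∈ 𝓢.Fil → toRingHom a ∈ 𝓢'.Fil
  map_σ (x : 𝓢.S) : 𝓢'.σ (toRingHom x) = toRingHom (𝓢.σ x)
  u : 𝓢'.Sˣ
  map_σ₁ (a : 𝓢.Fil) : 𝓢'.σ₁ ⟨toRingHom a, map_Fil a a.2⟩ = u * toRingHom (𝓢.σ₁ a)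

namespace FrameHom

variable {p : ℕ} {𝓢 𝓢' : Frame.{u} p} (α : FrameHom 𝓢 𝓢')

/-- The module `S' ⊗_S P`. -/
def BaseChange (X : Window 𝓢) : Type u :=
  letI := α.toRingHom.toAlgebra
  𝓢'.S ⊗[𝓢.S] X.P

instance (X : Window 𝓢) : AddCommGroup (α.BaseChange X) :=
  letI := α.toRingHom.toAlgebra
  TensorProduct.addCommGroup (R := 𝓢.S) (M := 𝓢'.S) (N := X.P)

instance (X : Window 𝓢) : Module 𝓢'.S (α.BaseChange X) :=
  letI := α.toRingHom.toAlgebra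
  TensorProduct.leftModule (R := 𝓢.S) (R'' := 𝓢'.S) (M := 𝓢'.S) (N := X.P)

instance (X : Window 𝓢) : Module.Finite 𝓢'.S (α.BaseChange X) :=
  letI := α.toRingHom.toAlgebra
  Module.Finite.base_change 𝓢.S 𝓢'.S X.P

instance (X : Window 𝓢) : Module.Projective 𝓢'.S (α.BaseChange X) :=
  letI := α.toRingHom.toAlgebra
  Module.Projective.tensorProduct (R := 𝓢'.S) (R₀ := 𝓢.S) (M := 𝓢'.S) (N := X.P)

/-- The map `P → S' ⊗_S P`, `x ↦ 1 ⊗ x`. -/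
def ι (X : Window 𝓢) : X.P →ₛₗ[α.toRingHom] α.BaseChange X :=
  letI := α.toRingHom.toAlgebra
  { toFun := fun x => (1 : 𝓢'.S) ⊗ₜ[𝓢.S] x
    map_add' := fun x y => TensorProduct.tmul_add _ _ _
    map_smul' := fun s x => by
      have : (1 : 𝓢'.S) ⊗ₜ[𝓢.S] (s • x) = (α.toRingHom s • (1 : 𝓢'.S)) ⊗ₜ[𝓢.S] x := by
        rw [TensorProduct.tmul_smul, TensorProduct.smul_tmul', Algebra.smul_def, mul_one,
          smul_eq_mul, mul_one]
        rfl
      exact this }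

theorem span_range_ι (X : Window 𝓢) : Submodule.span 𝓢'.S (Set.range (α.ι X)) = ⊤ := by
  letI := α.toRingHom.toAlgebra
  rw [eq_top_iff]
  rintro y -
  change 𝓢'.S ⊗[𝓢.S] X.P at y
  induction y with
  | zero => exact zero_mem _
  | add y z hy hz => exact add_mem hy hz
  | tmul t x =>
    have : (t ⊗ₜ[𝓢.S] x : 𝓢'.S ⊗[𝓢.S] X.P) = t • (1 : 𝓢'.S) ⊗ₜ[𝓢.S] x := by
      rw [TensorProduct.smul_tmul', smul_eq_mul, mul_one]
    rw [this]
    exact Submodule.smul_mem _ t (Submodule.subset_span ⟨x, rfl⟩)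

/-- Extension of a `σ`-linear endomorphism `f` of `P` to the `σ'`-linear endomorphism
`s ⊗ x ↦ σ' s ⊗ f x` of `S' ⊗_S P`. -/
def extend (X : Window 𝓢) (f : X.P →ₛₗ[𝓢.σ] X.P) : α.BaseChange X →ₛₗ[𝓢'.σ] α.BaseChange X :=
  letI := α.toRingHom.toAlgebra
  semilinearBaseChange (S := 𝓢.S) (S' := 𝓢'.S) (fun s => α.map_σ s) f

@[simp]
theorem extend_ι (X : Window 𝓢) (f : X.P →ₛₗ[𝓢.σ] X.P) (x : X.P) :
    α.extend X f (α.ι X x) = α.ι X (f x) := by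
  letI := α.toRingHom.toAlgebra
  change 𝓢'.σ 1 ⊗ₜ[𝓢.S] f x = (1 : 𝓢'.S) ⊗ₜ[𝓢.S] f x
  rw [map_one]

/-- The base change of a linear map. -/
def mapLinear {X Y : Window 𝓢} (f : X.P →ₗ[𝓢.S] Y.P) : α.BaseChange X →ₗ[𝓢'.S] α.BaseChange Y :=
  letI := α.toRingHom.toAlgebra
  LinearMap.baseChange 𝓢'.S f

@[simp]
theorem mapLinear_ι {X Y : Window 𝓢} (f : X.P →ₗ[𝓢.S] Y.P) (x : X.P) :
    α.mapLinear f (α.ι X x) = α.ι Y (f x) := rfl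

theorem induction {X : Window 𝓢} {motive : α.BaseChange X → Prop} (y : α.BaseChange X)
    (ι : ∀ x, motive (α.ι X x)) (zero : motive 0)
    (add : ∀ y z, motive y → motive z → motive (y + z))
    (smul : ∀ (s : 𝓢'.S) y, motive y → motive (s • y)) : motive y := by
  have : y ∈ Submodule.span 𝓢'.S (Set.range (α.ι X)) := by rw [span_range_ι]; trivial
  induction this using Submodule.span_induction with
  | mem x h => obtain ⟨x, rfl⟩ := h; exact ι x
  | zero => exact zero
  | add x y _ _ hx hy => exact add _ _ hx hy
  | smul a x _ hx => exact smul _ _ hx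

/-- The submodule `Q'` of `S' ⊗_S P` generated by the image of `Q` and by `Fil S' · (S' ⊗_S P)`. -/
def baseQ (X : Window 𝓢) : Submodule 𝓢'.S (α.BaseChange X) :=
  Submodule.span 𝓢'.S (α.ι X '' X.Q) ⊔ 𝓢'.Fil • ⊤

theorem ι_mem_baseQ (X : Window 𝓢) (x : X.Q) : α.ι X x ∈ α.baseQ X :=
  Submodule.mem_sup_left (Submodule.subset_span ⟨x, x.2, rfl⟩)

theorem smul_mem_baseQ (X : Window 𝓢) (a : 𝓢'.Fil) (y : α.BaseChange X) :
    (a : 𝓢'.S) • y ∈ α.baseQ X :=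
  Submodule.mem_sup_right (Submodule.smul_mem_smul a.2 trivial)

/-- `F₁'` is determined by its values on the image of `Q` and on `Fil S' · (S' ⊗_S P)`. -/
theorem baseQ_induction {X : Window 𝓢} {motive : α.baseQ X → Prop} (y : α.baseQ X)
    (ι : ∀ x : X.Q, motive ⟨α.ι X x, α.ι_mem_baseQ X x⟩)
    (smul_mem : ∀ (a : 𝓢'.Fil) (y : α.BaseChange X), motive ⟨(a : 𝓢'.S) • y, α.smul_mem_baseQ X a y⟩)
    (zero : motive 0)
    (add : ∀ y z, motive y → motive z → motive (y + z))
    (smul : ∀ (s : 𝓢'.S) y, motive y → motive (s • y)) : motive y := by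
  let N : Submodule 𝓢'.S (α.baseQ X) :=
    { carrier := {y | motive y}, zero_mem' := zero, add_mem' := fun h h' => add _ _ h h',
      smul_mem' := fun s y h => smul s y h }
  have : α.baseQ X ≤ N.map (α.baseQ X).subtype := by
    refine sup_le (Submodule.span_le.2 ?_) (Submodule.smul_le.2 ?_)
    · rintro _ ⟨x, hx, rfl⟩
      exact ⟨_, ι ⟨x, hx⟩, rfl⟩
    · intro a ha y _
      exact ⟨_, smul_mem ⟨a, ha⟩ y, rfl⟩
  obtain ⟨z, hz, hzy⟩ := this y.2
  rw [← show z = y from Subtype.ext hzy]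
  exact hz

theorem exists_normal_decomposition (X : Window 𝓢) :
    ∃ L T : Submodule 𝓢'.S (α.BaseChange X), IsCompl L T ∧ α.baseQ X = L ⊔ 𝓢'.Fil • T := by
  obtain ⟨L, T, hLT, hQ⟩ := X.exists_normal_decomposition
  refine ⟨Submodule.span 𝓢'.S (α.ι X '' L), Submodule.span 𝓢'.S (α.ι X '' T), ?_, ?_⟩
  · let e : X.P →ₗ[𝓢.S] X.P := L.subtype ∘ₗ L.projectionOnto T hLT
    have heL : ∀ x ∈ L, e x = x := fun x hx => by
      simpa [e] using congrArg Subtype.val (Submodule.projectionOnto_apply_left hLT ⟨x, hx⟩)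
    have heT : ∀ x ∈ T, e x = 0 := fun x hx => by
      simpa [e] using (Submodule.projectionOnto_apply_eq_zero_iff hLT).2 hx
    have h1 : ∀ y ∈ Submodule.span 𝓢'.S (α.ι X '' L), α.mapLinear e y = y := by
      intro y hy
      induction hy using Submodule.span_induction with
      | mem x h => obtain ⟨x, hx, rfl⟩ := h; rw [mapLinear_ι, heL x hx]
      | zero => simp
      | add x y _ _ hx hy => rw [map_add, hx, hy]
      | smul a x _ hx => rw [map_smul, hx]
    have h2 : ∀ y ∈ Submodule.span 𝓢'.S (α.ι X '' T), α.mapLinear e y = 0 := by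
      intro y hy
      induction hy using Submodule.span_induction with
      | mem x h => obtain ⟨x, hx, rfl⟩ := h; rw [mapLinear_ι, heT x hx, map_zero]
      | zero => simp
      | add x y _ _ hx hy => rw [map_add, hx, hy, add_zero]
      | smul a x _ hx => rw [map_smul, hx, smul_zero]
    refine ⟨?_, ?_⟩
    · rw [Submodule.disjoint_def]
      intro y hy hy'
      rw [← h1 y hy, h2 y hy']
    · rw [codisjoint_iff, eq_top_iff, ← α.span_range_ι X, Submodule.span_le]
      rintro _ ⟨x, rfl⟩
      obtain ⟨l, hl, t, ht, rfl⟩ := Submodule.mem_sup.1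
        (show x ∈ L ⊔ T by rw [hLT.sup_eq_top]; trivial)
      rw [map_add]
      exact add_mem (Submodule.mem_sup_left (Submodule.subset_span ⟨l, hl, rfl⟩))
        (Submodule.mem_sup_right (Submodule.subset_span ⟨t, ht, rfl⟩))
  · apply le_antisymm
    · refine sup_le (Submodule.span_le.2 ?_) (Submodule.smul_le.2 ?_)
      · rintro _ ⟨x, hx, rfl⟩
        rw [SetLike.mem_coe, hQ] at hx
        obtain ⟨l, hl, z, hz, rfl⟩ := Submodule.mem_sup.1 hx
        rw [map_add]
        refine add_mem (Submodule.mem_sup_left (Submodule.subset_span ⟨l, hl, rfl⟩))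
          (Submodule.mem_sup_right ?_)
        clear hx
        induction hz using Submodule.smul_induction_on' with
        | smul a ha t ht =>
          rw [map_smulₛₗ]
          exact Submodule.smul_mem_smul (α.map_Fil a ha) (Submodule.subset_span ⟨t, ht, rfl⟩)
        | add x _ y _ hx hy => rw [map_add]; exact add_mem hx hy
      · intro a ha y hy0
        clear hy0
        induction y using α.induction with
        | zero => simp
        | add y z hy hz => rw [smul_add]; exact add_mem hy hz
        | smul s y hy => rw [smul_comm]; exact Submodule.smul_mem _ s hy
        | ι x =>
          obtain ⟨l, hl, t, ht, rfl⟩ := Submodule.mem_sup.1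
            (show x ∈ L ⊔ T by rw [hLT.sup_eq_top]; trivial)
          rw [map_add, smul_add]
          exact add_mem
            (Submodule.mem_sup_left (Submodule.smul_mem _ _ (Submodule.subset_span ⟨l, hl, rfl⟩)))
            (Submodule.mem_sup_right
              (Submodule.smul_mem_smul ha (Submodule.subset_span ⟨t, ht, rfl⟩)))
    · refine sup_le (Submodule.span_le.2 ?_) (Submodule.smul_le.2 ?_)
      · rintro _ ⟨x, hx, rfl⟩
        exact α.ι_mem_baseQ X ⟨x, by rw [hQ]; exact Submodule.mem_sup_left hx⟩
      · intro a ha y _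
        exact α.smul_mem_baseQ X ⟨a, ha⟩ y

/-- On `Q` the operator `F` is a multiple of `F₁`, compatibly with base change. -/
theorem smul_ι_F₁ (X : Window 𝓢) (a : 𝓢'.Fil) (x : X.Q) :
    ((α.u : 𝓢'.S) * 𝓢'.σ a) • α.ι X (X.F₁ x) = 𝓢'.σ₁ a • α.ι X (X.F x) := by
  have key : ∀ c ∈ Ideal.span (Set.range 𝓢.σ₁),
      ((α.u : 𝓢'.S) * 𝓢'.σ a * α.toRingHom c) • α.ι X (X.F₁ x) =
        (𝓢'.σ₁ a * α.toRingHom c) • α.ι X (X.F x) := by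
    intro c hc
    induction hc using Submodule.span_induction with
    | zero => simp
    | add y z _ _ hy hz => rw [map_add, mul_add, mul_add, add_smul, add_smul, hy, hz]
    | smul s y _ hy =>
      rw [smul_eq_mul, map_mul, mul_left_comm, mul_smul, hy, smul_smul, mul_left_comm]
    | mem y hy =>
      obtain ⟨b, rfl⟩ := hy
      have h1 : (α.u : 𝓢'.S) * 𝓢'.σ a * α.toRingHom (𝓢.σ₁ b)
          = 𝓢'.σ₁ a * α.toRingHom (𝓢.σ b) := by
        have e1 := 𝓢'.σ₁.map_smulₛₗ (a : 𝓢'.S) ⟨α.toRingHom b, α.map_Fil b b.2⟩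
        have e2 := 𝓢'.σ₁.map_smulₛₗ (α.toRingHom b) a
        have e3 : (a : 𝓢'.S) • (⟨α.toRingHom b, α.map_Fil b b.2⟩ : 𝓢'.Fil)
            = α.toRingHom b • a := Subtype.ext (mul_comm _ _)
        rw [e3, e2, α.map_σ₁, α.map_σ, smul_eq_mul, smul_eq_mul] at e1
        rw [mul_comm (𝓢'.σ₁ a), e1]
        ring
      rw [h1, mul_smul, mul_smul, ← map_smulₛₗ (α.ι X), ← map_smulₛₗ (α.ι X), ← X.F₁_smul,
        ← map_smulₛₗ X.F₁]
      rfl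
  have := key 1 (by rw [𝓢.span_range_σ₁]; trivial)
  simpa using this

theorem exists_F₁ (X : Window 𝓢) :
    ∃ F₁ : α.baseQ X →ₛₗ[𝓢'.σ] α.BaseChange X,
      (∀ x : X.Q, F₁ ⟨α.ι X x, α.ι_mem_baseQ X x⟩ = (α.u : 𝓢'.S) • α.ι X (X.F₁ x)) ∧
      ∀ (a : 𝓢'.Fil) (y : α.BaseChange X),
        F₁ ⟨(a : 𝓢'.S) • y, α.smul_mem_baseQ X a y⟩ = 𝓢'.σ₁ a • α.extend X X.F y := by
  obtain ⟨L, T, hLT, hQ⟩ := X.exists_normal_decomposition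
  obtain ⟨Θ, hΘ⟩ := exists_theta 𝓢'.Fil 𝓢'.σ 𝓢'.σ₁ (α.extend X X.F)
  have hLQ : L ≤ X.Q := hQ ▸ le_sup_left
  let eL : X.P →ₗ[𝓢.S] X.Q := Submodule.inclusion hLQ ∘ₗ L.projectionOnto T hLT
  let eT : X.P →ₗ[𝓢.S] X.P := LinearMap.id - X.Q.subtype ∘ₗ eL
  have heL : ∀ x ∈ L, (eL x : X.P) = x := fun x hx => by
    simpa [eL] using congrArg Subtype.val (Submodule.projectionOnto_apply_left hLT ⟨x, hx⟩)
  have heT : ∀ x ∈ T, eL x = 0 := fun x hx => by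
    have := (Submodule.projectionOnto_apply_eq_zero_iff hLT).2 hx
    simp [eL, this]
  have hsum : ∀ x, x = (eL x : X.P) + eT x := fun x => by simp [eT]
  -- `eT` maps `Q` into `Fil S · P`
  have hTQ : ∀ x ∈ X.Q, eT x ∈ (𝓢.Fil • ⊤ : Submodule 𝓢.S X.P) := by
    intro x hx
    rw [hQ] at hx
    obtain ⟨l, hl, z, hz, rfl⟩ := Submodule.mem_sup.1 hx
    have : eT l = 0 := by simp [eT, heL l hl]
    rw [map_add, this, zero_add]
    have h2 : eT z = z := by
      have : eL z = 0 := by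
        clear hx
        induction hz using Submodule.smul_induction_on' with
        | smul a ha t ht => rw [map_smul, heT t ht, smul_zero]
        | add x _ y _ hx hy => rw [map_add, hx, hy, add_zero]
      simp [eT, this]
    rw [h2]
    exact Submodule.smul_mono le_rfl le_top hz
  have hι : ∀ z ∈ (𝓢.Fil • ⊤ : Submodule 𝓢.S X.P), α.ι X z ∈
      (𝓢'.Fil • ⊤ : Submodule 𝓢'.S (α.BaseChange X)) := by
    intro z hz
    induction hz using Submodule.smul_induction_on' with
    | smul a ha t ht =>
      rw [map_smulₛₗ]
      exact Submodule.smul_mem_smul (α.map_Fil a ha) trivial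
    | add x _ y _ hx hy => rw [map_add]; exact add_mem hx hy
  have hmem : ∀ y ∈ α.baseQ X, α.mapLinear eT y ∈
      (𝓢'.Fil • ⊤ : Submodule 𝓢'.S (α.BaseChange X)) := by
    suffices h : α.baseQ X ≤ Submodule.comap (α.mapLinear eT) (𝓢'.Fil • ⊤) from fun y hy => h hy
    refine sup_le (Submodule.span_le.2 ?_) (Submodule.smul_le.2 ?_)
    · rintro _ ⟨x, hx, rfl⟩
      exact hι _ (hTQ x hx)
    · intro a ha y _
      rw [Submodule.mem_comap, map_smul]
      exact Submodule.smul_mem_smul ha trivial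
  let Ψ := α.extend X (X.F₁.comp eL)
  have hΘι : ∀ z (hz : z ∈ (𝓢.Fil • ⊤ : Submodule 𝓢.S X.P)) (hzQ : z ∈ X.Q),
      Θ ⟨α.ι X z, hι z hz⟩ = (α.u : 𝓢'.S) • α.ι X (X.F₁ ⟨z, hzQ⟩) := by
    intro z hz
    induction hz using Submodule.smul_induction_on' with
    | smul a ha t ht =>
      intro hzQ
      have e1 : (⟨α.ι X (a • t), hι _ (Submodule.smul_mem_smul ha ht)⟩ :
          (𝓢'.Fil • ⊤ : Submodule 𝓢'.S (α.BaseChange X))) =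
          ⟨α.toRingHom a • α.ι X t, Submodule.smul_mem_smul (α.map_Fil a ha) trivial⟩ :=
        Subtype.ext (map_smulₛₗ _ _ _)
      rw [e1, hΘ _ (α.map_Fil a ha), extend_ι]
      have e2 := X.F₁_smul ⟨a, ha⟩ t
      rw [e2, map_smulₛₗ, smul_smul, ← α.map_σ₁ ⟨a, ha⟩]
    | add x hx y hy ihx ihy =>
      intro hzQ
      have hxQ : ∀ w ∈ (𝓢.Fil • ⊤ : Submodule 𝓢.S X.P), w ∈ X.Q := fun w hw =>
        (Submodule.smul_le.2 fun a ha t _ => X.smul_mem ⟨a, ha⟩ t) hw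
      have e1 : (⟨α.ι X (x + y), hι _ (add_mem hx hy)⟩ :
          (𝓢'.Fil • ⊤ : Submodule 𝓢'.S (α.BaseChange X))) =
          ⟨α.ι X x, hι x hx⟩ + ⟨α.ι X y, hι y hy⟩ := Subtype.ext (map_add _ _ _)
      have e2 : (⟨x + y, hzQ⟩ : X.Q) = ⟨x, hxQ x hx⟩ + ⟨y, hxQ y hy⟩ := rfl
      rw [e1, e2, map_add, map_add, map_add, smul_add, ihx, ihy]
  refine ⟨{ toFun := fun y => (α.u : 𝓢'.S) • Ψ y + Θ ⟨α.mapLinear eT y, hmem y y.2⟩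
            map_add' := ?_, map_smul' := ?_ }, ?_, ?_⟩
  · intro y z
    have : (⟨α.mapLinear eT (y + z : α.baseQ X), hmem _ (y + z).2⟩ :
        (𝓢'.Fil • ⊤ : Submodule 𝓢'.S (α.BaseChange X))) =
        ⟨α.mapLinear eT y, hmem y y.2⟩ + ⟨α.mapLinear eT z, hmem z z.2⟩ :=
      Subtype.ext (map_add _ _ _)
    rw [this, map_add, Submodule.coe_add, map_add, smul_add]
    abel
  · intro s y
    have : (⟨α.mapLinear eT (s • y : α.baseQ X), hmem _ (s • y).2⟩ :
        (𝓢'.Fil • ⊤ : Submodule 𝓢'.S (α.BaseChange X))) =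
        s • ⟨α.mapLinear eT y, hmem y y.2⟩ :=
      Subtype.ext (map_smul _ _ _)
    rw [this, map_smulₛₗ, Submodule.coe_smul, map_smulₛₗ, smul_add, smul_comm]
  · intro x
    change (α.u : 𝓢'.S) • Ψ (α.ι X x) + Θ ⟨α.ι X (eT x), _⟩ = _
    have hTx := hTQ x x.2
    have hTxQ : eT x ∈ X.Q := (Submodule.smul_le.2 fun a ha t _ => X.smul_mem ⟨a, ha⟩ t) hTx
    rw [hΘι (eT x) hTx hTxQ, extend_ι, ← smul_add, ← map_add]
    congr 2
    rw [LinearMap.comp_apply, ← map_add]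
    congr 1
    exact Subtype.ext (hsum x).symm
  · intro a y
    change (α.u : 𝓢'.S) • Ψ ((a : 𝓢'.S) • y) + Θ ⟨α.mapLinear eT ((a : 𝓢'.S) • y), _⟩ = _
    have e1 : (⟨α.mapLinear eT ((a : 𝓢'.S) • y), hmem _ (α.smul_mem_baseQ X a y)⟩ :
        (𝓢'.Fil • ⊤ : Submodule 𝓢'.S (α.BaseChange X))) =
        ⟨(a : 𝓢'.S) • α.mapLinear eT y, Submodule.smul_mem_smul a.2 trivial⟩ :=
      Subtype.ext (map_smul _ _ _)
    rw [e1, hΘ _ a.2, map_smulₛₗ]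
    clear e1
    have e2 : ((α.u : 𝓢'.S) * 𝓢'.σ a) • Ψ y =
        𝓢'.σ₁ a • α.extend X X.F (α.mapLinear (X.Q.subtype ∘ₗ eL) y) := by
      induction y using α.induction with
      | zero => simp
      | add y z hy hz => simp only [map_add, smul_add, hy, hz]
      | smul s y hy => rw [map_smulₛₗ, smul_comm, hy, map_smul, map_smulₛₗ, smul_comm]
      | ι x =>
        rw [extend_ι, mapLinear_ι, extend_ι, LinearMap.comp_apply, α.smul_ι_F₁]
        rfl
    have e3 : α.mapLinear (X.Q.subtype ∘ₗ eL) y + α.mapLinear eT y = y := by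
      clear e2
      induction y using α.induction with
      | zero => simp
      | add y z hy hz =>
        rw [map_add, map_add, add_add_add_comm, hy, hz]
      | smul s y hy => rw [map_smul, map_smul, ← smul_add, hy]
      | ι x => rw [mapLinear_ι, mapLinear_ι, ← map_add]; congr 1; exact (hsum x).symm
    rw [smul_smul, e2, ← smul_add, ← map_add, e3]

/-- The operator `F₁'` on `Q'`: the unique `σ'`-linear map with `F₁' (1 ⊗ x) = u ⊗ F₁ x` for
`x ∈ Q` and `F₁' (a y) = σ₁' a · F' y` for `a ∈ Fil S'`. -/
def baseF₁ (X : Window 𝓢) : α.baseQ X →ₛₗ[𝓢'.σ] α.BaseChange X :=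
  (α.exists_F₁ X).choose

theorem baseF₁_ι (X : Window 𝓢) (x : X.Q) :
    α.baseF₁ X ⟨α.ι X x, α.ι_mem_baseQ X x⟩ = (α.u : 𝓢'.S) • α.ι X (X.F₁ x) :=
  (α.exists_F₁ X).choose_spec.1 x

theorem baseF₁_smul (X : Window 𝓢) (a : 𝓢'.Fil) (y : α.BaseChange X) :
    α.baseF₁ X ⟨(a : 𝓢'.S) • y, α.smul_mem_baseQ X a y⟩ = 𝓢'.σ₁ a • α.extend X X.F y :=
  (α.exists_F₁ X).choose_spec.2 a y

/-- The base change of a window under a frame homomorphism. -/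
def baseChangeObj (X : Window 𝓢) : Window 𝓢' where
  P := α.BaseChange X
  Q := α.baseQ X
  F := α.extend X X.F
  F₁ := α.baseF₁ X
  exists_normal_decomposition := α.exists_normal_decomposition X
  smul_mem := α.smul_mem_baseQ X
  F₁_smul := α.baseF₁_smul X
  span_range_F₁ := by
    have h : ∀ x, α.ι X x ∈ Submodule.span 𝓢'.S (Set.range (α.baseF₁ X)) := by
      intro x
      have hx : x ∈ Submodule.span 𝓢.S (Set.range X.F₁) := by rw [X.span_range_F₁]; trivial
      induction hx using Submodule.span_induction with
      | zero => rw [map_zero]; exact zero_mem _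
      | add x y _ _ hx hy => rw [map_add]; exact add_mem hx hy
      | smul s x _ hx => rw [map_smulₛₗ]; exact Submodule.smul_mem _ _ hx
      | mem x hx =>
        obtain ⟨q, rfl⟩ := hx
        have : α.ι X (X.F₁ q) = ((α.u⁻¹ : 𝓢'.Sˣ) : 𝓢'.S) •
            α.baseF₁ X ⟨α.ι X q, α.ι_mem_baseQ X q⟩ := by
          rw [baseF₁_ι, smul_smul, Units.inv_mul, one_smul]
        rw [this]
        exact Submodule.smul_mem _ _ (Submodule.subset_span ⟨_, rfl⟩)
    rw [eq_top_iff, ← α.span_range_ι X, Submodule.span_le]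
    rintro _ ⟨x, rfl⟩
    exact h x

theorem mapLinear_mem_baseQ {X Y : Window 𝓢} (f : Window.Hom X Y) :
    ∀ y ∈ α.baseQ X, α.mapLinear f.toLinearMap y ∈ α.baseQ Y := by
  suffices h : α.baseQ X ≤ Submodule.comap (α.mapLinear f.toLinearMap) (α.baseQ Y) from
    fun y hy => h hy
  refine sup_le (Submodule.span_le.2 ?_) (Submodule.smul_le.2 ?_)
  · rintro _ ⟨x, hx, rfl⟩
    exact α.ι_mem_baseQ Y ⟨_, f.map_Q x hx⟩
  · intro a ha y _
    rw [Submodule.mem_comap, map_smul]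
    exact α.smul_mem_baseQ Y ⟨a, ha⟩ _

theorem mapLinear_extend {X Y : Window 𝓢} (f : Window.Hom X Y) (y : α.BaseChange X) :
    α.mapLinear f.toLinearMap (α.extend X X.F y) =
      α.extend Y Y.F (α.mapLinear f.toLinearMap y) := by
  induction y using α.induction with
  | zero => simp
  | add y z hy hz => simp only [map_add, hy, hz]
  | smul s y hy => rw [map_smulₛₗ, map_smul, map_smul, map_smulₛₗ, hy]
  | ι x => rw [extend_ι, mapLinear_ι, mapLinear_ι, extend_ι, f.map_F]

/-- The base change of a homomorphism of windows. -/
def baseChangeMap {X Y : Window 𝓢} (f : Window.Hom X Y) :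
    Window.Hom (α.baseChangeObj X) (α.baseChangeObj Y) where
  toLinearMap := α.mapLinear f.toLinearMap
  map_Q := α.mapLinear_mem_baseQ f
  map_F := α.mapLinear_extend f
  map_F₁ y := by
    let g : α.baseQ X →ₗ[𝓢'.S] α.baseQ Y :=
      (α.mapLinear f.toLinearMap).restrict (α.mapLinear_mem_baseQ f)
    change α.mapLinear f.toLinearMap (α.baseF₁ X y) = α.baseF₁ Y (g y)
    change α.baseQ X at y
    induction y using α.baseQ_induction with
    | zero => simp
    | add y z hy hz => simp only [map_add, hy, hz]
    | smul s y hy => rw [map_smulₛₗ, map_smul, map_smul, map_smulₛₗ, hy]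
    | ι x =>
      have : g ⟨α.ι X x, α.ι_mem_baseQ X x⟩ =
          ⟨α.ι Y (f.toLinearMap x), α.ι_mem_baseQ Y ⟨_, f.map_Q x x.2⟩⟩ := rfl
      rw [this, baseF₁_ι, map_smul, mapLinear_ι, f.map_F₁]
      exact (α.baseF₁_ι Y ⟨f.toLinearMap x, f.map_Q x x.2⟩).symm
    | smul_mem a y =>
      have : g ⟨(a : 𝓢'.S) • y, α.smul_mem_baseQ X a y⟩ =
          ⟨(a : 𝓢'.S) • α.mapLinear f.toLinearMap y, α.smul_mem_baseQ Y a _⟩ :=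
        Subtype.ext (map_smul (α.mapLinear f.toLinearMap) (a : 𝓢'.S) y)
      rw [this, baseF₁_smul, baseF₁_smul, map_smul, mapLinear_extend]

/-- The base change functor `α^* : Win(𝓢) ⥤ Win(𝓢')`. -/
def baseChange : CategoryTheory.Functor (Window 𝓢) (Window 𝓢') where
  obj := α.baseChangeObj
  map f := α.baseChangeMap f
  map_id X := by
    letI := α.toRingHom.toAlgebra
    apply Window.hom_ext
    exact LinearMap.baseChange_id
  map_comp f g := by
    letI := α.toRingHom.toAlgebra
    apply Window.hom_ext
    exact LinearMap.baseChange_comp _ _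

/-- A frame homomorphism is crystalline if base change is an equivalence of the window
categories. -/
def IsCrystalline : Prop := α.baseChange.IsEquivalence

end FrameHom

section PDEnvelope

open DividedPowerAlgebra (dp)

variable (p : ℕ) {W : Type u} [CommRing W] (I : Ideal W)

/-- The relations that turn the divided power algebra `Γ_W(I)` into the divided power envelope of
`I`: the divided power `i^{[1]}` is `i` itself, and the divided powers are compatible with those
of `pℤ_p`, that is, `p^{[n]} = p ^ n / n!`. -/
def pdRelations : Ideal (DividedPowerAlgebra W I) :=
  Ideal.span ({x | ∃ i : I, x = dp W 1 i - algebraMap W _ (i : W)} ∪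
    {x | ∃ (n : ℕ) (i : I) (w : W), (i : W) = p ∧ (n ! : W) * w = (p : W) ^ n ∧
      x = dp W n i - algebraMap W _ w})

/-- The divided power envelope of the ideal `I` of `W`, with divided powers compatible with those
of `pℤ_p`. -/
def PDEnvelope : Type u := DividedPowerAlgebra W I ⧸ pdRelations p I

instance : CommRing (PDEnvelope p I) :=
  inferInstanceAs (CommRing (DividedPowerAlgebra W I ⧸ pdRelations p I))

namespace PDEnvelope

/-- The quotient map from `Γ_W(I)` to the divided power envelope. -/
def mk : DividedPowerAlgebra W I →+* PDEnvelope p I := Ideal.Quotient.mk (pdRelations p I)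

/-- The canonical map from `W` to the divided power envelope. -/
def of : W →+* PDEnvelope p I := (mk p I).comp (algebraMap W (DividedPowerAlgebra W I))

/-- The divided power `i^{[n]}` for `i ∈ I`. -/
def γ (n : ℕ) (i : I) : PDEnvelope p I := mk p I (dp W n i)

variable {p I}

theorem γ_zero (i : I) : γ p I 0 i = 1 := by
  rw [γ, DividedPowerAlgebra.dp_zero, map_one]

theorem γ_one (i : I) : γ p I 1 i = of p I i :=
  Ideal.Quotient.eq.2 (Ideal.subset_span (Or.inl ⟨i, rfl⟩))

theorem γ_smul (n : ℕ) (w : W) (i : I) : γ p I n (w • i) = of p I w ^ n * γ p I n i := by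
  rw [γ, DividedPowerAlgebra.dp_smul, Algebra.smul_def, map_mul, map_pow, map_pow]
  rfl

theorem γ_mul (m n : ℕ) (i : I) :
    γ p I m i * γ p I n i = ((m + n).choose m : PDEnvelope p I) * γ p I (m + n) i := by
  rw [γ, γ, ← map_mul, DividedPowerAlgebra.dp_mul, map_nsmul, nsmul_eq_mul, γ]

theorem γ_add (n : ℕ) (i j : I) :
    γ p I n (i + j) = ∑ k ∈ Finset.HasAntidiagonal.antidiagonal n, γ p I k.1 i * γ p I k.2 j := by
  rw [γ, DividedPowerAlgebra.dp_add, map_sum]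
  exact Finset.sum_congr rfl fun _ _ => map_mul _ _ _

theorem γ_p {n : ℕ} {i : I} {w : W} (hi : (i : W) = p) (hw : (n ! : W) * w = (p : W) ^ n) :
    γ p I n i = of p I w :=
  Ideal.Quotient.eq.2 (Ideal.subset_span (Or.inr ⟨n, i, w, hi, hw, rfl⟩))

theorem factorial_mul_γ (n : ℕ) (i : I) : (n ! : PDEnvelope p I) * γ p I n i = of p I i ^ n := by
  rw [← γ_one, γ, γ, ← map_pow, ← DividedPowerAlgebra.natFactorial_mul_dp_eq, map_mul, map_natCast]

@[elab_as_elim]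
theorem induction {motive : PDEnvelope p I → Prop} (x : PDEnvelope p I)
    (of : ∀ w, motive (of p I w)) (add : ∀ x y, motive x → motive y → motive (x + y))
    (mul : ∀ x n i, motive x → motive (x * γ p I n i)) : motive x := by
  obtain ⟨x, rfl⟩ : ∃ y, mk p I y = x := Ideal.Quotient.mk_surjective x
  induction x using DividedPowerAlgebra.induction_on with
  | C a => exact of a
  | add f g hf hg => rw [map_add]; exact add _ _ hf hg
  | dp f n m hf => rw [map_mul]; exact mul _ n m hf

variable {B : Type*} [CommRing B]

/-- Ring homomorphisms out of the divided power envelope. -/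
def lift (g : W →+* B) (f : ℕ → I → B) (h0 : ∀ i, f 0 i = 1)
    (hs : ∀ n w i, f n (w • i) = g w ^ n * f n i)
    (hm : ∀ m n i, f m i * f n i = ((m + n).choose m : B) * f (m + n) i)
    (ha : ∀ n i j, f n (i + j) = ∑ k ∈ Finset.HasAntidiagonal.antidiagonal n, f k.1 i * f k.2 j)
    (h1 : ∀ i : I, f 1 i = g i)
    (hp : ∀ (n : ℕ) (i : I) (w : W), (i : W) = p → (n ! : W) * w = (p : W) ^ n → f n i = g w) :
    PDEnvelope p I →+* B :=
  letI := g.toAlgebra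
  let F : DividedPowerAlgebra W I →ₐ[W] B := DividedPowerAlgebra.lift' (f := fun x => f x.1 x.2)
    h0 (fun n w i => by rw [hs, Algebra.smul_def, map_pow]; rfl)
    (fun m n i => by rw [hm, nsmul_eq_mul]) ha
  Ideal.Quotient.lift (pdRelations p I) F.toRingHom (by
    suffices h : pdRelations p I ≤ RingHom.ker F.toRingHom from fun a ha => h ha
    refine Ideal.span_le.2 ?_
    rintro _ (⟨i, rfl⟩ | ⟨n, i, w, hi, hw, rfl⟩)
    · simp only [SetLike.mem_coe, RingHom.mem_ker, map_sub, sub_eq_zero]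
      change F (dp W 1 i) = F (algebraMap _ _ _)
      rw [AlgHom.commutes, DividedPowerAlgebra.lift'_apply_dp, h1]
      rfl
    · simp only [SetLike.mem_coe, RingHom.mem_ker, map_sub, sub_eq_zero]
      change F (dp W n i) = F (algebraMap _ _ _)
      rw [AlgHom.commutes, DividedPowerAlgebra.lift'_apply_dp, hp n i w hi hw]
      rfl)

section lift

variable (g : W →+* B) (f : ℕ → I → B) (h0 : ∀ i, f 0 i = 1)
    (hs : ∀ n w i, f n (w • i) = g w ^ n * f n i)
    (hm : ∀ m n i, f m i * f n i = ((m + n).choose m : B) * f (m + n) i)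
    (ha : ∀ n i j, f n (i + j) = ∑ k ∈ Finset.HasAntidiagonal.antidiagonal n, f k.1 i * f k.2 j)
    (h1 : ∀ i : I, f 1 i = g i)
    (hp : ∀ (n : ℕ) (i : I) (w : W), (i : W) = p → (n ! : W) * w = (p : W) ^ n → f n i = g w)

@[simp]
theorem lift_of (w : W) : lift g f h0 hs hm ha h1 hp (of p I w) = g w := by
  letI := g.toAlgebra
  exact AlgHom.commutes (DividedPowerAlgebra.lift' (f := fun x : ℕ × I => f x.1 x.2)
    h0 (fun n w i => by rw [hs, Algebra.smul_def, map_pow]; rfl)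
    (fun m n i => by rw [hm, nsmul_eq_mul]) ha) w

@[simp]
theorem lift_γ (n : ℕ) (i : I) : lift g f h0 hs hm ha h1 hp (γ p I n i) = f n i := by
  letI := g.toAlgebra
  exact DividedPowerAlgebra.lift'_apply_dp (f := fun x : ℕ × I => f x.1 x.2)
    h0 (fun n w i => by rw [hs, Algebra.smul_def, map_pow]; rfl)
    (fun m n i => by rw [hm, nsmul_eq_mul]) ha n i

end lift

theorem hom_ext {f g : PDEnvelope p I →+* B} (hof : ∀ w, f (of p I w) = g (of p I w))
    (hγ : ∀ n i, f (γ p I n i) = g (γ p I n i)) : f = g := by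
  ext x
  induction x using induction with
  | of w => exact hof w
  | add x y hx hy => rw [map_add, map_add, hx, hy]
  | mul x n i hx => rw [map_mul, map_mul, hx, hγ]

end PDEnvelope

end PDEnvelope

/-- The properties of the ring `W(k)` with its Frobenius, for a perfect ring `k` of characteristic
`p`, that enter in the construction of `σ₁`. -/
structure IsFrobeniusBase (p : ℕ) {W : Type u} [CommRing W] (σ : W →+* W) : Prop where
  torsionFree (x : W) : (p : W) * x = 0 → x = 0
  isUnit_of_coprime (m : ℕ) : p.Coprime m → IsUnit (m : W)
  frobenius_lift (x : W) : ∃ y, σ x = x ^ p + p * y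

namespace IsFrobeniusBase

variable {p : ℕ} [hp : Fact p.Prime] {W : Type u} [CommRing W] {σ : W →+* W}

theorem natCast_cancel (h : IsFrobeniusBase p σ) {n : ℕ} (hn : n ≠ 0) {x y : W}
    (hxy : (n : W) * x = n * y) : x = y := by
  obtain ⟨v, m, hm, rfl⟩ := Nat.exists_eq_pow_mul_and_not_dvd hn p hp.out.ne_one
  obtain ⟨a, ha⟩ := h.isUnit_of_coprime m ((Nat.Prime.coprime_iff_not_dvd hp.out).2 hm)
  rw [← sub_eq_zero] at hxy ⊢
  rw [← mul_sub] at hxy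
  generalize x - y = z at *
  rw [Nat.cast_mul, Nat.cast_pow, ← ha] at hxy
  have : ∀ v : ℕ, ∀ z : W, (p : W) ^ v * z = 0 → z = 0 := by
    intro v
    induction v with
    | zero => intro z hz; simpa using hz
    | succ v ih => intro z hz; exact h.torsionFree z (ih _ (by rw [← mul_assoc, ← pow_succ, hz]))
  have := this v (a * z) (by rw [← mul_assoc, hxy])
  simpa using this

theorem exists_coeff (h : IsFrobeniusBase p σ) (n : ℕ) (hn : n ≠ 0) :
    ∃ c : W, (n ! : W) * c = (p : W) ^ (n - 1) := by
  obtain ⟨v, m, hm, hvm⟩ := Nat.exists_eq_pow_mul_and_not_dvd (Nat.factorial_ne_zero n) p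
    hp.out.ne_one
  obtain ⟨a, ha⟩ := h.isUnit_of_coprime m ((Nat.Prime.coprime_iff_not_dvd hp.out).2 hm)
  have hv : v ≤ n - 1 := by
    have h1 := padicValNat_factorial_lt_of_ne_zero p hn
    have h2 : p ^ v ∣ n ! := ⟨m, hvm⟩
    have h3 := (padicValNat_dvd_iff_le (Nat.factorial_ne_zero n)).1 h2
    omega
  refine ⟨p ^ (n - 1 - v) * (a⁻¹ : Wˣ), ?_⟩
  rw [hvm, Nat.cast_mul, Nat.cast_pow, ← ha]
  calc (p : W) ^ v * a * (p ^ (n - 1 - v) * (a⁻¹ : Wˣ))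
      = p ^ v * p ^ (n - 1 - v) * (a * (a⁻¹ : Wˣ)) := by ring
    _ = p ^ (n - 1) := by rw [Units.mul_inv, mul_one, ← pow_add, Nat.add_sub_cancel' hv]

/-- The element `p ^ (n - 1) / n!` of `W`, for `n ≥ 1`. -/
def coeff (h : IsFrobeniusBase p σ) (n : ℕ) : W :=
  if hn : n = 0 then 0 else (h.exists_coeff n hn).choose

theorem factorial_mul_coeff (h : IsFrobeniusBase p σ) {n : ℕ} (hn : n ≠ 0) :
    (n ! : W) * h.coeff n = (p : W) ^ (n - 1) := by
  rw [coeff, dif_neg hn]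
  exact (h.exists_coeff n hn).choose_spec

theorem coeff_one (h : IsFrobeniusBase p σ) : h.coeff 1 = 1 := by
  simpa using h.factorial_mul_coeff one_ne_zero

theorem factorial_mul_p_mul_coeff (h : IsFrobeniusBase p σ) {n : ℕ} (hn : n ≠ 0) :
    (n ! : W) * (p * h.coeff n) = (p : W) ^ n := by
  rw [mul_left_comm, h.factorial_mul_coeff hn, ← pow_succ', Nat.sub_add_cancel (by omega)]

theorem p_mul_coeff_mul_coeff (h : IsFrobeniusBase p σ) {m n : ℕ} (hm : m ≠ 0) (hn : n ≠ 0) :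
    (p : W) * (h.coeff m * h.coeff n) = ((m + n).choose m : W) * h.coeff (m + n) := by
  apply h.natCast_cancel (mul_ne_zero (Nat.factorial_ne_zero m) (Nat.factorial_ne_zero n))
  have h1 := h.factorial_mul_coeff (show m + n ≠ 0 by omega)
  rw [← Nat.add_choose_mul_factorial_mul_factorial] at h1
  push_cast at h1 ⊢
  calc (m ! : W) * n ! * (p * (h.coeff m * h.coeff n))
      = p * (m ! * h.coeff m) * (n ! * h.coeff n) := by ring
    _ = p ^ (m + n - 1) := by
      rw [h.factorial_mul_coeff hm, h.factorial_mul_coeff hn, ← pow_succ', ← pow_add]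
      congr 1
      omega
    _ = _ := by rw [← h1, Nat.choose_symm_add]; ring

/-- The element `δ x = (σ x - x ^ p) / p` of `W`. -/
def δ (h : IsFrobeniusBase p σ) (x : W) : W := (h.frobenius_lift x).choose

theorem σ_eq (h : IsFrobeniusBase p σ) (x : W) : σ x = x ^ p + p * h.δ x :=
  (h.frobenius_lift x).choose_spec

theorem p_cancel (h : IsFrobeniusBase p σ) {x y : W} (hxy : (p : W) * x = p * y) : x = y :=
  h.natCast_cancel hp.out.ne_zero hxy

theorem δ_mul (h : IsFrobeniusBase p σ) (x y : W) :
    h.δ (x * y) = x ^ p * h.δ y + y ^ p * h.δ x + p * (h.δ x * h.δ y) := by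
  apply h.p_cancel
  have h1 := h.σ_eq (x * y)
  rw [map_mul, h.σ_eq x, h.σ_eq y] at h1
  linear_combination -h1

theorem δ_add (h : IsFrobeniusBase p σ) (x y : W) :
    h.δ x + h.δ y = h.δ (x + y) +
      ∑ k ∈ Finset.Ioo 0 p, ((p.choose k / p : ℕ) : W) * (x ^ k * y ^ (p - k)) := by
  apply h.p_cancel
  have h1 := h.σ_eq (x + y)
  rw [map_add, h.σ_eq x, h.σ_eq y] at h1
  have h2 : (x + y) ^ p = x ^ p + y ^ p +
      p * ∑ k ∈ Finset.Ioo 0 p, ((p.choose k / p : ℕ) : W) * (x ^ k * y ^ (p - k)) := by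
    rw [add_pow_prime_eq' hp.out]
    congr 2
    exact Finset.sum_congr rfl fun k _ => by ring
  linear_combination h1 + h2

theorem σ_coeff (h : IsFrobeniusBase p σ) (n : ℕ) : σ (h.coeff n) = h.coeff n := by
  by_cases hn : n = 0
  · simp [coeff, hn]
  · apply h.natCast_cancel (Nat.factorial_ne_zero n)
    rw [← map_natCast σ, ← map_mul, map_natCast, h.factorial_mul_coeff hn, map_pow, map_natCast]

/-- The element `p ^ n / n!` of `W`. -/
def dpowP (h : IsFrobeniusBase p σ) (n : ℕ) : W := if n = 0 then 1 else p * h.coeff n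

theorem factorial_mul_dpowP (h : IsFrobeniusBase p σ) (n : ℕ) :
    (n ! : W) * h.dpowP n = (p : W) ^ n := by
  by_cases hn : n = 0
  · simp [hn, dpowP]
  · rw [dpowP, if_neg hn, h.factorial_mul_p_mul_coeff hn]

theorem eq_dpowP (h : IsFrobeniusBase p σ) {n : ℕ} {w : W} (hw : (n ! : W) * w = (p : W) ^ n) :
    w = h.dpowP n :=
  h.natCast_cancel (Nat.factorial_ne_zero n) (hw.trans (h.factorial_mul_dpowP n).symm)

theorem dpowP_mul (h : IsFrobeniusBase p σ) (k l : ℕ) :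
    h.dpowP k * h.dpowP l = ((k + l).choose k : W) * h.dpowP (k + l) := by
  apply h.natCast_cancel (mul_ne_zero (Nat.factorial_ne_zero k) (Nat.factorial_ne_zero l))
  have h1 := h.factorial_mul_dpowP (k + l)
  rw [← Nat.add_choose_mul_factorial_mul_factorial] at h1
  push_cast at h1 ⊢
  calc (k ! : W) * l ! * (h.dpowP k * h.dpowP l)
      = (k ! * h.dpowP k) * (l ! * h.dpowP l) := by ring
    _ = p ^ (k + l) := by rw [h.factorial_mul_dpowP, h.factorial_mul_dpowP, pow_add]
    _ = _ := by rw [← h1, Nat.choose_symm_add]; ring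

end IsFrobeniusBase

section Sigma

variable {p : ℕ} [hp : Fact p.Prime] {W R : Type u} [CommRing W] [CommRing R] {σ : W →+* W}

namespace IsFrobeniusBase

variable (h : IsFrobeniusBase p σ) (q : W →+* R) (hR : (p : R) = 0)

open PDEnvelope

/-- The element `p` of the kernel of `W → R`. -/
def pKer : RingHom.ker q := ⟨p, by rw [RingHom.mem_ker, map_natCast, hR]⟩

theorem σ_mem_ker (h : IsFrobeniusBase p σ) (q : W →+* R) (hR : (p : R) = 0) (i : W) (hi : i ∈ RingHom.ker q) : σ i ∈ RingHom.ker q := by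
  rw [RingHom.mem_ker] at hi ⊢
  rw [h.σ_eq, map_add, map_mul, map_pow, hi, map_natCast, hR, zero_mul, zero_pow hp.out.ne_zero,
    add_zero]

/-- The restriction of `σ` to the kernel of `W → R`. -/
def σKer (i : RingHom.ker q) : RingHom.ker q := ⟨σ i, h.σ_mem_ker q hR i i.2⟩

/-- The projection from the divided power envelope to `R`. -/
def toR : PDEnvelope p (RingHom.ker q) →+* R :=
  PDEnvelope.lift q (fun n _ => if n = 0 then 1 else 0) (fun _ => rfl)
    (fun n w i => by
      by_cases hn : n = 0 <;> simp [hn])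
    (fun m n i => by
      by_cases hm : m = 0 <;> by_cases hn : n = 0 <;> simp [hm, hn])
    (fun n i j => by
      by_cases hn : n = 0
      · simp [hn]
      · rw [if_neg hn, Finset.sum_eq_zero]
        intro k hk
        rw [Finset.HasAntidiagonal.mem_antidiagonal] at hk
        by_cases h1 : k.1 = 0
        · rw [if_neg (show k.2 ≠ 0 by omega), mul_zero]
        · rw [if_neg h1, zero_mul])
    (fun i => by simpa using (RingHom.mem_ker.1 i.2).symm)
    (fun n i w _ hw => by
      rw [h.eq_dpowP hw, dpowP]
      by_cases hn : n = 0 <;> simp [hn, hR])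

/-- The endomorphism of the divided power envelope induced by `σ`; it maps `i^{[n]}` to
`(σ i)^{[n]}`. -/
def sigma : PDEnvelope p (RingHom.ker q) →+* PDEnvelope p (RingHom.ker q) :=
  PDEnvelope.lift ((of p _).comp σ) (fun n i => γ p _ n (h.σKer q hR i)) (fun i => γ_zero _)
    (fun n w i => by
      have : h.σKer q hR (w • i) = σ w • h.σKer q hR i := Subtype.ext (map_mul σ w i)
      rw [this, γ_smul]
      rfl)
    (fun m n i => γ_mul _ _ _)
    (fun n i j => by
      have : h.σKer q hR (i + j) = h.σKer q hR i + h.σKer q hR j := Subtype.ext (map_add σ _ _)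
      rw [this, γ_add])
    (fun i => γ_one _)
    (fun n i w hi hw => by
      rw [γ_p (w := σ w)]
      · rfl
      · change σ i = p
        rw [hi, map_natCast]
      · simpa using congrArg σ hw)

/-- The element `s i = (p - 1)! i^{[p]} + δ i` of the divided power envelope, for `i` in the kernel
of `W → R`. It satisfies `p · s i = σ i`, and `σ₁ i` will be `s i`. -/
def s (i : RingHom.ker q) : PDEnvelope p (RingHom.ker q) :=
  (((p - 1)! : ℕ) : PDEnvelope p (RingHom.ker q)) * γ p _ p i + of p _ (h.δ i)

theorem p_mul_s (i : RingHom.ker q) : (p : PDEnvelope p (RingHom.ker q)) * h.s q i =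
    of p _ (σ i) := by
  rw [s, mul_add, ← mul_assoc, ← Nat.cast_mul, Nat.mul_factorial_pred hp.out.ne_zero,
    factorial_mul_γ, h.σ_eq, map_add, map_mul, map_pow, map_natCast]

theorem s_smul (w : W) (i : RingHom.ker q) : h.s q (w • i) = of p _ (σ w) * h.s q i := by
  have h1 : (p : PDEnvelope p (RingHom.ker q)) *
      ((((p - 1)! : ℕ) : PDEnvelope p (RingHom.ker q)) * γ p _ p i) =
      of p _ (i : W) ^ p := by
    rw [← mul_assoc, ← Nat.cast_mul, Nat.mul_factorial_pred hp.out.ne_zero, factorial_mul_γ]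
  have h2 : h.δ ((w • i : RingHom.ker q) : W) = w ^ p * h.δ i + (i : W) ^ p * h.δ w +
      p * (h.δ w * h.δ i) := h.δ_mul w i
  rw [s, γ_smul, s, h.σ_eq w, h2]
  simp only [map_add, map_mul, map_pow, map_natCast] at h1 ⊢
  linear_combination (-of p _ (h.δ w)) * h1

theorem s_add (i j : RingHom.ker q) : h.s q (i + j) = h.s q i + h.s q j := by
  have h1 : (((p - 1)! : ℕ) : PDEnvelope p (RingHom.ker q)) * γ p _ p (i + j) =
      (((p - 1)! : ℕ) : PDEnvelope p (RingHom.ker q)) * γ p _ p i +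
      (((p - 1)! : ℕ) : PDEnvelope p (RingHom.ker q)) * γ p _ p j +
      of p _ (∑ k ∈ Finset.Ioo 0 p, ((p.choose k / p : ℕ) : W) * ((i : W) ^ k * (j : W) ^ (p - k)))
      := by
    rw [γ_add, Finset.Nat.sum_antidiagonal_eq_sum_range_succ_mk, Finset.sum_range_succ,
      Finset.range_eq_Ico, Finset.sum_eq_sum_Ico_succ_bot hp.out.pos]
    have : Finset.Ico (0 + 1) p = Finset.Ioo 0 p := rfl
    simp only [this, Nat.sub_self, Nat.sub_zero, γ_zero, one_mul, mul_one, mul_add, map_sum,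
      Finset.mul_sum]
    have h2 : ∀ k ∈ Finset.Ioo 0 p, (((p - 1)! : ℕ) : PDEnvelope p (RingHom.ker q)) *
        (γ p _ k i * γ p _ (p - k) j) =
        of p _ (((p.choose k / p : ℕ) : W) * ((i : W) ^ k * (j : W) ^ (p - k))) := by
      intro k hk
      rw [Finset.mem_Ioo] at hk
      have h3 : (p - 1)! = (p.choose k / p) * (k ! * (p - k)!) := by
        apply Nat.eq_of_mul_eq_mul_left hp.out.pos
        rw [Nat.mul_factorial_pred hp.out.ne_zero, ← mul_assoc,
          Nat.mul_div_cancel' (hp.out.dvd_choose_self (by omega) hk.2), ← mul_assoc,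
          Nat.choose_mul_factorial_mul_factorial hk.2.le]
      rw [h3, map_mul, map_mul, map_pow, map_pow, map_natCast, ← factorial_mul_γ,
        ← factorial_mul_γ]
      push_cast
      ring
    rw [Finset.sum_congr rfl h2]
    ring
  have h4 := congrArg (of p (RingHom.ker q)) (h.δ_add i j)
  simp only [map_add] at h4
  rw [s, s, s, h1]
  have h5 : ((i + j : RingHom.ker q) : W) = i + j := rfl
  rw [h5]
  linear_combination -h4

theorem s_pKer : h.s q (pKer q hR) = 1 := by
  rw [s, γ_p (i := pKer q hR) rfl (h.factorial_mul_dpowP p), ← map_natCast (of p (RingHom.ker q)),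
    ← map_mul, ← map_add, ← map_one (of p (RingHom.ker q))]
  congr 1
  apply h.p_cancel
  have h1 := h.σ_eq (p : W)
  have h2 := h.factorial_mul_dpowP p
  rw [map_natCast] at h1
  rw [← Nat.mul_factorial_pred hp.out.ne_zero] at h2
  push_cast at h2
  change (p : W) * ((((p - 1)! : ℕ) : W) * h.dpowP p + h.δ (p : W)) = p * 1
  linear_combination h2 - h1

theorem γ_pow (i : RingHom.ker q) (k : ℕ) : ∃ N : ℕ, N * p ! ^ k = (p * k)! ∧
    γ p (RingHom.ker q) p i ^ k = N * γ p (RingHom.ker q) (p * k) i := by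
  induction k with
  | zero => exact ⟨1, by simp, by simp [γ_zero]⟩
  | succ k ih =>
    obtain ⟨N, h1, h2⟩ := ih
    refine ⟨N * (p * k + p).choose (p * k), ?_, ?_⟩
    · rw [mul_add, mul_one, ← Nat.add_choose_mul_factorial_mul_factorial, ← h1, pow_succ,
        Nat.choose_symm_add]
      ring
    · rw [pow_succ, h2, mul_assoc, γ_mul, mul_add, mul_one]
      push_cast
      ring

/-- `(i ^ p)^{[k]} = (p ^ k / k!) · ((p - 1)! i^{[p]}) ^ k`. -/
theorem γ_pow_smul (i : RingHom.ker q) (k : ℕ) :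
    γ p (RingHom.ker q) k ((i : W) ^ (p - 1) • i) =
      of p _ (h.dpowP k) * ((((p - 1)! : ℕ) : PDEnvelope p (RingHom.ker q)) * γ p _ p i) ^ k := by
  obtain ⟨N, h1, h2⟩ := γ_pow (p := p) q i k
  have hpk : (p - 1) * k + k = p * k := by
    obtain ⟨r, hr⟩ := Nat.exists_eq_succ_of_ne_zero hp.out.ne_zero
    rw [hr]
    simp [Nat.succ_mul]
  rw [γ_smul, map_pow, ← pow_mul, ← factorial_mul_γ, mul_assoc, γ_mul, hpk, mul_pow, h2]
  have h3 : ((((p - 1) * k)! * (p * k).choose ((p - 1) * k) : ℕ) : W) =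
      h.dpowP k * (((p - 1)! ^ k * N : ℕ) : W) := by
    apply h.natCast_cancel (Nat.factorial_ne_zero k)
    rw [← mul_assoc, h.factorial_mul_dpowP]
    norm_cast
    have h4 := Nat.add_choose_mul_factorial_mul_factorial ((p - 1) * k) k
    rw [hpk] at h4
    have h5 : p ^ k * (p - 1)! ^ k = p ! ^ k := by
      rw [← mul_pow, Nat.mul_factorial_pred hp.out.ne_zero]
    rw [← mul_assoc (p ^ k), h5, mul_comm (p ! ^ k), h1, ← h4, ← hpk, Nat.choose_symm_add]
    ring
  have h6 := congrArg (of p (RingHom.ker q)) h3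
  simp only [map_mul, map_pow, map_natCast, Nat.cast_mul, Nat.cast_pow] at h6
  linear_combination (γ p (RingHom.ker q) (p * k) i) * h6

/-- `(σ i)^{[n]} = (p ^ n / n!) · (s i) ^ n`. -/
theorem γ_σKer (n : ℕ) (i : RingHom.ker q) :
    γ p _ n (h.σKer q hR i) = of p _ (h.dpowP n) * h.s q i ^ n := by
  have h1 : h.σKer q hR i = (i : W) ^ (p - 1) • i + h.δ i • pKer q hR := by
    apply Subtype.ext
    change σ i = (i : W) ^ (p - 1) * i + h.δ i * p
    rw [← pow_succ, Nat.sub_add_cancel hp.out.one_le, h.σ_eq]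
    ring
  rw [h1, γ_add, s, (Commute.all _ _).add_pow', Finset.mul_sum]
  refine Finset.sum_congr rfl fun k hk => ?_
  rw [Finset.HasAntidiagonal.mem_antidiagonal] at hk
  rw [h.γ_pow_smul, γ_smul, γ_p (i := pKer q hR) rfl (h.factorial_mul_dpowP k.2), nsmul_eq_mul]
  have h2 := congrArg (of p (RingHom.ker q)) (h.dpowP_mul k.1 k.2)
  simp only [map_mul, map_natCast, hk] at h2
  linear_combination ((((p - 1)! : ℕ) : PDEnvelope p (RingHom.ker q)) * γ p _ p i) ^ k.1 *
    of p (RingHom.ker q) (h.δ i) ^ k.2 * h2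

end IsFrobeniusBase

end Sigma

/-- For a ring homomorphism `τ : W → D`, the ring `W × D` with the product
`(w, d) (w', d') = (w w', τ w d' + τ w' d + p d d')`, so that `(w, d) ↦ τ w + p d` is a ring
homomorphism to `D`. -/
@[ext]
structure Twist (p : ℕ) {W D : Type u} [CommRing W] [CommRing D] (τ : W →+* D) : Type u where
  fst : W
  snd : D

namespace Twist

variable {p : ℕ} {W D : Type u} [CommRing W] [CommRing D] (τ : W →+* D)

instance : Zero (Twist p τ) := ⟨⟨0, 0⟩⟩
instance : One (Twist p τ) := ⟨⟨1, 0⟩⟩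
instance : Add (Twist p τ) := ⟨fun x y => ⟨x.fst + y.fst, x.snd + y.snd⟩⟩
instance : Neg (Twist p τ) := ⟨fun x => ⟨-x.fst, -x.snd⟩⟩
instance : Mul (Twist p τ) :=
  ⟨fun x y => ⟨x.fst * y.fst, τ x.fst * y.snd + τ y.fst * x.snd + p * (x.snd * y.snd)⟩⟩

theorem zero_fst : (0 : Twist p τ).fst = 0 := rfl
theorem zero_snd : (0 : Twist p τ).snd = 0 := rfl
theorem one_fst : (1 : Twist p τ).fst = 1 := rfl
theorem one_snd : (1 : Twist p τ).snd = 0 := rfl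
theorem add_fst (x y : Twist p τ) : (x + y).fst = x.fst + y.fst := rfl
theorem add_snd (x y : Twist p τ) : (x + y).snd = x.snd + y.snd := rfl
theorem neg_fst (x : Twist p τ) : (-x).fst = -x.fst := rfl
theorem neg_snd (x : Twist p τ) : (-x).snd = -x.snd := rfl
theorem mul_fst (x y : Twist p τ) : (x * y).fst = x.fst * y.fst := rfl
theorem mul_snd (x y : Twist p τ) :
    (x * y).snd = τ x.fst * y.snd + τ y.fst * x.snd + p * (x.snd * y.snd) := rfl

instance : CommRing (Twist p τ) where
  add_assoc x y z := Twist.ext (add_assoc _ _ _) (add_assoc _ _ _)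
  zero_add x := Twist.ext (zero_add _) (zero_add _)
  add_zero x := Twist.ext (add_zero _) (add_zero _)
  add_comm x y := Twist.ext (add_comm _ _) (add_comm _ _)
  neg_add_cancel x := Twist.ext (neg_add_cancel _) (neg_add_cancel _)
  left_distrib x y z := Twist.ext (mul_add _ _ _) (by
    simp only [mul_snd, add_fst, add_snd, map_add]
    ring)
  right_distrib x y z := Twist.ext (add_mul _ _ _) (by
    simp only [mul_snd, add_fst, add_snd, map_add]
    ring)
  zero_mul x := Twist.ext (zero_mul _) (by
    simp only [mul_snd, zero_fst, zero_snd, map_zero]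
    ring)
  mul_zero x := Twist.ext (mul_zero _) (by
    simp only [mul_snd, zero_fst, zero_snd, map_zero]
    ring)
  mul_assoc x y z := Twist.ext (mul_assoc _ _ _) (by
    simp only [mul_snd, mul_fst, map_mul]
    ring)
  one_mul x := Twist.ext (one_mul _) (by
    simp only [mul_snd, one_fst, one_snd, map_one]
    ring)
  mul_one x := Twist.ext (mul_one _) (by
    simp only [mul_snd, one_fst, one_snd, map_one]
    ring)
  mul_comm x y := Twist.ext (mul_comm _ _) (by
    simp only [mul_snd]
    ring)
  zsmul := zsmulRec
  nsmul := nsmulRec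

theorem sub_fst (x y : Twist p τ) : (x - y).fst = x.fst - y.fst := by
  rw [sub_eq_add_neg, sub_eq_add_neg]
  rfl

theorem sub_snd (x y : Twist p τ) : (x - y).snd = x.snd - y.snd := by
  rw [sub_eq_add_neg, sub_eq_add_neg]
  rfl

/-- The ring homomorphism `w ↦ (w, 0)`. -/
def inl : W →+* Twist p τ where
  toFun w := ⟨w, 0⟩
  map_one' := rfl
  map_zero' := rfl
  map_add' x y := Twist.ext rfl (add_zero (0 : D)).symm
  map_mul' x y := Twist.ext rfl (by
    simp only [mul_snd]
    ring)

/-- The additive map `d ↦ (0, d)`. -/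
def inr : D →+ Twist p τ where
  toFun d := ⟨0, d⟩
  map_zero' := rfl
  map_add' x y := Twist.ext (add_zero (0 : W)).symm rfl

theorem inl_fst (w : W) : (inl (p := p) τ w).fst = w := rfl
theorem inl_snd (w : W) : (inl (p := p) τ w).snd = 0 := rfl
theorem inr_fst (d : D) : (inr (p := p) τ d).fst = 0 := rfl
theorem inr_snd (d : D) : (inr (p := p) τ d).snd = d := rfl

theorem inl_mul_inr (w : W) (d : D) : inl (p := p) τ w * inr τ d = inr τ (τ w * d) :=
  Twist.ext (mul_zero w) (by
    simp only [mul_snd, inl_fst, inl_snd, inr_fst, inr_snd, map_zero]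
    ring)

theorem inr_mul_inr (d d' : D) : inr (p := p) τ d * inr τ d' = inr τ (p * (d * d')) :=
  Twist.ext (mul_zero 0) (by
    simp only [mul_snd, inr_fst, inr_snd, map_zero]
    ring)

/-- The ring homomorphism `(w, d) ↦ w`. -/
def fstHom : Twist p τ →+* W where
  toFun x := x.fst
  map_one' := rfl
  map_zero' := rfl
  map_add' _ _ := rfl
  map_mul' _ _ := rfl

/-- The ring homomorphism `(w, d) ↦ τ w + p d`. -/
def total : Twist p τ →+* D where
  toFun x := τ x.fst + p * x.snd
  map_one' := by rw [one_fst, one_snd, map_one, mul_zero, add_zero]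
  map_zero' := by rw [zero_fst, zero_snd, map_zero, mul_zero, add_zero]
  map_add' x y := by
    rw [add_fst, add_snd, map_add]
    ring
  map_mul' x y := by
    rw [mul_fst, mul_snd, map_mul]
    ring

theorem total_apply (x : Twist p τ) : total τ x = τ x.fst + p * x.snd := rfl

/-- The element `(0, c n · d ^ n)` for `n ≥ 1`, and `1` for `n = 0`. -/
def T (c : ℕ → D) (n : ℕ) (d : D) : Twist p τ := if n = 0 then 1 else inr τ (c n * d ^ n)

theorem T_zero (c : ℕ → D) (d : D) : T (p := p) τ c 0 d = 1 := if_pos rfl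

theorem T_of_ne_zero (c : ℕ → D) {n : ℕ} (hn : n ≠ 0) (d : D) :
    T (p := p) τ c n d = inr τ (c n * d ^ n) := if_neg hn

theorem T_smul (c : ℕ → D) (n : ℕ) (w : W) (d : D) :
    T (p := p) τ c n (τ w * d) = inl τ w ^ n * T τ c n d := by
  by_cases hn : n = 0
  · rw [hn, T_zero, T_zero, pow_zero, one_mul]
  · rw [T_of_ne_zero τ c hn, T_of_ne_zero τ c hn, ← map_pow, inl_mul_inr, map_pow, mul_pow]
    congr 1
    ring

variable {c : ℕ → D}

theorem T_mul_T (hc : ∀ k l, k ≠ 0 → l ≠ 0 →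
    (p : D) * (c k * c l) = ((k + l).choose k : D) * c (k + l))
    {k l n : ℕ} (hn : k + l = n) (hn0 : n ≠ 0) (d d' : D) :
    T (p := p) τ c k d * T τ c l d' = inr τ (c n * ((n.choose k : D) * (d ^ k * d' ^ l))) := by
  subst hn
  by_cases hk : k = 0
  · subst hk
    have hl : l ≠ 0 := by omega
    rw [T_zero, T_of_ne_zero τ c hl, Nat.choose_zero_right, Nat.cast_one, one_mul, one_mul,
      pow_zero, one_mul, zero_add]
  by_cases hl : l = 0
  · subst hl
    rw [T_zero, T_of_ne_zero τ c hk, mul_one, add_zero, Nat.choose_self, Nat.cast_one, one_mul,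
      pow_zero, mul_one]
  rw [T_of_ne_zero τ c hk, T_of_ne_zero τ c hl, inr_mul_inr]
  congr 1
  linear_combination d ^ k * d' ^ l * hc k l hk hl

theorem T_mul (hc : ∀ k l, k ≠ 0 → l ≠ 0 →
    (p : D) * (c k * c l) = ((k + l).choose k : D) * c (k + l)) (m n : ℕ) (d : D) :
    T (p := p) τ c m d * T τ c n d = ((m + n).choose m : Twist p τ) * T τ c (m + n) d := by
  by_cases hmn : m + n = 0
  · obtain ⟨rfl, rfl⟩ : m = 0 ∧ n = 0 := by omega
    rw [T_zero, add_zero, Nat.choose_self, Nat.cast_one]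
  · rw [T_mul_T τ hc rfl hmn, T_of_ne_zero τ c hmn, ← map_natCast (inl (p := p) τ), inl_mul_inr,
      map_natCast]
    congr 1
    ring

theorem T_add (hc : ∀ k l, k ≠ 0 → l ≠ 0 →
    (p : D) * (c k * c l) = ((k + l).choose k : D) * c (k + l)) (n : ℕ) (d d' : D) :
    T (p := p) τ c n (d + d') =
      ∑ k ∈ Finset.HasAntidiagonal.antidiagonal n, T τ c k.1 d * T τ c k.2 d' := by
  by_cases hn : n = 0
  · subst hn
    simp [T_zero]
  · rw [T_of_ne_zero τ c hn, (Commute.all _ _).add_pow', Finset.mul_sum, map_sum]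
    refine Finset.sum_congr rfl fun k hk => ?_
    rw [Finset.HasAntidiagonal.mem_antidiagonal] at hk
    rw [T_mul_T τ hc hk hn, nsmul_eq_mul]

end Twist

section SigmaOne

variable {p : ℕ} [hp : Fact p.Prime] {W R : Type u} [CommRing W] [CommRing R] {σ : W →+* W}

namespace IsFrobeniusBase

variable (h : IsFrobeniusBase p σ) (q : W →+* R) (hR : (p : R) = 0)

open PDEnvelope

/-- The map `W → D` induced by `σ`, where `D` is the divided power envelope. -/
def τ (σ : W →+* W) (q : W →+* R) : W →+* PDEnvelope p (RingHom.ker q) := (of p _).comp σ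

theorem τ_apply (w : W) : τ (p := p) σ q w = of p _ (σ w) := rfl

theorem s_zero : h.s q 0 = 0 := by simpa using h.s_add q 0 0

/-- The ideal of all `(i, - s i)` in the twisted ring, for `i` in the kernel of `W → R`. -/
def graph : Ideal (Twist p (τ (p := p) σ q)) where
  carrier := {x | ∃ i : RingHom.ker q, x = ⟨(i : W), -h.s q i⟩}
  zero_mem' := ⟨0, Twist.ext rfl (by rw [h.s_zero, neg_zero]; rfl)⟩
  add_mem' := by
    rintro _ _ ⟨i, rfl⟩ ⟨j, rfl⟩
    refine ⟨i + j, Twist.ext rfl ?_⟩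
    rw [Twist.add_snd, h.s_add]
    ring
  smul_mem' := by
    rintro x _ ⟨i, rfl⟩
    refine ⟨x.fst • i, Twist.ext rfl ?_⟩
    rw [smul_eq_mul, Twist.mul_snd, h.s_smul, τ_apply, τ_apply, ← h.p_mul_s]
    ring

theorem mk_inr_s (i : RingHom.ker q) :
    Ideal.Quotient.mk (h.graph q) (Twist.inr _ (h.s q i)) =
      Ideal.Quotient.mk (h.graph q) (Twist.inl _ (i : W)) := by
  symm
  rw [Ideal.Quotient.eq]
  refine ⟨i, Twist.ext ?_ ?_⟩
  · rw [Twist.sub_fst, Twist.inl_fst, Twist.inr_fst, sub_zero]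
  · rw [Twist.sub_snd, Twist.inl_snd, Twist.inr_snd, zero_sub]

/-- The element `(0, p ^ (n - 1) / n! · d ^ n)` of the twisted ring for `n ≥ 1`, and `1` for
`n = 0`. -/
def T (n : ℕ) (d : PDEnvelope p (RingHom.ker q)) : Twist p (τ (p := p) σ q) :=
  Twist.T _ (fun n => of p _ (h.coeff n)) n d

theorem hc (k l : ℕ) (hk : k ≠ 0) (hl : l ≠ 0) :
    (p : PDEnvelope p (RingHom.ker q)) * (of p _ (h.coeff k) * of p _ (h.coeff l)) =
      ((k + l).choose k : PDEnvelope p (RingHom.ker q)) * of p _ (h.coeff (k + l)) := by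
  have := congrArg (of p (RingHom.ker q)) (h.p_mul_coeff_mul_coeff hk hl)
  rwa [map_mul, map_mul, map_mul, map_natCast, map_natCast] at this

theorem T_zero (d : PDEnvelope p (RingHom.ker q)) : h.T q 0 d = 1 := Twist.T_zero _ _ _

theorem T_of_ne_zero {n : ℕ} (hn : n ≠ 0) (d : PDEnvelope p (RingHom.ker q)) :
    h.T q n d = Twist.inr _ (of p _ (h.coeff n) * d ^ n) :=
  Twist.T_of_ne_zero _ _ hn _

/-- The ring homomorphism from the divided power envelope to the quotient of the twisted ring by
the graph of `-s`, with `w ↦ (w, 0)` and `i^{[n]} ↦ (0, p ^ (n - 1) / n! · (s i) ^ n)`. -/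
def Φ : PDEnvelope p (RingHom.ker q) →+* Twist p (τ (p := p) σ q) ⧸ h.graph q :=
  PDEnvelope.lift ((Ideal.Quotient.mk (h.graph q)).comp (Twist.inl _))
    (fun n i => Ideal.Quotient.mk _ (h.T q n (h.s q i)))
    (fun i => by rw [h.T_zero, map_one])
    (fun n w i => by
      rw [h.s_smul, RingHom.comp_apply, ← map_pow, ← map_mul]
      exact congrArg _ (Twist.T_smul (τ (p := p) σ q) _ n w _))
    (fun m n i => by
      rw [← map_mul, ← map_natCast (Ideal.Quotient.mk (h.graph q)), ← map_mul]
      exact congrArg _ (Twist.T_mul _ (h.hc q) m n _))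
    (fun n i j => by
      rw [h.s_add]
      refine (congrArg _ (Twist.T_add _ (h.hc q) n _ _)).trans ?_
      rw [map_sum]
      exact Finset.sum_congr rfl fun k _ => map_mul _ _ _)
    (fun i => by
      rw [h.T_of_ne_zero q one_ne_zero, h.coeff_one, map_one, one_mul, pow_one, mk_inr_s]
      rfl)
    (fun n i w hi hw => by
      obtain rfl : i = pKer q hR := Subtype.ext hi
      rw [h.eq_dpowP hw, h.s_pKer q hR]
      by_cases hn : n = 0
      · rw [hn, h.T_zero, dpowP, if_pos rfl, map_one, map_one]
      · have h1 := h.mk_inr_s q (h.coeff n • pKer q hR)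
        rw [h.s_smul, h.s_pKer, h.σ_coeff] at h1
        rw [h.T_of_ne_zero q hn, one_pow, h1, dpowP, if_neg hn, mul_comm]
        rfl)

theorem Φ_of (w : W) : h.Φ q hR (of p _ w) = Ideal.Quotient.mk _ (Twist.inl _ w) :=
  lift_of _ _ _ _ _ _ _ _ _

theorem Φ_γ (n : ℕ) (i : RingHom.ker q) :
    h.Φ q hR (γ p _ n i) = Ideal.Quotient.mk _ (h.T q n (h.s q i)) :=
  lift_γ _ _ _ _ _ _ _ _ _ _

theorem toR_of (w : W) : h.toR q hR (of p _ w) = q w := lift_of _ _ _ _ _ _ _ _ _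

theorem toR_γ (n : ℕ) (i : RingHom.ker q) :
    h.toR q hR (γ p _ n i) = if n = 0 then 1 else 0 := lift_γ _ _ _ _ _ _ _ _ _ _

theorem sigma_of (w : W) : h.sigma q hR (of p _ w) = of p _ (σ w) := lift_of _ _ _ _ _ _ _ _ _

theorem sigma_γ (n : ℕ) (i : RingHom.ker q) :
    h.sigma q hR (γ p _ n i) = γ p _ n (h.σKer q hR i) := lift_γ _ _ _ _ _ _ _ _ _ _

/-- `sigma` factors through `Φ`. -/
theorem total_eq_sigma {x : PDEnvelope p (RingHom.ker q)} {y : Twist p (τ (p := p) σ q)}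
    (hxy : h.Φ q hR x = Ideal.Quotient.mk _ y) : Twist.total _ y = h.sigma q hR x := by
  let e : Twist p (τ (p := p) σ q) ⧸ h.graph q →+* PDEnvelope p (RingHom.ker q) :=
    Ideal.Quotient.lift _ (Twist.total _) (by
      rintro _ ⟨i, rfl⟩
      rw [Twist.total_apply, τ_apply, ← h.p_mul_s]
      ring)
  have he : e.comp (h.Φ q hR) = h.sigma q hR := by
    refine hom_ext (fun w => ?_) (fun n i => ?_)
    · rw [RingHom.comp_apply, Φ_of, sigma_of]
      change Twist.total _ (Twist.inl _ w) = _
      rw [Twist.total_apply, Twist.inl_fst, Twist.inl_snd, mul_zero, add_zero]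
      rfl
    · rw [RingHom.comp_apply, Φ_γ, sigma_γ, h.γ_σKer]
      change Twist.total _ (h.T q n (h.s q i)) = _
      by_cases hn : n = 0
      · rw [hn, h.T_zero, dpowP, if_pos rfl, map_one, map_one, pow_zero, one_mul]
      · rw [h.T_of_ne_zero q hn, dpowP, if_neg hn]
        rw [Twist.total_apply, Twist.inr_fst, Twist.inr_snd, map_zero, zero_add, map_mul,
          map_natCast, mul_assoc]
  rw [← he, RingHom.comp_apply, hxy]
  rfl

theorem fst_eq_toR {x : PDEnvelope p (RingHom.ker q)} {y : Twist p (τ (p := p) σ q)}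
    (hxy : h.Φ q hR x = Ideal.Quotient.mk _ y) : q (Twist.fstHom _ y) = h.toR q hR x := by
  let e : Twist p (τ (p := p) σ q) ⧸ h.graph q →+* R :=
    Ideal.Quotient.lift _ (q.comp (Twist.fstHom _)) (by
      rintro _ ⟨i, rfl⟩
      exact i.2)
  have he : e.comp (h.Φ q hR) = h.toR q hR := by
    refine hom_ext (fun w => ?_) (fun n i => ?_)
    · rw [RingHom.comp_apply, Φ_of, toR_of]
      rfl
    · rw [RingHom.comp_apply, Φ_γ, toR_γ]
      change q (Twist.fstHom _ (h.T q n (h.s q i))) = _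
      by_cases hn : n = 0
      · rw [hn, h.T_zero, if_pos rfl, map_one, map_one]
      · rw [h.T_of_ne_zero q hn, if_neg hn]
        exact map_zero q
  rw [← he, RingHom.comp_apply, hxy]
  rfl

theorem exists_rep (x : RingHom.ker (h.toR q hR)) : ∃ y : RingHom.ker q × PDEnvelope p (RingHom.ker q),
    h.Φ q hR x = Ideal.Quotient.mk (h.graph q) ⟨(y.1 : W), y.2⟩ := by
  obtain ⟨y, hy⟩ := Ideal.Quotient.mk_surjective (h.Φ q hR x)
  refine ⟨⟨⟨y.fst, ?_⟩, y.snd⟩, hy.symm⟩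
  have := h.fst_eq_toR q hR hy.symm
  rwa [RingHom.mem_ker.1 x.2] at this

/-- The value of `σ₁` at an element of the kernel of `D → R`: if the element is represented by
`(i, d)` in the twisted ring, it is `s i + d`. -/
def σ₁Fun (x : RingHom.ker (h.toR q hR)) : PDEnvelope p (RingHom.ker q) :=
  h.s q (h.exists_rep q hR x).choose.1 + (h.exists_rep q hR x).choose.2

theorem σ₁Fun_eq (x : RingHom.ker (h.toR q hR)) (i : RingHom.ker q)
    (d : PDEnvelope p (RingHom.ker q))
    (hx : h.Φ q hR x = Ideal.Quotient.mk (h.graph q) ⟨(i : W), d⟩) :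
    h.σ₁Fun q hR x = h.s q i + d := by
  rw [σ₁Fun]
  generalize hy : (h.exists_rep q hR x).choose = y
  have hy' := (h.exists_rep q hR x).choose_spec
  rw [hy, hx, eq_comm, Ideal.Quotient.eq] at hy'
  obtain ⟨j, hj⟩ := hy'
  have h1 : (y.1 : W) - i = j := by
    have := congrArg Twist.fst hj
    rwa [Twist.sub_fst] at this
  have h2 : y.2 - d = -h.s q j := by
    have := congrArg Twist.snd hj
    rwa [Twist.sub_snd] at this
  have h3 : y.1 = i + j := Subtype.ext (by
    change (y.1 : W) = i + j
    rw [← h1]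
    ring)
  rw [h3, h.s_add]
  linear_combination h2

/-- The `σ`-linear map `σ₁` on the kernel of the map `D → R`, where `D` is the divided power
envelope of the kernel of `W → R`. -/
def σ₁ : RingHom.ker (h.toR q hR) →ₛₗ[h.sigma q hR] PDEnvelope p (RingHom.ker q) where
  toFun := h.σ₁Fun q hR
  map_add' x y := by
    obtain ⟨⟨i, d⟩, hx⟩ := h.exists_rep q hR x
    obtain ⟨⟨j, e⟩, hy⟩ := h.exists_rep q hR y
    rw [h.σ₁Fun_eq q hR x i d hx, h.σ₁Fun_eq q hR y j e hy,
      h.σ₁Fun_eq q hR (x + y) (i + j) (d + e), h.s_add]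
    · ring
    · rw [Submodule.coe_add, map_add, hx, hy, ← map_add]
      rfl
  map_smul' c x := by
    obtain ⟨⟨i, d⟩, hx⟩ := h.exists_rep q hR x
    obtain ⟨⟨w, e⟩, hc⟩ := Ideal.Quotient.mk_surjective (h.Φ q hR c)
    have hc' := h.total_eq_sigma q hR hc.symm
    rw [Twist.total_apply, τ_apply] at hc'
    dsimp only at hc'
    rw [h.σ₁Fun_eq q hR x i d hx, h.σ₁Fun_eq q hR (c • x) (w • i)
      (of p _ (σ w) * d + of p _ (σ i) * e + (p : PDEnvelope p (RingHom.ker q)) * (e * d)), ← hc', h.s_smul, ← h.p_mul_s, smul_eq_mul]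
    · ring
    · rw [Submodule.coe_smul, smul_eq_mul, map_mul, hx, ← hc, ← map_mul]
      rfl

theorem σ₁_eq (x : RingHom.ker (h.toR q hR)) (i : RingHom.ker q)
    (d : PDEnvelope p (RingHom.ker q))
    (hx : h.Φ q hR x = Ideal.Quotient.mk (h.graph q) ⟨(i : W), d⟩) :
    h.σ₁ q hR x = h.s q i + d :=
  h.σ₁Fun_eq q hR x i d hx

theorem p_mul_σ₁ (x : RingHom.ker (h.toR q hR)) :
    (p : PDEnvelope p (RingHom.ker q)) * h.σ₁ q hR x = h.sigma q hR x := by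
  obtain ⟨⟨i, d⟩, hx⟩ := h.exists_rep q hR x
  rw [h.σ₁_eq q hR x i d hx, ← h.total_eq_sigma q hR hx, mul_add, h.p_mul_s]
  rfl

/-- `σ₁ (i^{[n]}) = p ^ (n - 1) / n! · (s i) ^ n` for `n ≥ 1`. -/
theorem σ₁_γ (n : ℕ) (hn : n ≠ 0) (i : RingHom.ker q)
    (hi : γ p _ n i ∈ RingHom.ker (h.toR q hR)) :
    h.σ₁ q hR ⟨γ p _ n i, hi⟩ = of p _ (h.coeff n) * h.s q i ^ n := by
  rw [h.σ₁_eq q hR _ 0 (of p _ (h.coeff n) * h.s q i ^ n)]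
  · rw [h.s_zero, zero_add]
  · rw [Φ_γ, h.T_of_ne_zero q hn]
    rfl

theorem σ₁_p (x : RingHom.ker (h.toR q hR)) (hx : (x : PDEnvelope p (RingHom.ker q)) = p) :
    h.σ₁ q hR x = 1 := by
  rw [h.σ₁_eq q hR _ (pKer q hR) 0, h.s_pKer, add_zero]
  rw [hx, ← map_natCast (of p (RingHom.ker q)), Φ_of]
  rfl

theorem γ_pow_eq (n k : ℕ) (i : RingHom.ker q) : ∃ N : ℕ, N * n ! ^ k = (k * n)! ∧
    γ p (RingHom.ker q) n i ^ k = N * γ p (RingHom.ker q) (k * n) i := by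
  induction k with
  | zero => exact ⟨1, by simp, by simp [γ_zero]⟩
  | succ k ih =>
    obtain ⟨N, h1, h2⟩ := ih
    refine ⟨N * (k * n + n).choose (k * n), ?_, ?_⟩
    · rw [add_mul, one_mul, ← Nat.add_choose_mul_factorial_mul_factorial, ← h1, pow_succ,
        Nat.choose_symm_add]
      ring
    · rw [pow_succ, h2, mul_assoc, γ_mul, add_mul, one_mul]
      push_cast
      ring

theorem exists_γ_pow (n : ℕ) (hn : n ≠ 0) (i : RingHom.ker q) :
    ∃ c, γ p (RingHom.ker q) n i ^ p = p * c := by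
  obtain ⟨N, h1, h2⟩ := γ_pow_eq (p := p) q n p i
  have h3 : N = p * ((p - 1)! * Nat.uniformBell p n) := by
    apply Nat.eq_of_mul_eq_mul_right (pow_pos (Nat.factorial_pos n) p)
    rw [h1, ← Nat.uniformBell_mul_eq p hn, ← mul_assoc, Nat.mul_factorial_pred hp.out.ne_zero]
    ring
  rw [h2, h3, Nat.cast_mul, mul_assoc]
  exact ⟨_, rfl⟩

/-- `sigma` is a lift of Frobenius. -/
theorem exists_sigma_eq (x : PDEnvelope p (RingHom.ker q)) :
    ∃ y, h.sigma q hR x = x ^ p + p * y := by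
  induction x using PDEnvelope.induction with
  | of w =>
    refine ⟨of p _ (h.δ w), ?_⟩
    rw [sigma_of, h.σ_eq, map_add, map_mul, map_pow, map_natCast]
  | add x y hx hy =>
    obtain ⟨a, ha⟩ := hx
    obtain ⟨b, hb⟩ := hy
    obtain ⟨r, hr⟩ := exists_add_pow_prime_eq hp.out x y
    refine ⟨a + b - x * y * r, ?_⟩
    rw [map_add, ha, hb, hr]
    ring
  | mul x n i hx =>
    obtain ⟨a, ha⟩ := hx
    have h1 : ∃ b, h.sigma q hR (γ p _ n i) = γ p _ n i ^ p + p * b := by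
      by_cases hn : n = 0
      · refine ⟨0, ?_⟩
        subst hn
        rw [γ_zero, map_one]
        simp
      · obtain ⟨c, hc⟩ := exists_γ_pow (p := p) q n hn i
        rw [sigma_γ, h.γ_σKer, dpowP, if_neg hn, map_mul, map_natCast, hc]
        exact ⟨of p _ (h.coeff n) * h.s q i ^ n - c, by ring⟩
    obtain ⟨b, hb⟩ := h1
    rw [map_mul, ha, hb]
    exact ⟨x ^ p * b + a * γ p _ n i ^ p + p * (a * b), by ring⟩

end IsFrobeniusBase

end SigmaOne

section Completion

namespace Completion

variable {p : ℕ} {D R : Type u} [CommRing D] [CommRing R]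

/-- The `p`-adic completion of a ring. -/
abbrev Compl (p : ℕ) (D : Type u) [CommRing D] : Type u :=
  AdicCompletion (Ideal.span {(p : D)}) D

open AdicCompletion (evalₐ evalOneₐ)

theorem evalₐ_of_le {m n : ℕ} (hmn : m ≤ n) (x : Compl p D) (d : D)
    (hx : evalₐ (Ideal.span {(p : D)}) n x = Ideal.Quotient.mk _ d) :
    evalₐ (Ideal.span {(p : D)}) m x = Ideal.Quotient.mk _ d := by
  obtain ⟨f, rfl⟩ := AdicCompletion.mk_surjective _ _ x
  rw [AdicCompletion.evalₐ_mk, Ideal.Quotient.eq] at hx ⊢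
  have h1 := f.2 hmn
  rw [SModEq.sub_mem, smul_eq_mul, Ideal.mul_top] at h1
  have h2 := Ideal.pow_le_pow_right hmn hx
  have := add_mem h1 h2
  simpa using this

theorem evalOneₐ_eq (x : Compl p D) (d : D)
    (hx : evalₐ (Ideal.span {(p : D)}) 1 x = Ideal.Quotient.mk _ d) :
    evalOneₐ (Ideal.span {(p : D)}) x = Ideal.Quotient.mk _ d := by
  rw [← AdicCompletion.factorₐ_evalₐ_one, hx]
  rfl

theorem exists_evalₐ_eq (n : ℕ) (x : Compl p D) :
    ∃ d, evalₐ (Ideal.span {(p : D)}) n x = Ideal.Quotient.mk _ d := by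
  obtain ⟨d, hd⟩ := Ideal.Quotient.mk_surjective (evalₐ (Ideal.span {(p : D)}) n x)
  exact ⟨d, hd.symm⟩

theorem pow_le_comap (σ : D →+* D) (n : ℕ) :
    Ideal.span {(p : D)} ^ n ≤ (Ideal.span {(p : D)} ^ n).comap σ := by
  rw [Ideal.span_singleton_pow, Ideal.span_singleton_le_iff_mem, Ideal.mem_comap, map_pow,
    map_natCast]
  exact Ideal.mem_span_singleton_self _

theorem map_aux (σ : D →+* D) {m n : ℕ} (hmn : m ≤ n) :
    (Ideal.Quotient.factorPow (Ideal.span {(p : D)}) hmn).comp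
      ((Ideal.quotientMap (Ideal.span {(p : D)} ^ n) σ (pow_le_comap σ n)).comp
        (evalₐ (Ideal.span {(p : D)}) n : Compl p D →+* _)) =
      (Ideal.quotientMap (Ideal.span {(p : D)} ^ m) σ (pow_le_comap σ m)).comp
        (evalₐ (Ideal.span {(p : D)}) m : Compl p D →+* _) := by
  ext x
  obtain ⟨d, hd⟩ := exists_evalₐ_eq n x
  have hd' := evalₐ_of_le hmn x d hd
  simp only [RingHom.comp_apply, RingHom.coe_coe, hd, hd', Ideal.quotientMap_mk]
  rfl

/-- The extension of a ring endomorphism to the `p`-adic completion. -/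
def map (σ : D →+* D) : Compl p D →+* Compl p D :=
  AdicCompletion.liftRingHom _
    (fun n => (Ideal.quotientMap (Ideal.span {(p : D)} ^ n) σ (pow_le_comap σ n)).comp
      (evalₐ (Ideal.span {(p : D)}) n : Compl p D →+* _))
    (map_aux σ)

theorem evalₐ_map (σ : D →+* D) (n : ℕ) (x : Compl p D) (d : D)
    (hx : evalₐ (Ideal.span {(p : D)}) n x = Ideal.Quotient.mk _ d) :
    evalₐ (Ideal.span {(p : D)}) n (map σ x) = Ideal.Quotient.mk _ (σ d) := by
  rw [map, AdicCompletion.evalₐ_liftRingHom _ _ (map_aux σ), RingHom.comp_apply, RingHom.coe_coe, hx,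
    Ideal.quotientMap_mk]

/-- The extension of a ring homomorphism `D → R` with `p R = 0` to the `p`-adic completion. -/
def toQuot (r : D →+* R) (hR : (p : R) = 0) : Compl p D →+* R :=
  (Ideal.Quotient.lift (Ideal.span {(p : D)}) r (fun a ha => by
    obtain ⟨b, rfl⟩ := Ideal.mem_span_singleton'.1 ha
    rw [map_mul, map_natCast, hR, mul_zero])).comp (evalOneₐ (Ideal.span {(p : D)}) : Compl p D →+* _)

theorem toQuot_eq (r : D →+* R) (hR : (p : R) = 0) (n : ℕ) (x : Compl p D) (d : D)
    (hx : evalₐ (Ideal.span {(p : D)}) (n + 1) x = Ideal.Quotient.mk _ d) :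
    toQuot r hR x = r d := by
  rw [toQuot, RingHom.comp_apply, RingHom.coe_coe,
    evalOneₐ_eq x d (evalₐ_of_le (Nat.le_add_left 1 n) x d hx), Ideal.Quotient.lift_mk]

theorem exists_rep (r : D →+* R) (hR : (p : R) = 0) (x : RingHom.ker (toQuot (p := p) r hR))
    (n : ℕ) : ∃ d : RingHom.ker r,
      evalₐ (Ideal.span {(p : D)}) (n + 1) x = Ideal.Quotient.mk _ (d : D) := by
  obtain ⟨d, hd⟩ := exists_evalₐ_eq (n + 1) (x : Compl p D)
  refine ⟨⟨d, ?_⟩, hd⟩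
  rw [RingHom.mem_ker, ← toQuot_eq r hR n x d hd]
  exact x.2

variable {σ : D →+* D}

theorem σ₁_sub_mem (r : D →+* R) (σ₁ : RingHom.ker r →ₛₗ[σ] D) (e : RingHom.ker r)
    (he : (e : D) = p) (he1 : σ₁ e = 1) {n : ℕ} {a b : RingHom.ker r}
    (hab : (a : D) - b ∈ Ideal.span {(p : D)} ^ (n + 1)) :
    σ₁ a - σ₁ b ∈ Ideal.span {(p : D)} ^ n := by
  rw [Ideal.span_singleton_pow] at hab ⊢
  obtain ⟨c, hc⟩ := Ideal.mem_span_singleton'.1 hab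
  have h1 : a - b = (c * (p : D) ^ n) • e := Subtype.ext (by
    change (a : D) - b = c * (p : D) ^ n * e
    rw [← hc, he]
    ring)
  rw [← map_sub, h1, map_smulₛₗ, he1, smul_eq_mul, mul_one, map_mul, map_pow, map_natCast]
  exact Ideal.mul_mem_left _ _ (Ideal.mem_span_singleton_self _)

/-- The value of the extension of `σ₁` to the `p`-adic completion: if `x` is congruent to `d`
modulo `p ^ (n + 1)`, the value at `x` is congruent to `σ₁ d` modulo `p ^ n`. -/
def σ₁Fun (r : D →+* R) (hR : (p : R) = 0) (σ₁ : RingHom.ker r →ₛₗ[σ] D) (e : RingHom.ker r)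
    (he : (e : D) = p) (he1 : σ₁ e = 1) (x : RingHom.ker (toQuot (p := p) r hR)) : Compl p D :=
  AdicCompletion.mk _ _ (AdicCompletion.AdicCauchySequence.mk _ _
    (fun n => σ₁ (exists_rep r hR x n).choose) (fun n => by
      rw [SModEq.sub_mem, smul_eq_mul, Ideal.mul_top]
      refine σ₁_sub_mem r σ₁ e he he1 ?_
      have h1 := (exists_rep r hR x n).choose_spec
      have h2 := evalₐ_of_le (Nat.le_succ _) _ _ (exists_rep r hR x (n + 1)).choose_spec
      rw [← Ideal.Quotient.eq, ← h1, ← h2]))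

theorem evalₐ_σ₁Fun (r : D →+* R) (hR : (p : R) = 0) (σ₁ : RingHom.ker r →ₛₗ[σ] D)
    (e : RingHom.ker r) (he : (e : D) = p) (he1 : σ₁ e = 1)
    (x : RingHom.ker (toQuot (p := p) r hR)) (n : ℕ) (d : RingHom.ker r)
    (hd : evalₐ (Ideal.span {(p : D)}) (n + 1) x = Ideal.Quotient.mk _ (d : D)) :
    evalₐ (Ideal.span {(p : D)}) n (σ₁Fun r hR σ₁ e he he1 x) = Ideal.Quotient.mk _ (σ₁ d) := by
  rw [σ₁Fun, AdicCompletion.evalₐ_mk, Ideal.Quotient.eq]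
  refine σ₁_sub_mem r σ₁ e he he1 ?_
  rw [← Ideal.Quotient.eq, ← hd]
  exact (exists_rep r hR x n).choose_spec.symm

/-- The extension of `σ₁` to the `p`-adic completion. -/
def mapσ₁ (r : D →+* R) (hR : (p : R) = 0) (σ₁ : RingHom.ker r →ₛₗ[σ] D)
    (e : RingHom.ker r) (he : (e : D) = p) (he1 : σ₁ e = 1) :
    RingHom.ker (toQuot (p := p) r hR) →ₛₗ[map (p := p) σ] Compl p D where
  toFun := σ₁Fun r hR σ₁ e he he1
  map_add' x y := AdicCompletion.ext_evalₐ fun n => by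
    obtain ⟨a, ha⟩ := exists_rep r hR x n
    obtain ⟨b, hb⟩ := exists_rep r hR y n
    rw [map_add, evalₐ_σ₁Fun r hR σ₁ e he he1 x n a ha, evalₐ_σ₁Fun r hR σ₁ e he he1 y n b hb,
      evalₐ_σ₁Fun r hR σ₁ e he he1 (x + y) n (a + b), map_add, map_add]
    rw [Submodule.coe_add, map_add, ha, hb, Submodule.coe_add, map_add]
  map_smul' c x := AdicCompletion.ext_evalₐ fun n => by
    obtain ⟨a, ha⟩ := exists_rep r hR x n
    obtain ⟨b, hb⟩ := exists_evalₐ_eq (n + 1) c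
    rw [smul_eq_mul, map_mul, evalₐ_σ₁Fun r hR σ₁ e he he1 x n a ha,
      evalₐ_map σ n c b (evalₐ_of_le (Nat.le_succ n) c b hb),
      evalₐ_σ₁Fun r hR σ₁ e he he1 (c • x) n (b • a), map_smulₛₗ, smul_eq_mul, map_mul]
    rw [Submodule.coe_smul, smul_eq_mul, map_mul, ha, hb, Submodule.coe_smul, smul_eq_mul, map_mul]

theorem evalₐ_mapσ₁ (r : D →+* R) (hR : (p : R) = 0) (σ₁ : RingHom.ker r →ₛₗ[σ] D)
    (e : RingHom.ker r) (he : (e : D) = p) (he1 : σ₁ e = 1)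
    (x : RingHom.ker (toQuot (p := p) r hR)) (n : ℕ) (d : RingHom.ker r)
    (hd : evalₐ (Ideal.span {(p : D)}) (n + 1) x = Ideal.Quotient.mk _ (d : D)) :
    evalₐ (Ideal.span {(p : D)}) n (mapσ₁ r hR σ₁ e he he1 x) = Ideal.Quotient.mk _ (σ₁ d) :=
  evalₐ_σ₁Fun r hR σ₁ e he he1 x n d hd

theorem span_p_eq_ker : Ideal.span {(p : Compl p D)} =
    RingHom.ker (evalOneₐ (Ideal.span {(p : D)})).toRingHom := by
  rw [AdicCompletion.ker_evalOneₐ_eq_map _ ⟨{(p : D)}, by simp⟩, Ideal.map_span,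
    Set.image_singleton, map_natCast]

theorem span_p_le_jacobson : Ideal.span {(p : Compl p D)} ≤ Ideal.jacobson ⊥ := by
  have fg : (Ideal.span {(p : D)}).FG := ⟨{(p : D)}, by simp⟩
  have := AdicCompletion.isAdicComplete_self _ fg
  rw [Ideal.map_span, Set.image_singleton, map_natCast] at this
  exact IsAdicComplete.le_jacobson_bot _

/-- The frame defined by the `p`-adic completion of `D`. -/
def frame (r : D →+* R) (hR : (p : R) = 0) (σ₁ : RingHom.ker r →ₛₗ[σ] D)
    (e : RingHom.ker r) (he : (e : D) = p) (he1 : σ₁ e = 1)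
    (hσ : ∀ x, ∃ y, σ x = x ^ p + p * y)
    (hr : RingHom.ker r ≤ (Ideal.span {(p : D)}).radical) : Frame.{u} p where
  S := Compl p D
  Fil := RingHom.ker (toQuot (p := p) r hR)
  σ := map σ
  σ₁ := mapσ₁ r hR σ₁ e he he1
  le_jacobson := by
    refine sup_le span_p_le_jacobson fun x hx => ?_
    obtain ⟨d, hd⟩ := exists_rep r hR ⟨x, hx⟩ 0
    obtain ⟨N, hN⟩ := hr d.2
    refine Ideal.isRadical_jacobson ⊥ ⟨N, span_p_le_jacobson ?_⟩
    rw [span_p_eq_ker, RingHom.mem_ker, map_pow]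
    change evalOneₐ _ x ^ N = 0
    rw [evalOneₐ_eq x d hd, ← map_pow]
    exact Ideal.Quotient.eq_zero_iff_mem.2 hN
  frobenius_lift x := by
    obtain ⟨d, hd⟩ := exists_evalₐ_eq 1 x
    obtain ⟨y, hy⟩ := hσ d
    rw [span_p_eq_ker, RingHom.mem_ker, map_sub, map_pow]
    change evalOneₐ _ (map σ x) - evalOneₐ _ x ^ p = 0
    rw [evalOneₐ_eq x d hd, evalOneₐ_eq _ _ (evalₐ_map σ 1 x d hd), ← map_pow, ← map_sub, hy]
    refine Ideal.Quotient.eq_zero_iff_mem.2 (Ideal.mem_span_singleton'.2 ⟨y, by ring⟩)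
  span_range_σ₁ := by
    rw [Ideal.eq_top_iff_one]
    have hp : (p : Compl p D) ∈ RingHom.ker (toQuot (p := p) r hR) := by
      rw [RingHom.mem_ker, map_natCast, hR]
    refine Ideal.subset_span ⟨⟨p, hp⟩, AdicCompletion.ext_evalₐ fun n => ?_⟩
    rw [evalₐ_mapσ₁ r hR σ₁ e he he1 ⟨p, hp⟩ n e, he1, map_one, map_one]
    rw [he, map_natCast, map_natCast]

end Completion

end Completion

section Acris

namespace IsFrobeniusBase

open PDEnvelope

/-- The kernel of the projection from the divided power envelope to `R` is nil modulo `p`. -/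
theorem ker_toR_le_radical {p : ℕ} [hp : Fact p.Prime] {W R : Type u} [CommRing W] [CommRing R]
    {σ : W →+* W} (h : IsFrobeniusBase p σ) (q : W →+* R) (hR : (p : R) = 0) :
    RingHom.ker (h.toR q hR) ≤
      (Ideal.span {(p : PDEnvelope p (RingHom.ker q))}).radical := by
  have key : ∀ n ≠ 0, ∀ i : RingHom.ker q, γ p (RingHom.ker q) n i ∈
      (Ideal.span {(p : PDEnvelope p (RingHom.ker q))}).radical ⊓ RingHom.ker (h.toR q hR) := by
    intro n hn i
    obtain ⟨c, hc⟩ := exists_γ_pow (p := p) q n hn i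
    refine ⟨⟨p, ?_⟩, ?_⟩
    · rw [hc]
      exact Ideal.mul_mem_right _ _ (Ideal.mem_span_singleton_self _)
    · change h.toR q hR _ = 0
      rw [toR_γ, if_neg hn]
  have h1 : ∀ x : PDEnvelope p (RingHom.ker q), ∃ w, x - of p _ w ∈
      (Ideal.span {(p : PDEnvelope p (RingHom.ker q))}).radical ⊓ RingHom.ker (h.toR q hR) := by
    intro x
    induction x using PDEnvelope.induction with
    | of w => exact ⟨w, by rw [sub_self]; exact zero_mem _⟩
    | add x y hx hy =>
      obtain ⟨v, hv⟩ := hx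
      obtain ⟨w, hw⟩ := hy
      refine ⟨v + w, ?_⟩
      rw [map_add, add_sub_add_comm]
      exact add_mem hv hw
    | mul x n i hx =>
      by_cases hn : n = 0
      · rw [hn, γ_zero, mul_one]
        exact hx
      · refine ⟨0, ?_⟩
        rw [map_zero, sub_zero]
        exact Ideal.mul_mem_left _ _ (key n hn i)
  intro x hx
  obtain ⟨w, hw⟩ := h1 x
  have hw0 : q w = 0 := by
    have h2 := hw.2
    change h.toR q hR (x - of p _ w) = 0 at h2
    rwa [map_sub, RingHom.mem_ker.1 hx, toR_of, zero_sub, neg_eq_zero] at h2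
  have h3 := (key 1 one_ne_zero ⟨w, hw0⟩).1
  rw [γ_one] at h3
  simpa using add_mem hw.1 h3

end IsFrobeniusBase

variable (p : ℕ) [hp : Fact p.Prime] (R : Type u) [CommRing R] [CharP R p]

/-- The ring `W(R♭)`, where `R♭` is the perfection (inverse limit over Frobenius) of `R`. -/
abbrev Winf : Type u := WittVector p (Perfection R p)

/-- The projection `W(R♭) → R♭ → R`. -/
def Winf.toR : Winf p R →+* R := (Perfection.coeff R p 0).comp WittVector.constantCoeff

theorem Winf.isFrobeniusBase :
    IsFrobeniusBase p (WittVector.frobenius : Winf p R →+* Winf p R) where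
  torsionFree x hx := WittVector.eq_zero_of_p_mul_eq_zero x (by rw [mul_comm, hx])
  isUnit_of_coprime m hm := by
    obtain ⟨a, b, hab⟩ : ∃ a b : ℤ, a * p + b * m = 1 := by
      have := Nat.isCoprime_iff_coprime.2 hm
      exact this
    have hJ : Ideal.span {(p : Winf p R)} ≤ Ideal.jacobson ⊥ := IsAdicComplete.le_jacobson_bot _
    have h1 : (a : Winf p R) * p + b * m = 1 := by exact_mod_cast congrArg (Int.cast (R := Winf p R)) hab
    have h2 := Ideal.mem_jacobson_bot.1 (hJ (Ideal.mem_span_singleton_self (p : Winf p R))) (-a)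
    have h3 : (p : Winf p R) * -a + 1 = b * m := by linear_combination -h1
    rw [h3] at h2
    exact isUnit_of_mul_isUnit_right h2
  frobenius_lift x := by
    have : WittVector.frobenius x - x ^ p ∈ Ideal.span {(p : Winf p R)} := by
      rw [← WittVector.ker_constantCoeff, RingHom.mem_ker, map_sub, map_pow, sub_eq_zero]
      exact WittVector.coeff_frobenius_charP p x 0
    obtain ⟨y, hy⟩ := Ideal.mem_span_singleton'.1 this
    exact ⟨y, by linear_combination -hy⟩

/-- The divided power envelope of the kernel of `W(R♭) → R`. -/
abbrev AcrisPre : Type u := PDEnvelope p (RingHom.ker (Winf.toR p R))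

/-- The ring `A_cris(R)`: the `p`-adic completion of the divided power envelope of the kernel of
`W(R♭) → R`. -/
abbrev Acris : Type u := Completion.Compl p (AcrisPre p R)

/-- The element `p` of the kernel of the map from the divided power envelope to `R`. -/
def AcrisPre.pKer :
    RingHom.ker ((Winf.isFrobeniusBase p R).toR (Winf.toR p R) (CharP.cast_eq_zero R p)) :=
  ⟨p, by rw [RingHom.mem_ker, map_natCast, CharP.cast_eq_zero]⟩

/-- The projection `A_cris(R) → R`. -/
def Acris.toR : Acris p R →+* R :=
  Completion.toQuot ((Winf.isFrobeniusBase p R).toR (Winf.toR p R) (CharP.cast_eq_zero R p))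
    (CharP.cast_eq_zero R p)

/-- The frame `(A_cris(R), Fil A_cris(R), R, σ, σ₁)`. -/
def Acris.frame : Frame.{u} p :=
  Completion.frame ((Winf.isFrobeniusBase p R).toR (Winf.toR p R) (CharP.cast_eq_zero R p))
    (CharP.cast_eq_zero R p)
    ((Winf.isFrobeniusBase p R).σ₁ (Winf.toR p R) (CharP.cast_eq_zero R p))
    (AcrisPre.pKer p R) rfl ((Winf.isFrobeniusBase p R).σ₁_p _ _ _ rfl)
    ((Winf.isFrobeniusBase p R).exists_sigma_eq _ _)
    ((Winf.isFrobeniusBase p R).ker_toR_le_radical _ _)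

end Acris

/-- A lift of the ring `R` of characteristic `p`: a `p`-adically complete and `p`-torsion free
ring `A` with `A / p A = R`, together with an endomorphism that induces the Frobenius of `R`. -/
structure Lift (p : ℕ) (R A : Type u) [CommRing R] [CommRing A] where
  π : A →+* R
  surjective : Function.Surjective π
  ker_eq : RingHom.ker π = Ideal.span {(p : A)}
  isAdicComplete : IsAdicComplete (Ideal.span {(p : A)}) A
  torsionFree (a : A) : (p : A) * a = 0 → a = 0
  σ : A →+* A
  π_σ (a : A) : π (σ a) = π a ^ p

namespace Lift

variable {p : ℕ} {R A : Type u} [CommRing R] [CommRing A] (L : Lift p R A)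

theorem p_cancel (L : Lift p R A) {a b : A} (h : (p : A) * a = p * b) : a = b :=
  sub_eq_zero.1 (L.torsionFree _ (by rw [mul_sub, h, sub_self]))

theorem exists_div (x : Ideal.span {(p : A)}) : ∃ a : A, (p : A) * a = x := by
  obtain ⟨a, ha⟩ := Ideal.mem_span_singleton'.1 x.2
  exact ⟨a, by rw [mul_comm, ha]⟩

theorem σ_div_eq (L : Lift p R A) (x : Ideal.span {(p : A)}) (a : A) (ha : (p : A) * a = x) :
    (exists_div x).choose = a :=
  L.p_cancel ((exists_div x).choose_spec.trans ha.symm)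

/-- The map `σ₁ = p⁻¹ σ` on `p A`. -/
def σ₁ : Ideal.span {(p : A)} →ₛₗ[L.σ] A where
  toFun x := L.σ (exists_div x).choose
  map_add' x y := by
    rw [L.σ_div_eq (x + y) ((exists_div x).choose + (exists_div y).choose), map_add]
    rw [mul_add, (exists_div x).choose_spec, (exists_div y).choose_spec]
    rfl
  map_smul' c x := by
    rw [L.σ_div_eq (c • x) (c * (exists_div x).choose), map_mul, smul_eq_mul]
    rw [mul_left_comm, (exists_div x).choose_spec]
    rfl

theorem p_mul_σ₁ (x : Ideal.span {(p : A)}) : (p : A) * L.σ₁ x = L.σ x := by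
  conv_rhs => rw [← (exists_div x).choose_spec, map_mul, map_natCast]
  rfl

/-- The frame `(A, p A, R, σ, p⁻¹ σ)`. -/
def frame : Frame.{u} p where
  S := A
  Fil := Ideal.span {(p : A)}
  σ := L.σ
  σ₁ := L.σ₁
  le_jacobson := by
    have := L.isAdicComplete
    exact sup_le (IsAdicComplete.le_jacobson_bot _) (IsAdicComplete.le_jacobson_bot _)
  frobenius_lift x := by
    rw [← L.ker_eq, RingHom.mem_ker, map_sub, map_pow, L.π_σ, sub_self]
  span_range_σ₁ := by
    rw [Ideal.eq_top_iff_one]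
    refine Ideal.subset_span ⟨⟨p, Ideal.mem_span_singleton_self _⟩, ?_⟩
    apply L.p_cancel
    rw [p_mul_σ₁, map_natCast, mul_one]

/-- The lift `A` is straight if `A = W(R♭) / J'`, where `W(R♭) → A` lifts `R♭ → R`, such that the
set of all `a` in `J = Ker (R♭ → R)` with `[a] ∈ J'` generates `J`. -/
def IsStraight [Fact p.Prime] [CharP R p] : Prop :=
  ∃ ψ : Winf p R →+* A, Function.Surjective ψ ∧ (∀ x, L.π (ψ x) = Winf.toR p R x) ∧
    Ideal.span {a : Perfection R p | a ∈ RingHom.ker (Perfection.coeff R p 0) ∧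
      WittVector.teichmuller p a ∈ RingHom.ker ψ} = RingHom.ker (Perfection.coeff R p 0)

end Lift

end Lau

end

noncomputable section

set_option linter.all false

open scoped TensorProduct Nat

namespace Lau

/-! ### Bijectivity of the linearization of a semilinear endomorphism whose image generates. -/

section Linearization

open Matrix

/-! Let `N` be the kernel of `ϰ`. Existence and uniqueness of `ϰ` rest on the torsion freeness and
completeness of `A`. Two maps from `W(R♭)` that agree modulo `p` agree, because Teichmüller elements
have `p^n`-th roots for all `n`. A divided power has only one possible image, since `n!` can be
cancelled in `A`; if `i` maps to `p b`, then `i^{[n]}` maps to `(p^n / n!) b^n`. The same uniqueness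
(`Lift.acris_hom_ext`) makes `ϰ` commute with `σ`, and cancelling `p` makes it commute with `σ₁`.

The heart of the matter is that `σ₁ ∘ σ₁` maps `N` into `p N` (`Lift.ker_le_σ₁Comap`). By
straightness the kernel of `W(R♭) → R` is generated by `p` and the elements `[a]` with `ψ [a] = 0`.
Hence every element of `Fil A_cris` is, modulo `p`, a combination of the `[a]^{[n]}` with `n ≥ 1`
(`IsFrobeniusBase.ker_toR_le_of_span`), and these lie in `N` because `A` is torsion free. Now `σ₁`
sends `[a]^{[n]}` to `(pn)! / (p n!) · [a]^{[pn]}`. For `n = 1` the factor is the unit `(p - 1)!`,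
so one application gains nothing, but in the second application the factor is divisible by
`p^{pn-1}`. What remains of an element of `N` is `p z` with `z ∈ N`, and `σ₁ ∘ σ₁` maps it to `p`
times an element of `N`.

So with `N₁ = {a ∈ N | σ₁ a ∈ p N}` the chain `N ⊇ N₁ ⊇ p N ⊇ p N₁ ⊇ ...` is shifted by `σ₁` by one
step and tends to zero `p`-adically. Base change along such a thickening is an equivalence
(`IsThickening.isCrystalline`). Indeed a normal decomposition packs `F` and `F₁` into one `σ`-linear
map `Φ = F₁ ∘ w` on `P` with bijective linearization (`exists_linearMap_comp_eq`). For a linear map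
`f` that preserves `Q` there is a unique linear `V f` with `V f ∘ Φ = F₁ ∘ f ∘ w`, and window
homomorphisms are the fixed points of `V`. As `V` raises the filtration of differences by one step
it is a contraction, so a homomorphism over `A` lifts uniquely: base change is fully faithful. It is
essentially surjective because `N` is nil modulo `p`: the two summands of a normal decomposition
lift as projective modules, the operators lift arbitrarily, and Nakayama's lemma gives generation by
`F₁`. -/

theorem exists_mul_eq_of_isIdempotentElem {k : Type*} [Field k] {n : ℕ}
    {e : Matrix (Fin n) (Fin n) k} (he : e * e = e) :
    ∃ (r : ℕ) (C : Matrix (Fin n) (Fin r) k) (D : Matrix (Fin r) (Fin n) k),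
      C * D = e ∧ D * C = 1 := by
  let f := Matrix.toLin' e
  let b := Module.finBasis k (LinearMap.range f)
  let g := b.equivFun
  refine ⟨_, LinearMap.toMatrix' ((LinearMap.range f).subtype ∘ₗ g.symm.toLinearMap),
    LinearMap.toMatrix' (g.toLinearMap ∘ₗ f.rangeRestrict), ?_, ?_⟩
  · rw [← LinearMap.toMatrix'_comp]
    apply (Matrix.toLin').injective
    rw [Matrix.toLin'_toMatrix']
    refine LinearMap.ext fun x => ?_
    simp only [LinearMap.comp_apply, LinearEquiv.coe_coe, LinearEquiv.symm_apply_apply]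
    rfl
  · rw [← LinearMap.toMatrix'_comp, ← LinearMap.toMatrix'_id]
    congr 1
    refine LinearMap.ext fun x => ?_
    obtain ⟨z, hz⟩ := (g.symm x).2
    have h1 : f.rangeRestrict (g.symm x : Fin n → k) = g.symm x := Subtype.ext (by
      change f (g.symm x : Fin n → k) = _
      rw [← hz]
      simp only [f, Matrix.toLin'_apply, Matrix.mulVec_mulVec, he])
    simp only [LinearMap.comp_apply, LinearEquiv.coe_coe, Submodule.subtype_apply, h1,
      LinearEquiv.apply_symm_apply, LinearMap.id_apply]

/-- A splitting `e = C D` through `k^r` twists to a splitting of `e.map τ` through the same `k^r`.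
In these coordinates `U` and `B` become square matrices of size `r` whose product in one order is
the identity, hence also in the other order. -/
theorem mul_eq_map_of_mul_eq_field {k : Type*} [Field k] (τ : k →+* k) {n : ℕ}
    {e U B : Matrix (Fin n) (Fin n) k} (he : e * e = e) (hUB : U * B = e) (heU : e * U = U)
    (hUe : U * e.map τ = U) (heB : e.map τ * B = B) : B * U = e.map τ := by
  obtain ⟨r, C, D, hCD, hDC⟩ := exists_mul_eq_of_isIdempotentElem he
  have hF : C.map τ * D.map τ = e.map τ := by rw [← Matrix.map_mul, hCD]
  have h1 : (D * U * C.map τ) * (D.map τ * B * C) = 1 := by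
    calc (D * U * C.map τ) * (D.map τ * B * C) = D * (U * (C.map τ * D.map τ)) * B * C := by
          simp only [Matrix.mul_assoc]
      _ = D * (U * B) * C := by rw [hF, hUe]; simp only [Matrix.mul_assoc]
      _ = (D * C) * (D * C) := by rw [hUB, ← hCD]; simp only [Matrix.mul_assoc]
      _ = 1 := by rw [hDC, mul_one]
  have h2 := mul_eq_one_comm.1 h1
  calc B * U = (e.map τ * B) * (e * U) * e.map τ := by
        rw [heB, heU, Matrix.mul_assoc, hUe]
    _ = C.map τ * ((D.map τ * B * C) * (D * U * C.map τ)) * D.map τ := by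
        rw [← hF, ← hCD]; simp only [Matrix.mul_assoc]
    _ = e.map τ := by rw [h2, Matrix.mul_one, hF]

variable {S : Type*} [CommRing S]

/-- The determinant of `1 - κ` is `1` modulo every maximal ideal, so `1 - κ` is invertible, while `κ
(1 - κ) = 0`. -/
theorem eq_zero_of_isIdempotentElem_of_mem_maximal {n : ℕ} {κ : Matrix (Fin n) (Fin n) S}
    (hκ : κ * κ = κ)
    (h : ∀ m : Ideal S, m.IsMaximal → κ.map (Ideal.Quotient.mk m) = 0) : κ = 0 := by
  have hu : IsUnit (1 - κ).det := by
    by_contra hu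
    obtain ⟨m, hm, hmem⟩ := exists_max_ideal_of_mem_nonunits hu
    have h1 : Ideal.Quotient.mk m (1 - κ).det = 1 := by
      rw [RingHom.map_det, map_sub, map_one]
      have : (Ideal.Quotient.mk m).mapMatrix κ = 0 := h m hm
      rw [this, sub_zero, Matrix.det_one]
    rw [Ideal.Quotient.eq_zero_iff_mem.2 hmem] at h1
    exact hm.ne_top (Ideal.Quotient.zero_eq_one_iff.1 h1)
  have h2 : κ * (1 - κ) = 0 := by rw [mul_sub, mul_one, hκ, sub_self]
  have h3 : IsUnit (1 - κ) := (Matrix.isUnit_iff_isUnit_det _).2 hu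
  exact h3.mul_left_eq_zero.1 h2

/-- In module terms `e` cuts out a projective module, `e.map σ` its twist, `U` is a surjection from
the twist to the module, and `B` is a section of it. The projector `e.map σ - B * U` onto the kernel
vanishes over every residue field, where twisting by the induced endomorphism preserves dimension.
-/
theorem mul_eq_map_of_mul_eq (σ : S →+* S) (hσ : ∀ m : Ideal S, m.IsMaximal → m ≤ m.comap σ)
    {n : ℕ} {e U B : Matrix (Fin n) (Fin n) S} (he : e * e = e) (hUB : U * B = e)
    (heU : e * U = U) (hUe : U * e.map σ = U) (heB : e.map σ * B = B) : B * U = e.map σ := by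
  have hε : e.map σ * e.map σ = e.map σ := by rw [← Matrix.map_mul, he]
  symm
  rw [← sub_eq_zero]
  apply eq_zero_of_isIdempotentElem_of_mem_maximal
  · have h1 : e.map σ * (B * U) = B * U := by rw [← Matrix.mul_assoc, heB]
    have h2 : (B * U) * e.map σ = B * U := by rw [Matrix.mul_assoc, hUe]
    have h3 : (B * U) * (B * U) = B * U := by
      rw [Matrix.mul_assoc, ← Matrix.mul_assoc U, hUB, heU]
    rw [sub_mul, mul_sub, mul_sub, h1, h2, h3, hε]
    abel
  · intro m hm
    letI := Ideal.Quotient.field m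
    let q := Ideal.Quotient.mk m
    let τ : S ⧸ m →+* S ⧸ m := Ideal.quotientMap m σ (hσ m hm)
    have hτ : ∀ M : Matrix (Fin n) (Fin n) S, (M.map σ).map q = (M.map q).map τ := by
      intro M
      ext i j
      simp [τ, q]
    have key := mul_eq_map_of_mul_eq_field τ (e := e.map q) (U := U.map q) (B := B.map q)
      (by rw [← Matrix.map_mul, he]) (by rw [← Matrix.map_mul, hUB])
      (by rw [← Matrix.map_mul, heU]) (by rw [← hτ, ← Matrix.map_mul, hUe])
      (by rw [← hτ, ← Matrix.map_mul, heB])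
    rw [← hτ, ← Matrix.map_mul] at key
    have : (e.map σ - B * U).map q = (e.map σ).map q - (B * U).map q :=
      Matrix.map_sub _ (map_sub q) _ _
    exact this.trans (by rw [key, sub_self])

variable {P M : Type*} [AddCommGroup P] [Module S P] [AddCommGroup M] [Module S M]

theorem exists_retraction (S P : Type*) [CommRing S] [AddCommGroup P] [Module S P]
    [Module.Finite S P] [Module.Projective S P] :
    ∃ (n : ℕ) (r : (Fin n → S) →ₗ[S] P) (i : P →ₗ[S] (Fin n → S)), ∀ x, r (i x) = x := by
  obtain ⟨n, f, hf⟩ := Module.Finite.exists_fin' S P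
  obtain ⟨g, hg⟩ := Module.projective_lifting_property f LinearMap.id hf
  exact ⟨n, f, g, fun x => LinearMap.congr_fun hg x⟩

theorem map_eq_sum_single {n : ℕ} (r : (Fin n → S) →ₗ[S] P) (x : Fin n → S) :
    r x = ∑ j, x j • r (Pi.single j 1) := by
  conv_lhs => rw [pi_eq_sum_univ' x, map_sum]
  exact Finset.sum_congr rfl fun j _ => map_smul _ _ _

theorem semilinear_map_eq_sum_single {σ : S →+* S} (θ : P →ₛₗ[σ] M) {n : ℕ}
    (r : (Fin n → S) →ₗ[S] P) (x : Fin n → S) :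
    θ (r x) = ∑ j, σ (x j) • θ (r (Pi.single j 1)) := by
  rw [map_eq_sum_single, map_sum]
  exact Finset.sum_congr rfl fun j _ => map_smulₛₗ _ _ _

/-- Let `P` be finite projective and let `Φ` be a `σ`-linear endomorphism of `P` with image
generating `P`. If `σ` stabilizes all maximal ideals then the linearization of `Φ` is bijective;
thus every `σ`-linear map on `P` factors uniquely through `Φ`. -/
theorem exists_linearMap_comp_eq [Module.Finite S P] [Module.Projective S P] {σ : S →+* S}
    (hσ : ∀ m : Ideal S, m.IsMaximal → m ≤ m.comap σ) (Φ : P →ₛₗ[σ] P)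
    (hΦ : Submodule.span S (Set.range Φ) = ⊤) (θ : P →ₛₗ[σ] M) :
    ∃ V : P →ₗ[S] M, ∀ x, V (Φ x) = θ x := by
  obtain ⟨n, r, i, hri⟩ := exists_retraction S P
  -- `u` and `v` are the linearizations of `Φ` and `θ`, precomposed with the map from `S^n` to the
  -- twist of `P`. The map sought is `v ∘ s` for a section `s` of `u`.
  let u : (Fin n → S) →ₗ[S] P := Fintype.linearCombination S fun j => Φ (r (Pi.single j 1))
  let v : (Fin n → S) →ₗ[S] M := Fintype.linearCombination S fun j => θ (r (Pi.single j 1))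
  have hu : ∀ x : Fin n → S, u (fun j => σ (x j)) = Φ (r x) := fun x => by
    rw [semilinear_map_eq_sum_single, Fintype.linearCombination_apply]
  have hv : ∀ x : Fin n → S, v (fun j => σ (x j)) = θ (r x) := fun x => by
    rw [semilinear_map_eq_sum_single, Fintype.linearCombination_apply]
  have husurj : Function.Surjective u := by
    rw [← LinearMap.range_eq_top, eq_top_iff, ← hΦ, Submodule.span_le]
    rintro _ ⟨x, rfl⟩
    exact ⟨fun j => σ (i x j), by rw [hu, hri]⟩
  obtain ⟨s, hs⟩ := Module.projective_lifting_property u LinearMap.id husurj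
  have hus : ∀ x, u (s x) = x := fun x => LinearMap.congr_fun hs x
  let e := LinearMap.toMatrix' (i ∘ₗ r)
  let ε := Matrix.toLin' (e.map σ)
  have hε : ∀ x : Fin n → S, ε (fun j => σ (x j)) = fun j => σ (i (r x) j) := by
    intro x
    have h1 : Matrix.toLin' e x = i (r x) := by simp [e]
    rw [← h1, Matrix.toLin'_apply]
    ext j
    simp [Matrix.toLin'_apply, Matrix.mulVec, dotProduct]
  -- Unit vectors are fixed by coordinatewise `σ`, so identities of linear maps on `S^n` can be
  -- tested on twisted vectors.
  have hsingle : ∀ j : Fin n, (fun l => σ ((Pi.single j 1 : Fin n → S) l)) = Pi.single j 1 := by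
    intro j
    ext l
    by_cases h : l = j
    · subst h; simp
    · simp [h]
  have huε : u ∘ₗ ε = u := by
    apply LinearMap.pi_ext'
    intro j
    ext
    simp only [LinearMap.comp_apply, LinearMap.single_apply]
    rw [← hsingle j, hε, hu, hu, hri]
  have hvε : v ∘ₗ ε = v := by
    apply LinearMap.pi_ext'
    intro j
    ext
    simp only [LinearMap.comp_apply, LinearMap.single_apply]
    rw [← hsingle j, hε, hv, hv, hri]
  have hee : e * e = e := by
    rw [← LinearMap.toMatrix'_comp]
    congr 1
    ext x : 2
    simp [hri]
  have hεm : LinearMap.toMatrix' ε = e.map σ := LinearMap.toMatrix'_toLin' _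
  have hεε : ∀ x, ε (ε x) = ε x := by
    intro x
    simp only [ε, Matrix.toLin'_apply, Matrix.mulVec_mulVec, ← Matrix.map_mul, hee]
  -- The outcome `ε ∘ s ∘ u = ε` says that the section of the linearization is a two-sided inverse
  -- on the twist of `P`.
  have key := mul_eq_map_of_mul_eq σ hσ (e := e) (U := LinearMap.toMatrix' (i ∘ₗ u))
    (B := LinearMap.toMatrix' (ε ∘ₗ s ∘ₗ r)) hee
    (by
      rw [← LinearMap.toMatrix'_comp]
      congr 1
      refine LinearMap.ext fun x => ?_
      have := LinearMap.congr_fun huε (s (r x))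
      simp only [LinearMap.comp_apply] at this ⊢
      rw [this, hus])
    (by
      rw [← LinearMap.toMatrix'_comp]
      congr 1
      refine LinearMap.ext fun x => ?_
      simp only [LinearMap.comp_apply, hri])
    (by
      rw [← hεm, ← LinearMap.toMatrix'_comp, LinearMap.comp_assoc, huε])
    (by
      rw [← hεm, ← LinearMap.toMatrix'_comp]
      congr 1
      refine LinearMap.ext fun x => ?_
      simp only [LinearMap.comp_apply, hεε])
  rw [← hεm, ← LinearMap.toMatrix'_comp] at key
  have key' := LinearMap.toMatrix'.injective key
  refine ⟨v ∘ₗ s, fun x => ?_⟩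
  have h1 := LinearMap.congr_fun key' (fun j => σ (i x j))
  simp only [LinearMap.comp_apply, hri] at h1
  rw [hu, hri, hε, hri] at h1
  have h2 := LinearMap.congr_fun hvε (s (Φ x))
  simp only [LinearMap.comp_apply] at h2 ⊢
  rw [← h2, h1, hv, hri]

end Linearization

/-! ### Limits in finite projective modules over an adic ring. -/

section Limits

variable {S : Type*} [CommRing S] {q : S}

theorem span_pow_smul_top_mem_iff {P : Type*} [AddCommGroup P] [Module S P] (k : ℕ) (x : P) :
    x ∈ (Ideal.span {q} ^ k • ⊤ : Submodule S P) ↔ ∃ y, x = q ^ k • y := by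
  rw [Ideal.span_singleton_pow, Submodule.ideal_span_singleton_smul,
    Submodule.mem_smul_pointwise_iff_exists]
  simp [eq_comm]

theorem eq_zero_of_forall_eq_pow_mul (hS : IsHausdorff (Ideal.span {q}) S) {x : S}
    (h : ∀ k, ∃ y, x = q ^ k * y) : x = 0 := by
  refine hS.haus x fun k => ?_
  rw [SModEq.zero, span_pow_smul_top_mem_iff]
  exact h k

theorem exists_limit_ring (hS : IsPrecomplete (Ideal.span {q}) S) (c : ℕ → S)
    (h : ∀ k, ∃ y, c (k + 1) - c k = q ^ k * y) : ∃ x, ∀ k, ∃ y, x - c k = q ^ k * y := by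
  have h1 : ∀ k j, c (k + j) - c k ∈ (Ideal.span {q} ^ k • ⊤ : Submodule S S) := by
    intro k j
    induction j with
    | zero => simp
    | succ j ih =>
      obtain ⟨y, hy⟩ := h (k + j)
      have : c (k + (j + 1)) - c k = q ^ k • (q ^ j * y) + (c (k + j) - c k) := by
        rw [← add_assoc, smul_eq_mul, ← mul_assoc, ← pow_add, ← hy]
        ring
      rw [this]
      exact add_mem ((span_pow_smul_top_mem_iff k _).2 ⟨_, rfl⟩) ih
  obtain ⟨x, hx⟩ := hS.prec (f := c) (fun {m n} hmn => by
    obtain ⟨j, rfl⟩ := Nat.exists_eq_add_of_le hmn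
    exact (SModEq.sub_mem.2 (h1 m j)).symm)
  refine ⟨x, fun k => ?_⟩
  exact (span_pow_smul_top_mem_iff k _).1 (SModEq.sub_mem.1 (hx k).symm)

variable {P : Type*} [AddCommGroup P] [Module S P] [Module.Finite S P] [Module.Projective S P]

/-- A finite projective module is a retract of `S^n`, so separatedness is inherited coordinate by
coordinate; `exists_limit` transfers completeness in the same way. -/
theorem eq_zero_of_forall_eq_pow_smul (hS : IsHausdorff (Ideal.span {q}) S) {x : P}
    (h : ∀ k, ∃ y, x = q ^ k • y) : x = 0 := by
  obtain ⟨n, r, i, hri⟩ := exists_retraction S P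
  have : i x = 0 := by
    ext j
    refine eq_zero_of_forall_eq_pow_mul hS fun k => ?_
    obtain ⟨y, rfl⟩ := h k
    exact ⟨i y j, by simp⟩
  rw [← hri x, this, map_zero]

theorem exists_limit (hS : IsPrecomplete (Ideal.span {q}) S) (c : ℕ → P)
    (h : ∀ k, ∃ y, c (k + 1) - c k = q ^ k • y) : ∃ x, ∀ k, ∃ y, x - c k = q ^ k • y := by
  obtain ⟨n, r, i, hri⟩ := exists_retraction S P
  have h1 : ∀ j, ∃ x, ∀ k, ∃ y, x - i (c k) j = q ^ k * y := fun j =>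
    exists_limit_ring hS (fun k => i (c k) j) fun k => by
      obtain ⟨y, hy⟩ := h k
      exact ⟨i y j, by simpa using congrArg (fun z => i z j) hy⟩
  choose x y hxy using h1
  refine ⟨r x, fun k => ⟨r fun j => y j k, ?_⟩⟩
  rw [← map_smul, ← hri (c k), ← map_sub]
  congr 1
  ext j
  simpa [hri] using hxy j k

/-- Limits are taken pointwise. The defect of linearity of the limit is divisible by every power of
`q`, hence zero. -/
theorem exists_limit_linearMap {X : Type*} [AddCommGroup X] [Module S X]
    (hS : IsAdicComplete (Ideal.span {q}) S) (f : ℕ → X →ₗ[S] P)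
    (h : ∀ k x, ∃ y, f (k + 1) x - f k x = q ^ k • y) :
    ∃ g : X →ₗ[S] P, ∀ k x, ∃ y, g x - f k x = q ^ k • y := by
  choose g hg using fun x => exists_limit (P := P) hS.toIsPrecomplete (fun k => f k x) (fun k => h k x)
  refine ⟨{ toFun := g, map_add' := fun x y => ?_, map_smul' := fun s x => ?_ },
    fun k x => hg x k⟩
  · rw [← sub_eq_zero]
    refine eq_zero_of_forall_eq_pow_smul hS.toIsHausdorff fun k => ?_
    obtain ⟨a, ha⟩ := hg (x + y) k
    obtain ⟨b, hb⟩ := hg x k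
    obtain ⟨c, hc⟩ := hg y k
    refine ⟨a - b - c, ?_⟩
    rw [smul_sub, smul_sub, ← ha, ← hb, ← hc, map_add]
    abel
  · rw [← sub_eq_zero]
    refine eq_zero_of_forall_eq_pow_smul hS.toIsHausdorff fun k => ?_
    obtain ⟨a, ha⟩ := hg (s • x) k
    obtain ⟨b, hb⟩ := hg x k
    refine ⟨a - s • b, ?_⟩
    rw [smul_sub, smul_comm _ s, ← ha, ← hb, map_smul, smul_sub, RingHom.id_apply]
    abel

end Limits

/-! ### Lifting idempotents, projective modules and semilinear maps. -/

section Lifting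

open Matrix

variable {S S' : Type*} [CommRing S] [CommRing S']

theorem matrix_mul_mem_mul {n : ℕ} {I J : Ideal S} {A B : Matrix (Fin n) (Fin n) S}
    (hA : ∀ i j, A i j ∈ I) (hB : ∀ i j, B i j ∈ J) (i j : Fin n) : (A * B) i j ∈ I * J := by
  rw [Matrix.mul_apply]
  exact sum_mem fun k _ => Ideal.mul_mem_mul (hA i k) (hB k j)

/-- Lifting of idempotent matrices along a surjection of `q`-adic rings whose kernel is nil
modulo `q`. -/
theorem exists_isIdempotentElem_matrix_map_eq {q : S} (α : S →+* S')
    (hα : Function.Surjective α) (hS : IsAdicComplete (Ideal.span {q}) S)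
    (hS' : IsHausdorff (Ideal.span {α q}) S')
    (hker : RingHom.ker α ≤ (Ideal.span {q}).radical) {n : ℕ}
    {e' : Matrix (Fin n) (Fin n) S'} (he' : e' * e' = e') :
    ∃ e : Matrix (Fin n) (Fin n) S, e * e = e ∧ e.map α = e' := by
  choose x₀ hx₀ using fun i j => hα (e' i j)
  -- This is the Newton iteration for `y² = y`. It fixes idempotents and squares the defect `y² - y`
  -- up to a factor.
  let g : Matrix (Fin n) (Fin n) S → Matrix (Fin n) (Fin n) S :=
    fun y => 3 * (y * y) - 2 * (y * y * y)
  let x : ℕ → Matrix (Fin n) (Fin n) S := fun k => g^[k] (Matrix.of x₀)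
  have hx : ∀ k, x (k + 1) = 3 * (x k * x k) - 2 * (x k * x k * x k) := fun k =>
    Function.iterate_succ_apply' g k _
  have hxα : ∀ k, (x k).map α = e' := by
    intro k
    induction k with
    | zero => ext i j; exact hx₀ i j
    | succ k ih =>
      have ih' : α.mapMatrix (x k) = e' := ih
      change α.mapMatrix (x (k + 1)) = e'
      rw [hx, map_sub, map_mul, map_mul, map_mul, map_mul, map_mul, ih', he', he', map_ofNat,
        map_ofNat]
      noncomm_ring
  let z : ℕ → Matrix (Fin n) (Fin n) S := fun k => x k * x k - x k
  have hz : ∀ k, z (k + 1) = z k * (z k * (4 * z k - 3)) := by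
    intro k
    simp only [z, hx]
    noncomm_ring
  have hxz : ∀ k, x (k + 1) - x k = z k * (1 - 2 * x k) := by
    intro k
    simp only [z, hx]
    noncomm_ring
  -- The defects generate a finitely generated ideal. Finite generation turns nilpotence of its
  -- elements modulo `q` into `b^m ≤ (q)` for some `m`, which makes the iteration converge
  -- `q`-adically. The linear bound `b^(k+1)` on the defects suffices for this.
  let b : Ideal S := Ideal.span (Set.range fun ij : Fin n × Fin n => z 0 ij.1 ij.2)
  have hzb : ∀ k i j, z k i j ∈ b ^ (k + 1) := by
    intro k
    induction k with
    | zero => intro i j; rw [zero_add, pow_one]; exact Ideal.subset_span ⟨(i, j), rfl⟩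
    | succ k ih =>
      intro i j
      rw [hz, pow_succ]
      refine matrix_mul_mem_mul ih (fun i j => ?_) i j
      have := matrix_mul_mem_mul (J := ⊤) ih (B := 4 * z k - 3) (fun _ _ => trivial) i j
      rw [Ideal.mul_top] at this
      exact Ideal.pow_le_self (Nat.succ_ne_zero k) this
  have hxb : ∀ k j a c, (x (k + j) - x k) a c ∈ b ^ k := by
    intro k j
    induction j with
    | zero => intro a c; simp
    | succ j ih =>
      intro a c
      have h1 : (x (k + (j + 1)) - x k) = (x (k + j + 1) - x (k + j)) + (x (k + j) - x k) := by
        rw [← add_assoc]; abel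
      rw [h1, Matrix.add_apply]
      refine add_mem ?_ (ih a c)
      rw [hxz]
      have := matrix_mul_mem_mul (J := ⊤) (hzb (k + j)) (B := 1 - 2 * x (k + j))
        (fun _ _ => trivial) a c
      rw [Ideal.mul_top] at this
      exact Ideal.pow_le_pow_right (by omega) this
  have hbker : b ≤ RingHom.ker α := by
    rw [Ideal.span_le]
    rintro _ ⟨ij, rfl⟩
    have : α.mapMatrix (z 0) = 0 := by
      have h1 : α.mapMatrix (x 0) = e' := hxα 0
      rw [map_sub, map_mul, h1, he', sub_self]
    exact congrFun (congrFun this ij.1) ij.2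
  obtain ⟨m, hm⟩ := Ideal.exists_pow_le_of_le_radical_of_fg (hbker.trans hker)
    (Submodule.fg_span (Set.finite_range _))
  have hbq : ∀ k t, m * k ≤ t → ∀ y ∈ b ^ t, ∃ y', y = q ^ k * y' := by
    intro k t hkt y hy
    have h1 : b ^ t ≤ Ideal.span {q ^ k} := by
      rw [← Ideal.span_singleton_pow]
      refine (Ideal.pow_le_pow_right hkt).trans ?_
      rw [pow_mul]
      exact Ideal.pow_right_mono hm k
    obtain ⟨y', hy'⟩ := Ideal.mem_span_singleton'.1 (h1 hy)
    exact ⟨y', by rw [← hy', mul_comm]⟩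
  -- Along the indices `m k` the increments lie in `b^(m k)` and are therefore divisible by `q^k`.
  choose e y hey using fun i j => exists_limit_ring hS.toIsPrecomplete (fun k => x (m * k) i j)
    (fun k => by
      have := hxb (m * k) m i j
      exact hbq k _ le_rfl _ (by simpa [mul_add, Matrix.sub_apply] using this))
  have hey' : ∀ k, Matrix.of e = x (m * k) + q ^ k • Matrix.of (fun i j => y i j k) := by
    intro k
    ext i j
    simp only [Matrix.of_apply, Matrix.add_apply, Matrix.smul_apply, smul_eq_mul, ← hey]
    ring
  refine ⟨Matrix.of e, ?_, ?_⟩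
  · rw [← sub_eq_zero]
    ext i j
    refine eq_zero_of_forall_eq_pow_mul hS.toIsHausdorff fun k => ?_
    obtain ⟨c, hc⟩ := hbq k _ (Nat.le_succ _) _ (hzb (m * k) i j)
    let Y := Matrix.of fun i j => y i j k
    have h1 : Matrix.of e * Matrix.of e - Matrix.of e = z (m * k) +
        q ^ k • (x (m * k) * Y + Y * x (m * k) + q ^ k • (Y * Y) - Y) := by
      rw [hey' k]
      simp only [mul_add, add_mul, smul_mul_assoc, mul_smul_comm, smul_add, smul_sub, z, Y]
      abel
    refine ⟨c + (x (m * k) * Y + Y * x (m * k) + q ^ k • (Y * Y) - Y) i j, ?_⟩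
    rw [h1, Matrix.add_apply, Matrix.smul_apply, hc, smul_eq_mul, mul_add]
  · rw [← sub_eq_zero]
    ext i j
    refine eq_zero_of_forall_eq_pow_mul hS' fun k => ⟨α (y i j k), ?_⟩
    have h1 := congrArg α (hey i j k)
    have h2 : α (x (m * k) i j) = e' i j := congrFun (congrFun (hxα (m * k)) i) j
    rw [map_sub, h2, map_mul, map_pow] at h1
    exact h1

/-- Finite projective modules lift along a surjection of `q`-adic rings whose kernel is nil
modulo `q`. -/
theorem exists_projective_lift {S S' P' : Type u} [CommRing S] [CommRing S'] [AddCommGroup P']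
    [Module S' P'] [Module.Finite S' P'] [Module.Projective S' P'] {q : S} (α : S →+* S')
    (hα : Function.Surjective α) (hS : IsAdicComplete (Ideal.span {q}) S)
    (hS' : IsHausdorff (Ideal.span {α q}) S')
    (hker : RingHom.ker α ≤ (Ideal.span {q}).radical) :
    ∃ (P : Type u) (_ : AddCommGroup P) (_ : Module S P), Module.Finite S P ∧
      Module.Projective S P ∧ ∃ π : P →ₛₗ[α] P', Function.Surjective π ∧
        ∀ x, π x = 0 → x ∈ (RingHom.ker α • ⊤ : Submodule S P) := by
  obtain ⟨n, r', i', hri'⟩ := exists_retraction S' P'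
  obtain ⟨e, he, heα⟩ := exists_isIdempotentElem_matrix_map_eq α hα hS hS' hker
    (e' := LinearMap.toMatrix' (i' ∘ₗ r')) (by
      rw [← LinearMap.toMatrix'_comp]
      congr 1
      refine LinearMap.ext fun x => ?_
      simp only [LinearMap.comp_apply, hri'])
  let f := Matrix.toLin' e
  have hff : ∀ x, f (f x) = f x := fun x => by
    simp only [f, Matrix.toLin'_apply, Matrix.mulVec_mulVec, he]
  have hfα : ∀ x : Fin n → S, (fun j => α (f x j)) = i' (r' fun j => α (x j)) := by
    intro x
    have h1 : Matrix.toLin' (e.map α) (fun j => α (x j)) = i' (r' fun j => α (x j)) := by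
      rw [heα]; simp
    rw [← h1, Matrix.toLin'_apply]
    ext j
    simp [f, Matrix.toLin'_apply, Matrix.mulVec, dotProduct]
  have hfP : ∀ x : LinearMap.range f, f x = x := by
    rintro ⟨_, z, rfl⟩
    exact hff z
  -- The lift of `P'` is the image of the lifted idempotent; the projection to `P'` applies `α` to
  -- the coordinates and then `r'`.
  refine ⟨LinearMap.range f, inferInstance, inferInstance, inferInstance, ?_, ?_⟩
  · exact Module.Projective.of_split (LinearMap.range f).subtype f.rangeRestrict
      (LinearMap.ext fun x => Subtype.ext (hfP x))
  · refine ⟨{ toFun := fun x => r' fun j => α (x.1 j), map_add' := fun x y => ?_,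
              map_smul' := fun s x => ?_ }, fun y => ?_, fun x hx => ?_⟩
    · rw [← map_add]
      congr 1
      ext j
      simp
    · rw [← map_smul]
      congr 1
      ext j
      simp
    · choose z hz using fun j => hα (i' y j)
      refine ⟨⟨f z, z, rfl⟩, ?_⟩
      change r' (fun j => α (f z j)) = y
      rw [hfα, hri', show (fun j => α (z j)) = i' y from funext hz, hri']
    · change r' (fun j => α (x.1 j)) = 0 at hx
      -- Since `x = f x`, reducing the coordinates of `x` gives `i'` of the image of `x` in `P'`,
      -- which is zero.
      have h1 : ∀ j, x.1 j ∈ RingHom.ker α := by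
        intro j
        have h2 := congrFun (hfα x.1) j
        rw [hx, map_zero, hfP] at h2
        exact h2
      have h3 : x = ∑ j, x.1 j • f.rangeRestrict (Pi.single j 1) := by
        rw [← map_eq_sum_single]
        exact Subtype.ext (hfP x).symm
      rw [h3]
      exact sum_mem fun j _ => Submodule.smul_mem_smul (h1 j) trivial

/-- Lifting of semilinear maps on finite projective modules along a semilinear surjection. -/
theorem exists_semilinear_lift {P M M' : Type*} [AddCommGroup P] [Module S P]
    [Module.Finite S P] [Module.Projective S P] [AddCommGroup M] [Module S M] [AddCommGroup M']
    [Module S' M'] {α : S →+* S'} {π : M →ₛₗ[α] M'} (hπ : Function.Surjective π) (τ : S →+* S)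
    (θ : P → M') (hadd : ∀ x y, θ (x + y) = θ x + θ y)
    (hsmul : ∀ s x, θ (s • x) = α (τ s) • θ x) :
    ∃ f : P →ₛₗ[τ] M, ∀ x, π (f x) = θ x := by
  obtain ⟨n, r, i, hri⟩ := exists_retraction S P
  choose c hc using fun j : Fin n => hπ (θ (r (Pi.single j 1)))
  refine ⟨{ toFun := fun x => ∑ j, τ (i x j) • c j, map_add' := fun x y => ?_,
            map_smul' := fun s x => ?_ }, fun x => ?_⟩
  · rw [← Finset.sum_add_distrib]
    exact Finset.sum_congr rfl fun j _ => by simp [add_smul]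
  · rw [Finset.smul_sum]
    exact Finset.sum_congr rfl fun j _ => by simp [mul_smul]
  · change π (∑ j, τ (i x j) • c j) = θ x
    let θ' : P →+ M' := AddMonoidHom.mk' θ hadd
    change _ = θ' x
    conv_rhs => rw [← hri x, map_eq_sum_single, map_sum]
    rw [map_sum]
    refine Finset.sum_congr rfl fun j _ => ?_
    rw [map_smulₛₗ, hc]
    exact (hsmul _ _).symm

end Lifting

/-! ### Normalized frames. -/

namespace Frame

variable {p : ℕ} (𝓢 : Frame.{u} p)

/-- Every maximal ideal contains `p`, and `σ x` is congruent to `x^p` modulo `p`. This is what makes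
the rank argument for linearizations available over a frame. -/
theorem maximal_le_comap_σ [Fact p.Prime] (m : Ideal 𝓢.S) (hm : m.IsMaximal) :
    m ≤ m.comap 𝓢.σ := by
  intro x hx
  have hp : Ideal.span {(p : 𝓢.S)} ≤ m :=
    (le_sup_left.trans 𝓢.le_jacobson).trans (sInf_le ⟨bot_le, hm⟩)
  have h1 := add_mem (hp (𝓢.frobenius_lift x))
    (Ideal.pow_mem_of_mem m hx p (Fact.out : p.Prime).pos)
  rwa [sub_add_cancel] at h1

/-- A frame is normalized if `p ∈ Fil S` and `σ₁ p = 1`; then `p σ₁ = σ`. -/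
structure IsNormalized : Prop where
  p_mem : (p : 𝓢.S) ∈ 𝓢.Fil
  σ₁_p : 𝓢.σ₁ ⟨p, p_mem⟩ = 1

variable {𝓢}

/-- Evaluate `σ₁ (p a)` in two ways, with `p` or with `a` as the scalar. -/
theorem IsNormalized.p_mul_σ₁ (h : 𝓢.IsNormalized) (a : 𝓢.Fil) :
    (p : 𝓢.S) * 𝓢.σ₁ a = 𝓢.σ a := by
  have h1 := 𝓢.σ₁.map_smulₛₗ (p : 𝓢.S) a
  have h2 := 𝓢.σ₁.map_smulₛₗ (a : 𝓢.S) ⟨p, h.p_mem⟩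
  have h3 : (p : 𝓢.S) • a = (a : 𝓢.S) • (⟨p, h.p_mem⟩ : 𝓢.Fil) := Subtype.ext (mul_comm _ _)
  rw [h3, h2, h.σ₁_p, map_natCast, smul_eq_mul, smul_eq_mul, mul_one] at h1
  exact h1.symm

end Frame

/-! ### Encoding the operators of a window in one semilinear map. -/

namespace Window

variable {p : ℕ} {𝓢 : Frame.{u} p}

theorem Fil_smul_top_le (X : Window 𝓢) : (𝓢.Fil • ⊤ : Submodule 𝓢.S X.P) ≤ X.Q :=
  Submodule.smul_le.2 fun a ha t _ => X.smul_mem ⟨a, ha⟩ t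

theorem F_eq (h : 𝓢.IsNormalized) (X : Window 𝓢) (x : X.P) :
    X.F x = X.F₁ ⟨(p : 𝓢.S) • x, X.smul_mem ⟨p, h.p_mem⟩ x⟩ := by
  have := X.F₁_smul ⟨p, h.p_mem⟩ x
  rw [h.σ₁_p, one_smul] at this
  exact this.symm

/-- For a normal decomposition `P = L ⊕ T` the map `w : P → Q` given by the identity on `L` and
by multiplication with `p` on `T`. A `σ`-linear map `g` on `Q` with `g (a x) = σ₁ a · g (p x)`
is determined by `g ∘ w`. -/
theorem exists_toQ (h : 𝓢.IsNormalized) (X : Window 𝓢) :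
    ∃ w : X.P →ₗ[𝓢.S] X.Q, ∀ {M : Type u} [AddCommGroup M] [Module 𝓢.S M] (g : X.Q →ₛₗ[𝓢.σ] M),
      (∀ (a : 𝓢.Fil) (x : X.P), g ⟨(a : 𝓢.S) • x, X.smul_mem a x⟩ =
        𝓢.σ₁ a • g ⟨(p : 𝓢.S) • x, X.smul_mem ⟨p, h.p_mem⟩ x⟩) →
      (∀ x, g (w x) = 0) → g = 0 := by
  obtain ⟨L, T, hLT, hQ⟩ := X.exists_normal_decomposition
  have hLQ : L ≤ X.Q := hQ ▸ le_sup_left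
  let eL : X.P →ₗ[𝓢.S] X.Q := Submodule.inclusion hLQ ∘ₗ L.projectionOnto T hLT
  let pQ : X.P →ₗ[𝓢.S] X.Q := LinearMap.codRestrict X.Q ((p : 𝓢.S) • LinearMap.id)
    (fun x => X.smul_mem ⟨p, h.p_mem⟩ x)
  have heL : ∀ x ∈ L, (eL x : X.P) = x := fun x hx => by
    simpa [eL] using congrArg Subtype.val (Submodule.projectionOnto_apply_left hLT ⟨x, hx⟩)
  have heT : ∀ x ∈ T, eL x = 0 := fun x hx => by
    have := (Submodule.projectionOnto_apply_eq_zero_iff hLT).2 hx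
    simp [eL, this]
  -- `eL` is the projection to `L`, viewed in `Q`, and its complement is the projection to `T`,
  -- which multiplication by `p` carries into `Q`.
  refine ⟨eL + pQ ∘ₗ (LinearMap.id - X.Q.subtype ∘ₗ eL), ?_⟩
  intro M _ _ g hg hw
  have hL : ∀ x (hx : x ∈ L), g ⟨x, hLQ hx⟩ = 0 := by
    intro x hx
    rw [← hw x]
    congr 1
    apply Subtype.ext
    simp [pQ, heL x hx]
  have hT : ∀ x ∈ T, g ⟨(p : 𝓢.S) • x, X.smul_mem ⟨p, h.p_mem⟩ x⟩ = 0 := by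
    intro x hx
    rw [← hw x]
    congr 1
    apply Subtype.ext
    simp [pQ, heT x hx]
  have hFT : ∀ x ∈ 𝓢.Fil • T, ∀ hx : x ∈ X.Q, g ⟨x, hx⟩ = 0 := by
    intro x hx
    induction hx using Submodule.smul_induction_on' with
    | smul a ha t ht =>
      intro _
      have := hg ⟨a, ha⟩ t
      rw [hT t ht, smul_zero] at this
      exact this
    | add x hx y hy ihx ihy =>
      intro hxy
      have hTQ : ∀ z ∈ 𝓢.Fil • T, z ∈ X.Q := fun z hz => hQ ▸ Submodule.mem_sup_right hz
      have : (⟨x + y, hxy⟩ : X.Q) = ⟨x, hTQ x hx⟩ + ⟨y, hTQ y hy⟩ := rfl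
      rw [this, map_add, ihx, ihy, add_zero]
  ext ⟨x, hx⟩
  have hx' := hx
  rw [hQ] at hx'
  obtain ⟨l, hl, t, ht, rfl⟩ := Submodule.mem_sup.1 hx'
  have htQ : t ∈ X.Q := hQ ▸ Submodule.mem_sup_right ht
  have : (⟨l + t, hx⟩ : X.Q) = ⟨l, hLQ hl⟩ + ⟨t, htQ⟩ := rfl
  rw [this, map_add, hL l hl, hFT t ht, add_zero, LinearMap.zero_apply]

/-- The map `w : P → Q` attached to a normal decomposition. -/
def toQ (h : 𝓢.IsNormalized) (X : Window 𝓢) : X.P →ₗ[𝓢.S] X.Q := (X.exists_toQ h).choose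

theorem eq_zero_of_comp_toQ (h : 𝓢.IsNormalized) (X : Window 𝓢) {M : Type u} [AddCommGroup M]
    [Module 𝓢.S M] (g : X.Q →ₛₗ[𝓢.σ] M)
    (hg : ∀ (a : 𝓢.Fil) (x : X.P), g ⟨(a : 𝓢.S) • x, X.smul_mem a x⟩ =
      𝓢.σ₁ a • g ⟨(p : 𝓢.S) • x, X.smul_mem ⟨p, h.p_mem⟩ x⟩)
    (hw : ∀ x, g (X.toQ h x) = 0) : g = 0 :=
  (X.exists_toQ h).choose_spec g hg hw

theorem F₁_smul' (h : 𝓢.IsNormalized) (X : Window 𝓢) (a : 𝓢.Fil) (x : X.P) :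
    X.F₁ ⟨(a : 𝓢.S) • x, X.smul_mem a x⟩ =
      𝓢.σ₁ a • X.F₁ ⟨(p : 𝓢.S) • x, X.smul_mem ⟨p, h.p_mem⟩ x⟩ := by
  rw [X.F₁_smul, X.F_eq h]

/-- The `σ`-linear map `Φ = F₁ ∘ w`, whose linearization is bijective. -/
def Phi (h : 𝓢.IsNormalized) (X : Window 𝓢) : X.P →ₛₗ[𝓢.σ] X.P := X.F₁.comp (X.toQ h)

/-- Modulo the span of the image of `Φ`, the map `F₁` vanishes on the image of `w`, hence on all of
`Q`; but `F₁` generates `P`. -/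
theorem span_range_Phi (h : 𝓢.IsNormalized) (X : Window 𝓢) :
    Submodule.span 𝓢.S (Set.range (X.Phi h)) = ⊤ := by
  let N := Submodule.span 𝓢.S (Set.range (X.Phi h))
  have h1 : N.mkQ.comp X.F₁ = 0 := by
    apply X.eq_zero_of_comp_toQ h
    · intro a x
      rw [LinearMap.comp_apply, X.F₁_smul' h, map_smul]
      rfl
    · intro x
      rw [LinearMap.comp_apply, Submodule.mkQ_apply, Submodule.Quotient.mk_eq_zero]
      exact Submodule.subset_span ⟨x, rfl⟩
  rw [eq_top_iff, ← X.span_range_F₁, Submodule.span_le]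
  rintro _ ⟨q, rfl⟩
  have := LinearMap.congr_fun h1 q
  rwa [LinearMap.comp_apply, Submodule.mkQ_apply, LinearMap.zero_apply,
    Submodule.Quotient.mk_eq_zero] at this

/-- A linear map that preserves `Q` and commutes with `F₁ ∘ w` commutes with `F₁` and `F`. -/
theorem exists_hom_of_Phi (h : 𝓢.IsNormalized) {X Y : Window 𝓢} (f : X.P →ₗ[𝓢.S] Y.P)
    (hQ : ∀ x ∈ X.Q, f x ∈ Y.Q)
    (hf : ∀ x, f (X.Phi h x) = Y.F₁ ⟨f (X.toQ h x), hQ _ (X.toQ h x).2⟩) :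
    ∃ g : Hom X Y, g.toLinearMap = f := by
  let fQ : X.Q →ₗ[𝓢.S] Y.Q := f.restrict hQ
  -- The commutation defect with `F₁` satisfies the rule `g (a x) = σ₁ a · g (p x)`, so its
  -- vanishing on the image of `w` is enough. Commutation with `F` then follows from `F x = F₁ (p
  -- x)`.
  have h1 : f.comp X.F₁ - Y.F₁.comp fQ = 0 := by
    apply X.eq_zero_of_comp_toQ h
    · intro a x
      have e1 : ∀ (b : 𝓢.Fil), fQ ⟨(b : 𝓢.S) • x, X.smul_mem b x⟩ =
          ⟨(b : 𝓢.S) • f x, Y.smul_mem b (f x)⟩ := fun b => Subtype.ext (map_smul f _ _)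
      simp only [LinearMap.sub_apply, LinearMap.comp_apply]
      rw [e1 a, e1 ⟨p, h.p_mem⟩, X.F₁_smul' h, Y.F₁_smul' h, map_smul, smul_sub]
    · intro x
      rw [LinearMap.sub_apply, sub_eq_zero]
      exact hf x
  have h2 : ∀ q : X.Q, f (X.F₁ q) = Y.F₁ (fQ q) := fun q => by
    have := LinearMap.congr_fun h1 q
    rwa [LinearMap.sub_apply, LinearMap.zero_apply, sub_eq_zero] at this
  refine ⟨⟨f, hQ, fun x => ?_, h2⟩, rfl⟩
  rw [X.F_eq h, Y.F_eq h, h2]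
  congr 1
  exact Subtype.ext (map_smul f _ _)

/-- If `σ₁` maps `𝔞` into `𝔟`, then `F₁` maps `𝔞 P` into `𝔟 P`. -/
theorem F₁_mem_smul_top (X : Window 𝓢) {𝔞 𝔟 : Ideal 𝓢.S} (h𝔞 : 𝔞 ≤ 𝓢.Fil)
    (hab : ∀ a (ha : a ∈ 𝔞), 𝓢.σ₁ ⟨a, h𝔞 ha⟩ ∈ 𝔟) (x : X.P)
    (hx : x ∈ (𝔞 • ⊤ : Submodule 𝓢.S X.P)) (hxQ : x ∈ X.Q) :
    X.F₁ ⟨x, hxQ⟩ ∈ (𝔟 • ⊤ : Submodule 𝓢.S X.P) := by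
  induction hx using Submodule.smul_induction_on' with
  | smul a ha t ht =>
    have := X.F₁_smul ⟨a, h𝔞 ha⟩ t
    change X.F₁ ⟨a • t, hxQ⟩ = _ at this
    rw [this]
    exact Submodule.smul_mem_smul (hab a ha) trivial
  | add x hx y hy ihx ihy =>
    have hQ : ∀ z ∈ (𝔞 • ⊤ : Submodule 𝓢.S X.P), z ∈ X.Q := fun z hz =>
      X.Fil_smul_top_le (Submodule.smul_mono h𝔞 le_rfl hz)
    have : (⟨x + y, hxQ⟩ : X.Q) = ⟨x, hQ x hx⟩ + ⟨y, hQ y hy⟩ := rfl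
    rw [this, map_add]
    exact add_mem (ihx _) (ihy _)

end Window

/-! ### Base change along surjective frame homomorphisms. -/

namespace FrameHom

variable {p : ℕ} {𝓢 𝓢' : Frame.{u} p} (α : FrameHom 𝓢 𝓢')

/-- A semilinear map `P → M'` factors over `S' ⊗_S P`. -/
theorem exists_desc (X : Window 𝓢) {M' : Type*} [AddCommGroup M'] [Module 𝓢'.S M']
    (g : X.P →ₛₗ[α.toRingHom] M') :
    ∃ f : α.BaseChange X →ₗ[𝓢'.S] M', ∀ x, f (α.ι X x) = g x := by
  letI := α.toRingHom.toAlgebra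
  letI : Module 𝓢.S M' := Module.compHom M' α.toRingHom
  haveI : IsScalarTower 𝓢.S 𝓢'.S M' := ⟨fun s s' m => by
    rw [Algebra.smul_def, mul_smul]; rfl⟩
  let g' : X.P →ₗ[𝓢.S] M' :=
    { toFun := g, map_add' := map_add g, map_smul' := fun s x => map_smulₛₗ g s x }
  refine ⟨g'.liftBaseChange 𝓢'.S, fun x => ?_⟩
  have := LinearMap.liftBaseChange_tmul 𝓢'.S g' 1 x
  rw [one_smul] at this
  exact this

variable {α}

theorem ι_surjective (hα : Function.Surjective α.toRingHom) (X : Window 𝓢) : Function.Surjective (α.ι X) := by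
  intro y
  induction y using α.induction with
  | ι x => exact ⟨x, rfl⟩
  | zero => exact ⟨0, map_zero _⟩
  | add y z hy hz =>
    obtain ⟨a, rfl⟩ := hy
    obtain ⟨b, rfl⟩ := hz
    exact ⟨a + b, map_add _ _ _⟩
  | smul s y hy =>
    obtain ⟨a, rfl⟩ := hy
    obtain ⟨s, rfl⟩ := hα s
    exact ⟨s • a, map_smulₛₗ _ _ _⟩

/-- Coordinates of `P` as a retract of a free module, reduced by `α`, factor over the base change.
So the coordinates of an element that dies in the base change lie in the kernel of `α`. -/
theorem ι_eq_zero_iff (X : Window 𝓢) (x : X.P) :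
    α.ι X x = 0 ↔ x ∈ (RingHom.ker α.toRingHom • ⊤ : Submodule 𝓢.S X.P) := by
  constructor
  · intro hx
    obtain ⟨n, r, i, hri⟩ := exists_retraction 𝓢.S X.P
    have h1 : ∀ j, i x j ∈ RingHom.ker α.toRingHom := by
      intro j
      obtain ⟨f, hf⟩ := α.exists_desc X (M' := 𝓢'.S)
        { toFun := fun x => α.toRingHom (i x j), map_add' := fun x y => by simp,
          map_smul' := fun s x => by simp }
      have := hf x
      rw [hx, map_zero] at this
      exact this.symm
    rw [← hri x, map_eq_sum_single]
    exact sum_mem fun j _ => Submodule.smul_mem_smul (h1 j) trivial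
  · intro hx
    induction hx using Submodule.smul_induction_on' with
    | smul a ha t ht => rw [map_smulₛₗ, RingHom.mem_ker.1 ha, zero_smul]
    | add x hx y hy ihx ihy => rw [map_add, ihx, ihy, add_zero]

/-- The summand `Fil S' · P'` is also hit by `Q`, because `Fil S` is the full preimage of `Fil S'`.
-/
theorem exists_mem_Q_of_mem_baseQ (hα : Function.Surjective α.toRingHom)
    (hFil : ∀ a, α.toRingHom a ∈ 𝓢'.Fil → a ∈ 𝓢.Fil)
    (X : Window 𝓢) (y : α.BaseChange X) (hy : y ∈ α.baseQ X) : ∃ q : X.Q, α.ι X q = y := by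
  let y' : α.baseQ X := ⟨y, hy⟩
  change ∃ q : X.Q, α.ι X q = y'
  generalize y' = z
  clear hy y' y
  induction z using α.baseQ_induction with
  | ι x => exact ⟨x, rfl⟩
  | smul_mem a y =>
    obtain ⟨x, rfl⟩ := ι_surjective hα X y
    obtain ⟨b, hb⟩ := hα a
    exact ⟨⟨b • x, X.smul_mem ⟨b, hFil b (hb ▸ a.2)⟩ x⟩, by
      change α.ι X (b • x) = (a : 𝓢'.S) • α.ι X x
      rw [map_smulₛₗ, hb]⟩
  | zero => exact ⟨0, map_zero _⟩
  | add y z hy hz =>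
    obtain ⟨a, ha⟩ := hy
    obtain ⟨b, hb⟩ := hz
    exact ⟨a + b, by rw [Submodule.coe_add, map_add, ha, hb, Submodule.coe_add]⟩
  | smul s y hy =>
    obtain ⟨a, ha⟩ := hy
    obtain ⟨s, rfl⟩ := hα s
    exact ⟨s • a, by rw [Submodule.coe_smul, map_smulₛₗ, ha, Submodule.coe_smul]⟩

/-- Two lifts of the same element differ by an element of `Ker α · P`, which lies in `Fil S · P` and
so in `Q`. Thus every linear lift of a window homomorphism automatically preserves `Q`. -/
theorem mem_Q_of_ι_mem_baseQ (hα : Function.Surjective α.toRingHom)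
    (hFil : ∀ a, α.toRingHom a ∈ 𝓢'.Fil → a ∈ 𝓢.Fil)
    (X : Window 𝓢) (x : X.P) (hx : α.ι X x ∈ α.baseQ X) : x ∈ X.Q := by
  obtain ⟨q, hq⟩ := exists_mem_Q_of_mem_baseQ hα hFil X _ hx
  have h1 : α.ι X (x - q) = 0 := by rw [map_sub, hq, sub_self]
  rw [ι_eq_zero_iff] at h1
  have h2 : RingHom.ker α.toRingHom ≤ 𝓢.Fil := fun a ha =>
    hFil a (by rw [RingHom.mem_ker.1 ha]; exact zero_mem _)
  have h3 := X.Fil_smul_top_le (Submodule.smul_mono h2 le_rfl h1)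
  simpa using add_mem h3 q.2

end FrameHom

/-! ### Thickenings of frames: base change is fully faithful. -/

namespace FrameHom

variable {p : ℕ} {𝓢 𝓢' : Frame.{u} p}

/-- A surjective strict homomorphism of normalized `p`-adic frames with the same quotient `R`,
such that the kernel is nil modulo `p` and carries a filtration on which `σ₁` is topologically
nilpotent. -/
structure IsThickening (α : FrameHom 𝓢 𝓢') (𝔞 : ℕ → Ideal 𝓢.S) : Prop where
  surjective : Function.Surjective α.toRingHom
  u_eq_one : α.u = 1
  mem_Fil (a : 𝓢.S) : α.toRingHom a ∈ 𝓢'.Fil → a ∈ 𝓢.Fil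
  isNormalized : 𝓢.IsNormalized
  isAdicComplete : IsAdicComplete (Ideal.span {(p : 𝓢.S)}) 𝓢.S
  isHausdorff : IsHausdorff (Ideal.span {(p : 𝓢'.S)}) 𝓢'.S
  ker_le_radical : RingHom.ker α.toRingHom ≤ (Ideal.span {(p : 𝓢.S)}).radical
  filtration_zero : 𝔞 0 = RingHom.ker α.toRingHom
  filtration_antitone : Antitone 𝔞
  filtration_le_Fil (k : ℕ) : 𝔞 k ≤ 𝓢.Fil
  σ₁_mem (k : ℕ) (a : 𝓢.S) (ha : a ∈ 𝔞 k) : 𝓢.σ₁ ⟨a, filtration_le_Fil k ha⟩ ∈ 𝔞 (k + 1)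
  filtration_le (k : ℕ) : 𝔞 (2 * k) ≤ Ideal.span {(p : 𝓢.S)} ^ k

namespace IsThickening

variable {α : FrameHom 𝓢 𝓢'} {𝔞 : ℕ → Ideal 𝓢.S}

theorem ker_le_Fil (h : α.IsThickening 𝔞) : RingHom.ker α.toRingHom ≤ 𝓢.Fil :=
  h.filtration_zero ▸ h.filtration_le_Fil 0

theorem smul_top_le_Q (h : α.IsThickening 𝔞) (k : ℕ) (X : Window 𝓢) :
    (𝔞 k • ⊤ : Submodule 𝓢.S X.P) ≤ X.Q :=
  (Submodule.smul_mono (h.filtration_le_Fil k) le_rfl).trans X.Fil_smul_top_le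

theorem isNormalized' (h : α.IsThickening 𝔞) : 𝓢'.IsNormalized where
  p_mem := by
    have := α.map_Fil p h.isNormalized.p_mem
    rwa [map_natCast] at this
  σ₁_p := by
    have := α.map_σ₁ ⟨p, h.isNormalized.p_mem⟩
    rw [h.isNormalized.σ₁_p, map_one, mul_one, h.u_eq_one, Units.val_one] at this
    rw [← this]
    congr 1
    exact Subtype.ext (map_natCast _ _).symm

theorem baseF₁_ι (h : α.IsThickening 𝔞) (X : Window 𝓢) (q : X.Q) :
    α.baseF₁ X ⟨α.ι X q, α.ι_mem_baseQ X q⟩ = α.ι X (X.F₁ q) := by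
  rw [FrameHom.baseF₁_ι, h.u_eq_one, Units.val_one, one_smul]

theorem exists_eq_pow_smul (h : α.IsThickening 𝔞) {k : ℕ} {X : Window 𝓢} {x : X.P}
    (hx : x ∈ (𝔞 (2 * k) • ⊤ : Submodule 𝓢.S X.P)) : ∃ y, x = (p : 𝓢.S) ^ k • y :=
  (span_pow_smul_top_mem_iff k x).1 (Submodule.smul_mono (h.filtration_le k) le_rfl hx)

/-- If linear maps `f, g : X → Y` satisfy `g ∘ Φ = F₁ ∘ f ∘ w` and `f` takes values in `𝔞 k Y`,
then `g` takes values in `𝔞 (k + 1) Y`. -/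
theorem mem_filtration_succ (h : α.IsThickening 𝔞) {X Y : Window 𝓢} {k : ℕ}
    {f g : X.P →ₗ[𝓢.S] Y.P} (hf : ∀ x, f x ∈ (𝔞 k • ⊤ : Submodule 𝓢.S Y.P))
    (hg : ∀ x, g (X.Phi h.isNormalized x) =
      Y.F₁ ⟨f (X.toQ h.isNormalized x), h.smul_top_le_Q k Y (hf _)⟩) (x : X.P) :
    g x ∈ (𝔞 (k + 1) • ⊤ : Submodule 𝓢.S Y.P) := by
  have hx : x ∈ Submodule.span 𝓢.S (Set.range (X.Phi h.isNormalized)) := by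
    rw [X.span_range_Phi]; trivial
  induction hx using Submodule.span_induction with
  | mem x hx =>
    obtain ⟨x, rfl⟩ := hx
    rw [hg]
    exact Y.F₁_mem_smul_top (h.filtration_le_Fil k) (h.σ₁_mem k) _ (hf _) _
  | zero => rw [map_zero]; exact zero_mem _
  | add x y _ _ hx hy => rw [map_add]; exact add_mem hx hy
  | smul s x _ hx => rw [map_smul]; exact Submodule.smul_mem _ _ hx

/-- The difference `d` of two homomorphisms with equal base change has values in `Ker α · Y` and
satisfies `d ∘ Φ = F₁ ∘ d ∘ w`. Bootstrapping this equation moves the values of `d` into every `𝔞 k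
· Y`, so they are divisible by all powers of `p`. -/
theorem faithful (h : α.IsThickening 𝔞) : α.baseChange.Faithful where
  map_injective {X Y} f g hfg := by
    have hfg' : α.mapLinear (Window.Hom.toLinearMap f) = α.mapLinear (Window.Hom.toLinearMap g) :=
      congrArg (fun t => Window.Hom.toLinearMap t) hfg
    let d := Window.Hom.toLinearMap f - Window.Hom.toLinearMap g
    have hd : ∀ k x, d x ∈ (𝔞 k • ⊤ : Submodule 𝓢.S Y.P) := by
      intro k
      induction k with
      | zero =>
        intro x
        rw [h.filtration_zero, ← ι_eq_zero_iff, LinearMap.sub_apply, map_sub, ← mapLinear_ι,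
          ← mapLinear_ι, hfg', sub_self]
      | succ k ih =>
        refine h.mem_filtration_succ ih fun x => ?_
        have h1 := Window.Hom.map_F₁ f (X.toQ h.isNormalized x)
        have h2 := Window.Hom.map_F₁ g (X.toQ h.isNormalized x)
        change Window.Hom.toLinearMap f (X.F₁ _) - Window.Hom.toLinearMap g (X.F₁ _) = _
        rw [h1, h2, ← map_sub]
        rfl
    apply Window.hom_ext
    rw [← sub_eq_zero]
    ext x
    exact eq_zero_of_forall_eq_pow_smul h.isAdicComplete.toIsHausdorff
      fun k => h.exists_eq_pow_smul (hd (2 * k) x)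

/-- This is the operator `f ↦ V f` whose fixed points are the window homomorphisms; it exists
because the linearization of `Φ` is bijective. -/
theorem exists_next [Fact p.Prime] (h : α.IsThickening 𝔞) {X Y : Window 𝓢}
    (f : X.P →ₗ[𝓢.S] Y.P) (hf : ∀ x ∈ X.Q, f x ∈ Y.Q) :
    ∃ g : X.P →ₗ[𝓢.S] Y.P, ∀ x, g (X.Phi h.isNormalized x) =
      Y.F₁ ⟨f (X.toQ h.isNormalized x), hf _ (X.toQ h.isNormalized x).2⟩ :=
  exists_linearMap_comp_eq 𝓢.maximal_le_comap_σ (X.Phi h.isNormalized)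
    (X.span_range_Phi h.isNormalized)
    ((Y.F₁.comp (f.restrict hf)).comp (X.toQ h.isNormalized))

/-- A linear map that reduces to a window homomorphism is corrected to one that is closer to a
window homomorphism. -/
theorem exists_next_lift [Fact p.Prime] (h : α.IsThickening 𝔞) {X Y : Window 𝓢}
    (g : Window.Hom (α.baseChangeObj X) (α.baseChangeObj Y)) (f : X.P →ₗ[𝓢.S] Y.P)
    (hf : ∀ x, α.ι Y (f x) = g.toLinearMap (α.ι X x)) (hQ : ∀ x ∈ X.Q, f x ∈ Y.Q) :
    ∃ f' : X.P →ₗ[𝓢.S] Y.P, (∀ x, α.ι Y (f' x) = g.toLinearMap (α.ι X x)) ∧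
      ∀ x, f' (X.Phi h.isNormalized x) =
        Y.F₁ ⟨f (X.toQ h.isNormalized x), hQ _ (X.toQ h.isNormalized x).2⟩ := by
  obtain ⟨f', hf'⟩ := h.exists_next f hQ
  refine ⟨f', fun x => ?_, hf'⟩
  have hx : x ∈ Submodule.span 𝓢.S (Set.range (X.Phi h.isNormalized)) := by
    rw [X.span_range_Phi]; trivial
  induction hx using Submodule.span_induction with
  | mem x hx =>
    obtain ⟨x, rfl⟩ := hx
    rw [hf', ← h.baseF₁_ι]
    let q := X.toQ h.isNormalized x
    have h1 := g.map_F₁ ⟨α.ι X q, α.ι_mem_baseQ X q⟩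
    have h2 : (α.baseChangeObj X).F₁ ⟨α.ι X q, α.ι_mem_baseQ X q⟩ = α.ι X (X.F₁ q) :=
      h.baseF₁_ι X q
    rw [h2] at h1
    refine Eq.trans ?_ h1.symm
    change α.baseF₁ Y _ = α.baseF₁ Y _
    congr 1
    exact Subtype.ext (hf _)
  | zero => rw [map_zero, map_zero, map_zero]; exact (map_zero g.toLinearMap).symm
  | add x y _ _ hx hy =>
    rw [map_add, map_add, hx, hy, map_add]
    exact (map_add g.toLinearMap _ _).symm
  | smul s x _ hx =>
    rw [map_smul, map_smulₛₗ, hx, map_smulₛₗ]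
    exact (map_smul g.toLinearMap _ _).symm

/-- Start from any linear lift and iterate `V`. Consecutive iterates differ by maps with values in
`𝔞 k · Y`, so the iterates of even index converge `p`-adically; the limit is a fixed point of `V`
and hence a homomorphism. -/
theorem full [Fact p.Prime] (h : α.IsThickening 𝔞) : α.baseChange.Full where
  map_surjective {X Y} g := by
    change Window.Hom (α.baseChangeObj X) (α.baseChangeObj Y) at g
    have hQ : ∀ f : X.P →ₗ[𝓢.S] Y.P, (∀ x, α.ι Y (f x) = g.toLinearMap (α.ι X x)) →
        ∀ x ∈ X.Q, f x ∈ Y.Q := by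
      intro f hf x hx
      refine mem_Q_of_ι_mem_baseQ h.surjective h.mem_Fil Y _ ?_
      rw [hf]
      exact g.map_Q _ (α.ι_mem_baseQ X ⟨x, hx⟩)
    let E := {f : X.P →ₗ[𝓢.S] Y.P // ∀ x, α.ι Y (f x) = g.toLinearMap (α.ι X x)}
    obtain ⟨f₀, hf₀⟩ := exists_semilinear_lift (ι_surjective h.surjective Y) (RingHom.id 𝓢.S)
      (fun x => g.toLinearMap (α.ι X x))
      (fun x y => by rw [map_add]; exact map_add g.toLinearMap _ _)
      (fun s x => by rw [map_smulₛₗ]; exact map_smul g.toLinearMap _ _)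
    choose V hVι hV using fun f : E => h.exists_next_lift g f.1 f.2 (hQ f.1 f.2)
    let f : ℕ → E := fun k => (fun e : E => (⟨V e, hVι e⟩ : E))^[k] ⟨f₀, hf₀⟩
    have hf : ∀ k x, (f (k + 1)).1 (X.Phi h.isNormalized x) =
        Y.F₁ ⟨(f k).1 (X.toQ h.isNormalized x), hQ _ (f k).2 _ (X.toQ h.isNormalized x).2⟩ := by
      intro k x
      rw [← hV (f k)]
      simp only [f, Function.iterate_succ_apply']
    have hd : ∀ k x, (f (k + 1)).1 x - (f k).1 x ∈ (𝔞 k • ⊤ : Submodule 𝓢.S Y.P) := by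
      intro k
      induction k with
      | zero =>
        intro x
        rw [h.filtration_zero, ← ι_eq_zero_iff, map_sub, (f _).2, (f _).2]
        exact sub_self _
      | succ k ih =>
        refine h.mem_filtration_succ (f := (f (k + 1)).1 - (f k).1)
          (g := (f (k + 1 + 1)).1 - (f (k + 1)).1) ih fun x => ?_
        rw [LinearMap.sub_apply, hf, hf, ← map_sub]
        rfl
    -- Two steps of the filtration are needed for one power of `p`, since `𝔞 (2 k)` is contained in
    -- `(p^k)`.
    obtain ⟨F, hF⟩ := exists_limit_linearMap h.isAdicComplete (fun k => (f (2 * k)).1) (by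
      intro k x
      have h1 := Submodule.smul_mono (h.filtration_antitone (Nat.le_succ (2 * k))) le_rfl
        (hd (2 * k + 1) x)
      have h2 := add_mem h1 (hd (2 * k) x)
      rw [sub_add_sub_cancel] at h2
      exact h.exists_eq_pow_smul h2)
    have hFg : ∀ x, α.ι Y (F x) = g.toLinearMap (α.ι X x) := by
      intro x
      apply eq_of_sub_eq_zero
      refine eq_zero_of_forall_eq_pow_smul (P := α.BaseChange Y) (q := (p : 𝓢'.S)) h.isHausdorff
        fun k => ?_
      obtain ⟨y, hy⟩ := hF k x
      refine ⟨α.ι Y y, ?_⟩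
      have h1 := congrArg (α.ι Y) hy
      rw [map_sub, (f (2 * k)).2, map_smulₛₗ, map_pow, map_natCast] at h1
      exact h1
    obtain ⟨G, hG⟩ := Window.exists_hom_of_Phi h.isNormalized F (hQ F hFg) (fun x => by
      rw [← sub_eq_zero]
      refine eq_zero_of_forall_eq_pow_smul (q := (p : 𝓢.S)) h.isAdicComplete.toIsHausdorff
        fun k => ?_
      -- The shift to `k + 1` pays for the application of `F₁`: the error term `y` need not lie in
      -- `Q`, but `p y` does, and `p^(k+1) y` is `p^k` times it.
      obtain ⟨y, hy⟩ := hF (k + 1) (X.toQ h.isNormalized x)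
      obtain ⟨z, hz⟩ := hF (k + 1) (X.Phi h.isNormalized x)
      obtain ⟨t, ht⟩ : ∃ t, (f (2 * (k + 1) + 1)).1 (X.Phi h.isNormalized x) -
          (f (2 * (k + 1))).1 (X.Phi h.isNormalized x) = (p : 𝓢.S) ^ (k + 1) • t :=
        h.exists_eq_pow_smul (hd _ _)
      let py : Y.Q := ⟨(p : 𝓢.S) • y, Y.smul_mem ⟨p, h.isNormalized.p_mem⟩ y⟩
      have h1 : (⟨F (X.toQ h.isNormalized x), hQ F hFg _ (X.toQ h.isNormalized x).2⟩ : Y.Q) =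
          ⟨(f (2 * (k + 1))).1 (X.toQ h.isNormalized x),
            hQ _ (f _).2 _ (X.toQ h.isNormalized x).2⟩ + (p : 𝓢.S) ^ k • py := by
        apply Subtype.ext
        change F _ = (f (2 * (k + 1))).1 _ + (p : 𝓢.S) ^ k • (p : 𝓢.S) • y
        rw [smul_smul, ← pow_succ, ← hy]
        abel
      rw [h1, map_add, ← hf, map_smulₛₗ, map_pow, map_natCast]
      refine ⟨(p : 𝓢.S) • z - (p : 𝓢.S) • t - Y.F₁ py, ?_⟩
      rw [smul_sub, smul_sub, smul_smul, smul_smul, ← pow_succ, ← hz, ← ht]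
      abel)
    refine ⟨G, ?_⟩
    apply Window.hom_ext
    change α.mapLinear G.toLinearMap = g.toLinearMap
    rw [hG]
    refine LinearMap.ext fun y => ?_
    obtain ⟨x, rfl⟩ := ι_surjective h.surjective X y
    rw [mapLinear_ι]
    exact hFg x

end IsThickening

end FrameHom

/-! ### Thickenings of frames: base change is essentially surjective. -/

namespace FrameHom

variable {p : ℕ} {𝓢 𝓢' : Frame.{u} p} {α : FrameHom 𝓢 𝓢'} {𝔞 : ℕ → Ideal 𝓢.S}

/-- A semilinear surjection from a window `X` to a window `Y` that exhibits `Y` as the base change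
of `X`. -/
theorem nonempty_iso_of_surjective (hα : Function.Surjective α.toRingHom) (hu : α.u = 1)
    (hFil : ∀ a, α.toRingHom a ∈ 𝓢'.Fil → a ∈ 𝓢.Fil) {X : Window 𝓢} {Y : Window 𝓢'}
    (π : X.P →ₛₗ[α.toRingHom] Y.P) (hπ : Function.Surjective π)
    (hker : ∀ x, π x = 0 → x ∈ (RingHom.ker α.toRingHom • ⊤ : Submodule 𝓢.S X.P))
    (hQ : ∀ x ∈ X.Q, π x ∈ Y.Q) (hQ' : ∀ y ∈ Y.Q, ∃ x ∈ X.Q, π x = y)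
    (hF : ∀ x, π (X.F x) = Y.F (π x)) (hF₁ : ∀ q : X.Q, π (X.F₁ q) = Y.F₁ ⟨π q, hQ q q.2⟩) :
    Nonempty (α.baseChange.obj X ≅ Y) := by
  obtain ⟨f, hf⟩ := α.exists_desc X π
  have hfb : Function.Bijective f := by
    refine ⟨(injective_iff_map_eq_zero f).2 fun y hy => ?_, fun z => ?_⟩
    · obtain ⟨x, rfl⟩ := ι_surjective hα X y
      rw [hf] at hy
      exact (ι_eq_zero_iff X x).2 (hker x hy)
    · obtain ⟨x, rfl⟩ := hπ z
      exact ⟨α.ι X x, hf x⟩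
  let e : α.BaseChange X ≃ₗ[𝓢'.S] Y.P := LinearEquiv.ofBijective f hfb
  have heQ : ∀ y ∈ α.baseQ X, f y ∈ Y.Q := by
    intro y hy
    obtain ⟨q, rfl⟩ := exists_mem_Q_of_mem_baseQ hα hFil X y hy
    rw [hf]
    exact hQ q q.2
  have heQ' : ∀ z ∈ Y.Q, e.symm z ∈ α.baseQ X := by
    intro z hz
    obtain ⟨x, hx, rfl⟩ := hQ' z hz
    have : e.symm (π x) = α.ι X x := by
      rw [LinearEquiv.symm_apply_eq]
      exact (hf x).symm
    rw [this]
    exact α.ι_mem_baseQ X ⟨x, hx⟩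
  have hfF : ∀ y, f (α.extend X X.F y) = Y.F (f y) := by
    intro y
    obtain ⟨x, rfl⟩ := ι_surjective hα X y
    rw [extend_ι, hf, hf, hF]
  have hfF₁ : ∀ y : α.baseQ X, f (α.baseF₁ X y) = Y.F₁ ⟨f y, heQ y y.2⟩ := by
    rintro ⟨y, hy⟩
    obtain ⟨q, rfl⟩ := exists_mem_Q_of_mem_baseQ hα hFil X y hy
    rw [baseF₁_ι, hu, Units.val_one, one_smul, hf, hF₁]
    congr 1
    exact Subtype.ext (hf q).symm
  have hef : ∀ z, f (e.symm z) = z := fun z => e.apply_symm_apply z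
  let i : Window.Hom (α.baseChangeObj X) Y := ⟨f, heQ, hfF, hfF₁⟩
  let j : Window.Hom Y (α.baseChangeObj X) := ⟨e.symm.toLinearMap, heQ',
    fun z => hfb.1 ((hef _).trans ((congrArg Y.F (hef z).symm).trans (hfF (e.symm z)).symm)),
    fun z => hfb.1 ((hef _).trans ((congrArg Y.F₁ (Subtype.ext (hef z).symm)).trans
      (hfF₁ ⟨e.symm z, heQ' z z.2⟩).symm))⟩
  exact ⟨{ hom := i
           inv := j
           hom_inv_id := Window.hom_ext (LinearMap.ext fun y => e.symm_apply_apply y)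
           inv_hom_id := Window.hom_ext (LinearMap.ext fun z => e.apply_symm_apply z) }⟩

namespace IsThickening

/-- Once a normal decomposition is fixed, a window is given by two semilinear maps, `F₁` on `L` and
`F` on `T`, whose images together generate. The modules lift because the kernel is nil modulo `p`,
the maps lift because the modules are projective, and generation is an open condition by Nakayama's
lemma. -/
theorem essSurj (h : α.IsThickening 𝔞) : α.baseChange.EssSurj where
  mem_essImage Y := by
    obtain ⟨L', T', hLT', hQ'⟩ := Y.exists_normal_decomposition
    have hLQ' : L' ≤ Y.Q := hQ' ▸ le_sup_left
    have hproj : ∀ (A B : Submodule 𝓢'.S Y.P), IsCompl A B →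
        Module.Finite 𝓢'.S A ∧ Module.Projective 𝓢'.S A := by
      intro A B hAB
      have hs : (A.projectionOnto B hAB) ∘ₗ A.subtype = LinearMap.id :=
        LinearMap.ext fun x => Submodule.projectionOnto_apply_left hAB x
      exact ⟨Module.Finite.of_surjective (A.projectionOnto B hAB)
        (fun x => ⟨x, LinearMap.congr_fun hs x⟩), Module.Projective.of_split _ _ hs⟩
    obtain ⟨_, _⟩ := hproj L' T' hLT'
    obtain ⟨_, _⟩ := hproj T' L' hLT'.symm
    have hHaus : IsHausdorff (Ideal.span {α.toRingHom (p : 𝓢.S)}) 𝓢'.S := by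
      rw [map_natCast]; exact h.isHausdorff
    obtain ⟨L, _, _, _, _, πL, hπL, hkerL⟩ := exists_projective_lift (P' := L') α.toRingHom
      h.surjective h.isAdicComplete hHaus h.ker_le_radical
    obtain ⟨T, _, _, _, _, πT, hπT, hkerT⟩ := exists_projective_lift (P' := T') α.toRingHom
      h.surjective h.isAdicComplete hHaus h.ker_le_radical
    let π : L × T →ₛₗ[α.toRingHom] Y.P :=
      { toFun := fun x => (πL x.1 : Y.P) + (πT x.2 : Y.P)
        map_add' := fun x y => by
          simp only [Prod.fst_add, Prod.snd_add, map_add, Submodule.coe_add]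
          abel
        map_smul' := fun s x => by
          simp only [Prod.smul_fst, Prod.smul_snd, map_smulₛₗ, Submodule.coe_smul, smul_add] }
    have hπ_apply : ∀ l t, π (l, t) = (πL l : Y.P) + (πT t : Y.P) := fun _ _ => rfl
    have hπ : Function.Surjective π := by
      intro y
      obtain ⟨l, hl, t, ht, rfl⟩ := Submodule.mem_sup.1
        (show y ∈ L' ⊔ T' by rw [hLT'.sup_eq_top]; trivial)
      obtain ⟨a, ha⟩ := hπL ⟨l, hl⟩
      obtain ⟨b, hb⟩ := hπT ⟨t, ht⟩
      exact ⟨(a, b), by rw [hπ_apply, ha, hb]⟩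
    have hinl : ∀ (I : Ideal 𝓢.S) (l : L), l ∈ (I • ⊤ : Submodule 𝓢.S L) →
        ((l, 0) : L × T) ∈ (I • ⊤ : Submodule 𝓢.S (L × T)) := by
      intro I l hl
      have := Submodule.mem_map_of_mem (f := LinearMap.inl 𝓢.S L T) hl
      rw [Submodule.map_smul''] at this
      exact Submodule.smul_mono le_rfl le_top this
    have hinr : ∀ (I : Ideal 𝓢.S) (t : T), t ∈ (I • ⊤ : Submodule 𝓢.S T) →
        ((0, t) : L × T) ∈ (I • ⊤ : Submodule 𝓢.S (L × T)) := by
      intro I t ht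
      have := Submodule.mem_map_of_mem (f := LinearMap.inr 𝓢.S L T) ht
      rw [Submodule.map_smul''] at this
      exact Submodule.smul_mono le_rfl le_top this
    have hker : ∀ x, π x = 0 →
        x ∈ (RingHom.ker α.toRingHom • ⊤ : Submodule 𝓢.S (L × T)) := by
      rintro ⟨l, t⟩ hx
      rw [hπ_apply] at hx
      have h1 : (πL l : Y.P) ∈ T' := by
        rw [eq_neg_of_add_eq_zero_left hx]
        exact neg_mem (πT t).2
      have h2 : (πL l : Y.P) = 0 := Submodule.disjoint_def.1 hLT'.disjoint _ (πL l).2 h1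
      have h3 : (πT t : Y.P) = 0 := by rwa [h2, zero_add] at hx
      have h4 := add_mem (hinl _ l (hkerL l (Subtype.ext h2)))
        (hinr _ t (hkerT t (Subtype.ext h3)))
      simpa using h4
    obtain ⟨ΦL, hΦL⟩ := exists_semilinear_lift (P := L) hπ 𝓢.σ
      (fun l => Y.F₁ ⟨πL l, hLQ' (πL l).2⟩)
      (fun x y => by
        rw [← map_add]
        congr 1
        exact Subtype.ext (by simp))
      (fun s x => by
        rw [← α.map_σ, ← map_smulₛₗ]
        congr 1
        exact Subtype.ext (by simp [map_smulₛₗ]))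
    obtain ⟨ΦT, hΦT⟩ := exists_semilinear_lift (P := T) hπ 𝓢.σ (fun t => Y.F (πT t))
      (fun x y => by rw [← map_add, map_add, Submodule.coe_add])
      (fun s x => by rw [← α.map_σ, ← map_smulₛₗ, map_smulₛₗ, Submodule.coe_smul])
    -- On `L` the operator is forced to be `p F₁`, because `F x = F₁ (p x)` over a normalized frame.
    let F : L × T →ₛₗ[𝓢.σ] L × T :=
      ((p : 𝓢.S) • ΦL).comp (LinearMap.fst 𝓢.S L T) + ΦT.comp (LinearMap.snd 𝓢.S L T)
    have hF_apply : ∀ l t, F (l, t) = (p : 𝓢.S) • ΦL l + ΦT t := fun _ _ => rfl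
    obtain ⟨Θ, hΘ⟩ := exists_theta 𝓢.Fil 𝓢.σ 𝓢.σ₁ F
    have hπF : ∀ x, π (F x) = Y.F (π x) := by
      rintro ⟨l, t⟩
      rw [hF_apply, map_add, map_smulₛₗ, hΦL, hΦT, hπ_apply, map_add, Y.F_eq h.isNormalized' (πL l),
        map_natCast]
      congr 1
      have := Y.F₁.map_smulₛₗ (p : 𝓢'.S) ⟨πL l, hLQ' (πL l).2⟩
      rw [map_natCast] at this
      exact this.symm
    have hπFil : ∀ x ∈ (𝓢.Fil • ⊤ : Submodule 𝓢.S (L × T)),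
        π x ∈ (𝓢'.Fil • ⊤ : Submodule 𝓢'.S Y.P) := by
      intro x hx
      induction hx using Submodule.smul_induction_on' with
      | smul a ha t ht =>
        rw [map_smulₛₗ]
        exact Submodule.smul_mem_smul (α.map_Fil a ha) trivial
      | add x _ y _ hx hy => rw [map_add]; exact add_mem hx hy
    have hπΘ : ∀ x (hx : x ∈ (𝓢.Fil • ⊤ : Submodule 𝓢.S (L × T))) (hxQ : π x ∈ Y.Q),
        π (Θ ⟨x, hx⟩) = Y.F₁ ⟨π x, hxQ⟩ := by
      intro x hx
      induction hx using Submodule.smul_induction_on' with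
      | smul a ha t ht =>
        intro hxQ
        have e1 : (⟨π (a • t), hxQ⟩ : Y.Q) =
            ⟨α.toRingHom a • π t, Y.smul_mem ⟨_, α.map_Fil a ha⟩ (π t)⟩ :=
          Subtype.ext (map_smulₛₗ _ _ _)
        have e2 := Y.F₁_smul ⟨_, α.map_Fil a ha⟩ (π t)
        rw [e1, hΘ a ha, map_smulₛₗ, hπF]
        refine Eq.trans ?_ e2.symm
        have e3 := α.map_σ₁ ⟨a, ha⟩
        rw [h.u_eq_one, Units.val_one, one_mul] at e3
        rw [← e3]
      | add x hx y hy ihx ihy =>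
        intro hxQ
        have hQ : ∀ z ∈ (𝓢.Fil • ⊤ : Submodule 𝓢.S (L × T)), π z ∈ Y.Q := fun z hz =>
          Y.Fil_smul_top_le (hπFil z hz)
        have e1 : (⟨x + y, add_mem hx hy⟩ : (𝓢.Fil • ⊤ : Submodule 𝓢.S (L × T))) =
          ⟨x, hx⟩ + ⟨y, hy⟩ := rfl
        have e2 : (⟨π (x + y), hxQ⟩ : Y.Q) = ⟨π x, hQ x hx⟩ + ⟨π y, hQ y hy⟩ :=
          Subtype.ext (map_add _ _ _)
        rw [e1, e2, map_add, map_add, map_add, ihx, ihy]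
    -- `Q` is `L ⊕ Fil S · T`. On `L` the operator `F₁` is the chosen lift, and on `Fil S · T` it is
    -- the only possible map `a t ↦ σ₁ a · F t`.
    let Q : Submodule 𝓢.S (L × T) := Submodule.prod ⊤ (𝓢.Fil • ⊤)
    have hmemQ : ∀ x : L × T, x ∈ Q ↔ x.2 ∈ (𝓢.Fil • ⊤ : Submodule 𝓢.S T) := fun x => by
      simp [Q, Submodule.mem_prod]
    let sT : Q →ₗ[𝓢.S] (𝓢.Fil • ⊤ : Submodule 𝓢.S (L × T)) :=
      LinearMap.codRestrict _ (LinearMap.inr 𝓢.S L T ∘ₗ LinearMap.snd 𝓢.S L T ∘ₗ Q.subtype)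
        (fun x => hinr _ _ ((hmemQ x).1 x.2))
    let F₁ : Q →ₛₗ[𝓢.σ] L × T :=
      ΦL.comp (LinearMap.fst 𝓢.S L T ∘ₗ Q.subtype) + Θ.comp sT
    have hsmul_mem : ∀ (a : 𝓢.Fil) (x : L × T), (a : 𝓢.S) • x ∈ Q := fun a x =>
      (hmemQ _).2 (Submodule.smul_mem_smul a.2 trivial)
    have hπQ : ∀ x ∈ Q, π x ∈ Y.Q := by
      rintro ⟨l, t⟩ hx
      have h1 := Y.Fil_smul_top_le (hπFil _ (hinr _ t ((hmemQ _).1 hx)))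
      rw [hπ_apply, map_zero, Submodule.coe_zero, zero_add] at h1
      rw [hπ_apply]
      exact add_mem (hLQ' (πL l).2) h1
    have hπF₁ : ∀ q : Q, π (F₁ q) = Y.F₁ ⟨π q, hπQ q q.2⟩ := by
      rintro ⟨⟨l, t⟩, hx⟩
      have h0 := hinr _ t ((hmemQ _).1 hx)
      have h1 := Y.Fil_smul_top_le (hπFil _ h0)
      change π (ΦL l + Θ ⟨(0, t), h0⟩) = _
      rw [map_add, hΦL, hπΘ _ h0 h1, ← map_add]
      congr 1
      apply Subtype.ext
      change (πL l : Y.P) + π (0, t) = π (l, t)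
      rw [hπ_apply, hπ_apply, map_zero, Submodule.coe_zero, zero_add]
    have hπQ' : ∀ y ∈ Y.Q, ∃ x ∈ Q, π x = y := by
      intro y hy
      rw [hQ'] at hy
      obtain ⟨l, hl, z, hz, rfl⟩ := Submodule.mem_sup.1 hy
      obtain ⟨a, ha⟩ := hπL ⟨l, hl⟩
      obtain ⟨b, hb, hbz⟩ : ∃ b ∈ (𝓢.Fil • ⊤ : Submodule 𝓢.S T), (πT b : Y.P) = z := by
        clear hy
        induction hz using Submodule.smul_induction_on' with
        | smul c hc t ht =>
          obtain ⟨c, rfl⟩ := h.surjective c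
          obtain ⟨b, hb⟩ := hπT ⟨t, ht⟩
          exact ⟨c • b, Submodule.smul_mem_smul (h.mem_Fil c hc) trivial, by
            rw [map_smulₛₗ, Submodule.coe_smul, hb]⟩
        | add x _ y _ hx hy =>
          obtain ⟨b, hb, rfl⟩ := hx
          obtain ⟨c, hc, rfl⟩ := hy
          exact ⟨b + c, add_mem hb hc, by rw [map_add, Submodule.coe_add]⟩
      exact ⟨(a, b), (hmemQ _).2 hb, by rw [hπ_apply, ha, hbz]⟩
    let X : Window 𝓢 :=
      { P := L × T
        Q := Q
        F := F
        F₁ := F₁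
        exists_normal_decomposition := by
          refine ⟨LinearMap.range (LinearMap.inl 𝓢.S L T), LinearMap.range (LinearMap.inr 𝓢.S L T),
            LinearMap.isCompl_range_inl_inr, ?_⟩
          have e : 𝓢.Fil • LinearMap.range (LinearMap.inr 𝓢.S L T) =
              Submodule.map (LinearMap.inr 𝓢.S L T) (𝓢.Fil • ⊤) := by
            rw [Submodule.map_smul'', Submodule.map_top]
          rw [e, LinearMap.range_eq_map, ← LinearMap.prod_eq_sup_map]
        smul_mem := hsmul_mem
        F₁_smul := by
          rintro a ⟨l, t⟩
          -- The `T`-component is the defining property of `Θ`. The `L`-component is `σ a · ΦL l =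
          -- σ₁ a · p ΦL l`, that is, `p σ₁ = σ`.
          have e1 : sT ⟨(a : 𝓢.S) • (l, t), hsmul_mem a (l, t)⟩ =
              ⟨(a : 𝓢.S) • (0, t), Submodule.smul_mem_smul a.2 trivial⟩ :=
            Subtype.ext (Prod.ext (smul_zero _).symm rfl)
          change ΦL ((a : 𝓢.S) • l) + Θ (sT ⟨(a : 𝓢.S) • (l, t), _⟩) = _
          rw [e1, hΘ a a.2, map_smulₛₗ, hF_apply, hF_apply, map_zero, smul_zero, zero_add,
            smul_add, smul_smul, ← h.isNormalized.p_mul_σ₁, mul_comm]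
        span_range_F₁ := by
          rw [eq_top_iff]
          -- Nakayama: the kernel of `α` lies in the radical, and modulo it the image of `F₁`
          -- generates because it does so for `Y`.
          refine Submodule.le_of_le_smul_of_le_jacobson_bot Module.Finite.fg_top
            ((h.ker_le_Fil.trans le_sup_right).trans 𝓢.le_jacobson) ?_
          intro x _
          have h1 : ∀ y, ∃ z ∈ Submodule.span 𝓢.S (Set.range F₁), π z = y := by
            intro y
            have hy : y ∈ Submodule.span 𝓢'.S (Set.range Y.F₁) := by
              rw [Y.span_range_F₁]; trivial
            induction hy using Submodule.span_induction with
            | mem y hy =>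
              obtain ⟨⟨q, hq⟩, rfl⟩ := hy
              obtain ⟨x, hx, rfl⟩ := hπQ' q hq
              exact ⟨F₁ ⟨x, hx⟩, Submodule.subset_span ⟨_, rfl⟩, hπF₁ ⟨x, hx⟩⟩
            | zero => exact ⟨0, zero_mem _, map_zero _⟩
            | add y z _ _ hy hz =>
              obtain ⟨a, ha, rfl⟩ := hy
              obtain ⟨b, hb, rfl⟩ := hz
              exact ⟨a + b, add_mem ha hb, map_add _ _ _⟩
            | smul s y _ hy =>
              obtain ⟨a, ha, rfl⟩ := hy
              obtain ⟨s, rfl⟩ := h.surjective s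
              exact ⟨s • a, Submodule.smul_mem _ _ ha, map_smulₛₗ _ _ _⟩
          obtain ⟨z, hz, hzx⟩ := h1 (π x)
          have h2 := hker (x - z) (by rw [map_sub, hzx, sub_self])
          rw [← add_sub_cancel z x]
          exact Submodule.add_mem_sup hz h2 }
    exact ⟨X, nonempty_iso_of_surjective (X := X) h.surjective h.u_eq_one h.mem_Fil π hπ hker hπQ
      hπQ' hπF hπF₁⟩

/-- Base change along a topologically nilpotent thickening of frames is an equivalence of window
categories. -/
theorem isCrystalline [Fact p.Prime] (h : α.IsThickening 𝔞) : α.IsCrystalline where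
  faithful := h.faithful
  full := h.full
  essSurj := h.essSurj

end IsThickening

end FrameHom

/-! ### Rigidity of homomorphisms from Witt vectors of a perfect ring. -/

section Uniqueness

variable {p : ℕ} [hp : Fact p.Prime] {A : Type*} [CommRing A]

/-- Ring homomorphisms from `W(k)`, where `k` is perfect, to a `p`-adically separated ring
coincide if they coincide modulo `p`. -/
theorem wittVector_hom_ext {k : Type*} [CommRing k] [CharP k p] [PerfectRing k p]
    (hA : IsHausdorff (Ideal.span {(p : A)}) A) {f g : WittVector p k →+* A}
    (hfg : ∀ x, (p : A) ∣ f x - g x) : f = g := by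
  have h1 : ∀ a : k, f (WittVector.teichmuller p a) = g (WittVector.teichmuller p a) := by
    intro a
    rw [← sub_eq_zero]
    refine eq_zero_of_forall_eq_pow_mul hA fun n => ?_
    -- Taking the `p^n`-th power improves the congruence `f [b] ≡ g [b]` modulo `p` to one modulo
    -- `p^(n+1)`.
    obtain ⟨b, rfl⟩ : ∃ b : k, b ^ p ^ n = a := by
      obtain ⟨b, hb⟩ := (bijective_iterateFrobenius k p n).2 a
      exact ⟨b, hb⟩
    obtain ⟨y, hy⟩ := dvd_sub_pow_of_dvd_sub (hfg (WittVector.teichmuller p b)) n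
    exact ⟨p * y, by rw [map_pow, map_pow, map_pow, hy, pow_succ, mul_assoc]⟩
  have h2 : ∀ n x, ∃ y, f x - g x = (p : A) ^ n * y := by
    intro n
    induction n with
    | zero => exact fun x => ⟨f x - g x, by rw [pow_zero, one_mul]⟩
    | succ n ih =>
      intro x
      -- As `x` is a Teichmüller element plus `p z`, agreement at `z` modulo `p^n` gives agreement
      -- at `x` modulo `p^(n+1)`.
      have h3 : x - WittVector.teichmuller p (x.coeff 0) ∈ Ideal.span {(p : WittVector p k)} := by
        rw [← WittVector.ker_constantCoeff, RingHom.mem_ker, map_sub, sub_eq_zero]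
        exact (WittVector.teichmuller_coeff_zero p (x.coeff 0)).symm
      obtain ⟨z, hz⟩ := Ideal.mem_span_singleton'.1 h3
      obtain ⟨y, hy⟩ := ih z
      have hx : x = WittVector.teichmuller p (x.coeff 0) + z * p := by rw [hz]; ring
      refine ⟨y, ?_⟩
      rw [hx, map_add, map_add, h1, map_mul, map_mul, map_natCast, map_natCast]
      linear_combination (p : A) * hy
  ext x
  rw [← sub_eq_zero]
  exact eq_zero_of_forall_eq_pow_mul hA fun n => h2 n x

end Uniqueness

/-! ### Homomorphisms from the `p`-adic completion. -/

namespace Completion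

variable {p : ℕ} {D A : Type u} [CommRing D] [CommRing A]

theorem exists_eq_add_mul (x : Compl p D) (d : D)
    (hd : AdicCompletion.evalₐ (Ideal.span {(p : D)}) 1 x = Ideal.Quotient.mk _ d) :
    ∃ y, x = algebraMap D (Compl p D) d + p * y := by
  have h1 : x - algebraMap D (Compl p D) d ∈ Ideal.span {(p : Compl p D)} := by
    rw [span_p_eq_ker, RingHom.mem_ker, map_sub, sub_eq_zero]
    change AdicCompletion.evalOneₐ _ x = AdicCompletion.evalOneₐ _ _
    rw [evalOneₐ_eq x d hd]
    rfl
  obtain ⟨y, hy⟩ := Ideal.mem_span_singleton'.1 h1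
  exact ⟨y, by linear_combination -hy⟩

theorem evalₐ_algebraMap (n : ℕ) (d : D) :
    AdicCompletion.evalₐ (Ideal.span {(p : D)}) n (algebraMap D (Compl p D) d) =
      Ideal.Quotient.mk _ d :=
  AlgHom.commutes (AdicCompletion.evalₐ (Ideal.span {(p : D)}) n) d

theorem isAdicComplete (p : ℕ) (D : Type u) [CommRing D] :
    IsAdicComplete (Ideal.span {(p : Compl p D)}) (Compl p D) := by
  have := AdicCompletion.isAdicComplete_self (Ideal.span {(p : D)}) ⟨{(p : D)}, by simp⟩
  rwa [Ideal.map_span, Set.image_singleton, map_natCast] at this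

/-- Every element of the completion is `d + p y` with `d ∈ D`, so each application of this
decomposition gains one power of `p`; no continuity assumption enters. -/
theorem hom_ext (hA : IsHausdorff (Ideal.span {(p : A)}) A) {f g : Compl p D →+* A}
    (hfg : ∀ d, f (algebraMap D _ d) = g (algebraMap D _ d)) : f = g := by
  have h2 : ∀ n x, ∃ y, f x - g x = (p : A) ^ n * y := by
    intro n
    induction n with
    | zero => exact fun x => ⟨f x - g x, by rw [pow_zero, one_mul]⟩
    | succ n ih =>
      intro x
      obtain ⟨d, hd⟩ := exists_evalₐ_eq 1 x
      obtain ⟨z, hz⟩ := exists_eq_add_mul x d hd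
      obtain ⟨y, hy⟩ := ih z
      refine ⟨y, ?_⟩
      rw [hz, map_add, map_add, hfg, map_mul, map_mul, map_natCast, map_natCast]
      linear_combination (p : A) * hy
  ext x
  rw [← sub_eq_zero]
  exact eq_zero_of_forall_eq_pow_mul hA fun n => h2 n x

/-- Ring homomorphisms to a `p`-adically complete ring extend to the `p`-adic completion. -/
theorem exists_extension (hA : IsAdicComplete (Ideal.span {(p : A)}) A) (f : D →+* A) :
    ∃ g : Compl p D →+* A, ∀ d, g (algebraMap D _ d) = f d := by
  have hle : ∀ n, Ideal.span {(p : D)} ^ n ≤ (Ideal.span {(p : A)} ^ n).comap f := by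
    intro n
    rw [Ideal.span_singleton_pow, Ideal.span_singleton_pow, Ideal.span_singleton_le_iff_mem,
      Ideal.mem_comap, map_pow, map_natCast]
    exact Ideal.mem_span_singleton_self _
  let F : (n : ℕ) → Compl p D →+* A ⧸ Ideal.span {(p : A)} ^ n := fun n =>
    (Ideal.quotientMap (Ideal.span {(p : A)} ^ n) f (hle n)).comp
      (AdicCompletion.evalₐ (Ideal.span {(p : D)}) n : Compl p D →+* _)
  have hF : ∀ {m n : ℕ} (hmn : m ≤ n),
      (Ideal.Quotient.factorPow (Ideal.span {(p : A)}) hmn).comp (F n) = F m := by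
    intro m n hmn
    ext x
    obtain ⟨d, hd⟩ := exists_evalₐ_eq n x
    have hd' := evalₐ_of_le hmn x d hd
    simp only [F, RingHom.comp_apply, RingHom.coe_coe, hd, hd', Ideal.quotientMap_mk]
    rfl
  refine ⟨IsAdicComplete.liftRingHom _ F hF, fun d => ?_⟩
  rw [← sub_eq_zero]
  refine eq_zero_of_forall_eq_pow_mul hA.toIsHausdorff fun n => ?_
  have h1 := IsAdicComplete.mk_liftRingHom (Ideal.span {(p : A)}) F hF n (algebraMap D _ d)
  rw [show F n (algebraMap D _ d) = Ideal.Quotient.mk _ (f d) by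
    simp only [F, RingHom.comp_apply, RingHom.coe_coe, evalₐ_algebraMap, Ideal.quotientMap_mk],
    Ideal.Quotient.eq, Ideal.span_singleton_pow] at h1
  obtain ⟨y, hy⟩ := Ideal.mem_span_singleton'.1 h1
  exact ⟨y, by rw [← hy, mul_comm]⟩

end Completion

/-! ### Homomorphisms from the divided power envelope. -/

namespace PDEnvelope

variable {p : ℕ} [hp : Fact p.Prime] {W A : Type u} [CommRing W] [CommRing A] {I : Ideal W}
  {σ : A →+* A}

/-- Extension of a ring homomorphism with `I ↦ p A` to the divided power envelope, when `A` has
a Frobenius lift and no `p`-torsion. -/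
theorem exists_extension (hA : IsFrobeniusBase p σ) (ψ : W →+* A)
    (hψ : ∀ i : I, (p : A) ∣ ψ i) :
    ∃ g : PDEnvelope p I →+* A, (∀ w, g (of p I w) = ψ w) ∧
      ∀ n ≠ 0, ∀ i : I, (p : A) ∣ g (γ p I n i) := by
  choose b hb using hψ
  -- Writing `ψ i = p b`, the divided power `ψ(i)^n / n!` exists in `A` as `(p^n / n!) b^n`. Since
  -- `n!` can be cancelled, every relation reduces to one between powers of `ψ i`.
  let f : ℕ → I → A := fun n i => hA.dpowP n * b i ^ n
  have hf : ∀ n i, (n ! : A) * f n i = ψ i ^ n := fun n i => by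
    rw [← mul_assoc, hA.factorial_mul_dpowP, ← mul_pow, ← hb]
  refine ⟨PDEnvelope.lift ψ f ?_ ?_ ?_ ?_ ?_ ?_, fun w => lift_of _ _ _ _ _ _ _ _ _,
    fun n hn i => ?_⟩
  · intro i
    simpa using hf 0 i
  · intro n w i
    apply hA.natCast_cancel (Nat.factorial_ne_zero n)
    rw [hf, mul_left_comm, hf, ← mul_pow, ← map_mul]
    rfl
  · intro m n i
    apply hA.natCast_cancel (mul_ne_zero (Nat.factorial_ne_zero m) (Nat.factorial_ne_zero n))
    have h1 := hf (m + n) i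
    rw [← Nat.add_choose_mul_factorial_mul_factorial, pow_add, ← hf m, ← hf n] at h1
    rw [Nat.choose_symm_add]
    push_cast at h1 ⊢
    linear_combination -h1
  · intro n i j
    apply hA.natCast_cancel (Nat.factorial_ne_zero n)
    rw [hf, Submodule.coe_add, map_add, (Commute.all _ _).add_pow', Finset.mul_sum]
    refine Finset.sum_congr rfl fun k hk => ?_
    rw [Finset.HasAntidiagonal.mem_antidiagonal] at hk
    have h1 := Nat.add_choose_mul_factorial_mul_factorial k.1 k.2
    have h2 := congrArg (Nat.cast (R := A)) h1
    rw [← hk, ← hf, ← hf, nsmul_eq_mul]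
    push_cast at h2
    rw [Nat.choose_symm_add]
    linear_combination (f k.1 i * f k.2 j) * h2
  · intro i
    simpa using hf 1 i
  · intro n i w hi hw
    apply hA.natCast_cancel (Nat.factorial_ne_zero n)
    rw [hf, hi, map_natCast, ← map_natCast ψ, ← map_natCast ψ, ← map_pow, ← hw, map_mul]
  · rw [lift_γ]
    -- For `n ≥ 1` already `p^(n-1) / n!` is integral, so `p` divides `p^n / n!`.
    refine Dvd.dvd.mul_right ?_ _
    rw [IsFrobeniusBase.dpowP, if_neg hn]
    exact Dvd.intro _ rfl

end PDEnvelope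

/-! ### The homomorphism from `A_cris(R)` to a lift: existence and uniqueness. -/

namespace Lift

variable {p : ℕ} [hp : Fact p.Prime] {R A : Type u} [CommRing R] [CommRing A] (L : Lift p R A)

theorem π_eq_zero_iff (a : A) : L.π a = 0 ↔ (p : A) ∣ a := by
  rw [← RingHom.mem_ker, L.ker_eq, Ideal.mem_span_singleton]

/-- An integer prime to `p` is a unit because it is one modulo `p`, and `p` lies in the radical of
the complete ring `A`. -/
theorem isFrobeniusBase : IsFrobeniusBase p L.σ where
  torsionFree := L.torsionFree
  isUnit_of_coprime m hm := by
    have := L.isAdicComplete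
    obtain ⟨a, b, hab⟩ : ∃ a b : ℤ, a * p + b * m = 1 := Nat.isCoprime_iff_coprime.2 hm
    have hJ : Ideal.span {(p : A)} ≤ Ideal.jacobson ⊥ := IsAdicComplete.le_jacobson_bot _
    have h1 : (a : A) * p + b * m = 1 := by exact_mod_cast congrArg (Int.cast (R := A)) hab
    have h2 := Ideal.mem_jacobson_bot.1 (hJ (Ideal.mem_span_singleton_self (p : A))) (-a)
    have h3 : (p : A) * -a + 1 = b * m := by linear_combination -h1
    rw [h3] at h2
    exact isUnit_of_mul_isUnit_right h2
  frobenius_lift x := by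
    have : (p : A) ∣ L.σ x - x ^ p := by
      rw [← L.π_eq_zero_iff, map_sub, L.π_σ, map_pow, sub_self]
    obtain ⟨y, hy⟩ := this
    exact ⟨y, by linear_combination hy⟩

variable [CharP R p]

/-- Ring homomorphisms `A_cris(R) → A` coincide if they coincide modulo `p`. -/
theorem acris_hom_ext {f g : Acris p R →+* A} (hfg : ∀ x, L.π (f x) = L.π (g x)) : f = g := by
  have hH := L.isAdicComplete.toIsHausdorff
  refine Completion.hom_ext hH fun d => ?_
  let c : AcrisPre p R →+* Acris p R := algebraMap _ _
  have h1 : (f.comp c).comp (PDEnvelope.of p _) = (g.comp c).comp (PDEnvelope.of p _) :=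
    wittVector_hom_ext hH fun x => by
      rw [← L.π_eq_zero_iff, map_sub, sub_eq_zero]
      exact hfg _
  have h2 : f.comp c = g.comp c := by
    refine PDEnvelope.hom_ext (fun w => RingHom.congr_fun h1 w) fun n i => ?_
    -- The image of `i^{[n]}` is determined by that of `n! i^{[n]} = i^n`.
    apply L.isFrobeniusBase.natCast_cancel (Nat.factorial_ne_zero n)
    rw [← map_natCast (f.comp c), ← map_mul, PDEnvelope.factorial_mul_γ, map_natCast,
      ← map_natCast (g.comp c), ← map_mul, PDEnvelope.factorial_mul_γ, map_pow, map_pow]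
    exact congrArg (· ^ n) (RingHom.congr_fun h1 i)
  exact RingHom.congr_fun h2 d

theorem acris_toR_algebraMap (d : AcrisPre p R) : Acris.toR p R (algebraMap _ _ d) =
    (Winf.isFrobeniusBase p R).toR (Winf.toR p R) (CharP.cast_eq_zero R p) d :=
  Completion.toQuot_eq _ _ 0 _ d (Completion.evalₐ_algebraMap _ d)

/-- The homomorphism `A_cris(R) → A` over `R`. -/
theorem exists_acris_hom (ψ : Winf p R →+* A) (hψ : ∀ x, L.π (ψ x) = Winf.toR p R x) :
    ∃ ϰ : Acris p R →+* A, (∀ w, ϰ (algebraMap (AcrisPre p R) _ (PDEnvelope.of p _ w)) = ψ w) ∧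
      ∀ x, L.π (ϰ x) = Acris.toR p R x := by
  obtain ⟨g, hg, hgγ⟩ := PDEnvelope.exists_extension (I := RingHom.ker (Winf.toR p R))
    L.isFrobeniusBase ψ (fun i => by rw [← L.π_eq_zero_iff, hψ]; exact i.2)
  obtain ⟨ϰ, hϰ⟩ := Completion.exists_extension L.isAdicComplete g
  refine ⟨ϰ, fun w => by rw [hϰ, hg], fun x => ?_⟩
  have h1 : L.π.comp g =
      (Winf.isFrobeniusBase p R).toR (Winf.toR p R) (CharP.cast_eq_zero R p) := by
    refine PDEnvelope.hom_ext (fun w => ?_) fun n i => ?_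
    · rw [RingHom.comp_apply, hg, hψ, IsFrobeniusBase.toR_of]
    · rw [RingHom.comp_apply, IsFrobeniusBase.toR_γ]
      by_cases hn : n = 0
      · rw [hn, PDEnvelope.γ_zero, map_one, map_one, if_pos rfl]
      · rw [if_neg hn, L.π_eq_zero_iff]
        exact hgγ n hn i
  obtain ⟨d, hd⟩ := Completion.exists_evalₐ_eq 1 x
  obtain ⟨y, rfl⟩ := Completion.exists_eq_add_mul x d hd
  rw [map_add, map_add, map_add, hϰ, acris_toR_algebraMap, ← h1, map_mul, map_mul, map_mul,
    map_natCast, map_natCast, map_natCast, CharP.cast_eq_zero, zero_mul, zero_mul]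
  rfl

end Lift

/-! ### A filtration on which `σ₁` is topologically nilpotent. -/

namespace Frame

variable {p : ℕ} (𝓢 : Frame.{u} p)

/-- The ideal of all `a ∈ Fil S` with `σ₁ a ∈ J`. -/
def σ₁Comap (J : Ideal 𝓢.S) : Ideal 𝓢.S :=
  Submodule.map 𝓢.Fil.subtype (Submodule.comap 𝓢.σ₁ J)

theorem mem_σ₁Comap {J : Ideal 𝓢.S} {a : 𝓢.S} :
    a ∈ 𝓢.σ₁Comap J ↔ ∃ ha : a ∈ 𝓢.Fil, 𝓢.σ₁ ⟨a, ha⟩ ∈ J := by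
  constructor
  · rintro ⟨b, hb, rfl⟩
    exact ⟨b.2, hb⟩
  · rintro ⟨ha, h⟩
    exact ⟨⟨a, ha⟩, h, rfl⟩

theorem σ₁_natCast_mul (c : ℕ) (a : 𝓢.S) (ha : a ∈ 𝓢.Fil) (hca : (c : 𝓢.S) * a ∈ 𝓢.Fil) :
    𝓢.σ₁ ⟨c * a, hca⟩ = c * 𝓢.σ₁ ⟨a, ha⟩ := by
  have := 𝓢.σ₁.map_smulₛₗ (c : 𝓢.S) ⟨a, ha⟩
  rwa [map_natCast, smul_eq_mul] at this

/-- The filtration `N ⊇ N₁ ⊇ p N ⊇ p N₁ ⊇ p² N ⊇ ...` where `N₁` consists of all `a ∈ N` with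
`σ₁ a ∈ p N`. -/
def filtration (N : Ideal 𝓢.S) (k : ℕ) : Ideal 𝓢.S :=
  Ideal.span {((p ^ (k / 2) : ℕ) : 𝓢.S)} *
    if k % 2 = 0 then N else N ⊓ 𝓢.σ₁Comap (Ideal.span {(p : 𝓢.S)} * N)

variable {𝓢}

theorem filtration_le_self (N : Ideal 𝓢.S) (k : ℕ) : 𝓢.filtration N k ≤ N := by
  refine Ideal.mul_le_right.trans ?_
  split
  · exact le_rfl
  · exact inf_le_left

theorem filtration_two_mul (N : Ideal 𝓢.S) (k : ℕ) :
    𝓢.filtration N (2 * k) = Ideal.span {((p ^ k : ℕ) : 𝓢.S)} * N := by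
  rw [filtration, if_pos (by omega), show 2 * k / 2 = k by omega]

theorem filtration_two_mul_add_one (N : Ideal 𝓢.S) (k : ℕ) :
    𝓢.filtration N (2 * k + 1) = Ideal.span {((p ^ k : ℕ) : 𝓢.S)} *
      (N ⊓ 𝓢.σ₁Comap (Ideal.span {(p : 𝓢.S)} * N)) := by
  rw [filtration, if_neg (by omega), show (2 * k + 1) / 2 = k by omega]

theorem span_pow_succ_mul (N : Ideal 𝓢.S) (k : ℕ) :
    Ideal.span {((p ^ (k + 1) : ℕ) : 𝓢.S)} * N =
      Ideal.span {((p ^ k : ℕ) : 𝓢.S)} * (Ideal.span {(p : 𝓢.S)} * N) := by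
  rw [← mul_assoc, Ideal.span_singleton_mul_span_singleton]
  push_cast
  rw [pow_succ]

/-- The one inclusion with content is `p N ≤ N₁`, which holds because `σ₁ (p y) = p σ₁ y` and `N` is
stable under `σ₁`. -/
theorem filtration_antitone {N : Ideal 𝓢.S} (hN : N ≤ 𝓢.Fil) (h1 : N ≤ 𝓢.σ₁Comap N) :
    Antitone (𝓢.filtration N) := by
  refine antitone_nat_of_succ_le fun n => ?_
  obtain ⟨k, rfl | rfl⟩ : ∃ k, n = 2 * k ∨ n = 2 * k + 1 := ⟨n / 2, by omega⟩
  · rw [filtration_two_mul, filtration_two_mul_add_one]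
    exact Ideal.mul_mono_right inf_le_left
  · rw [filtration_two_mul_add_one, show 2 * k + 1 + 1 = 2 * (k + 1) by ring, filtration_two_mul,
      span_pow_succ_mul]
    refine Ideal.mul_mono_right (le_inf Ideal.mul_le_right ?_)
    intro x hx
    obtain ⟨y, hy, rfl⟩ := Ideal.mem_span_singleton_mul.1 hx
    have hpy := 𝓢.Fil.mul_mem_left (p : 𝓢.S) (hN hy)
    refine 𝓢.mem_σ₁Comap.2 ⟨hpy, ?_⟩
    rw [𝓢.σ₁_natCast_mul p y (hN hy)]
    exact Ideal.mul_mem_mul (Ideal.mem_span_singleton_self _) (𝓢.mem_σ₁Comap.1 (h1 hy)).2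

/-- As `σ₁` commutes with multiplication by `p^k`, only two steps matter. From `N` to `N₁` it is the
assumption that `σ₁ ∘ σ₁` maps `N` into `p N`; from `N₁` to `p N` it is the definition of `N₁`. -/
theorem σ₁_mem_filtration {N : Ideal 𝓢.S} (hN : N ≤ 𝓢.Fil) (h1 : N ≤ 𝓢.σ₁Comap N)
    (h2 : N ≤ 𝓢.σ₁Comap (𝓢.σ₁Comap (Ideal.span {(p : 𝓢.S)} * N))) (k : ℕ) (a : 𝓢.S)
    (ha : a ∈ 𝓢.filtration N k) (haF : a ∈ 𝓢.Fil) :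
    𝓢.σ₁ ⟨a, haF⟩ ∈ 𝓢.filtration N (k + 1) := by
  obtain ⟨k, rfl | rfl⟩ : ∃ j, k = 2 * j ∨ k = 2 * j + 1 := ⟨k / 2, by omega⟩
  · rw [filtration_two_mul] at ha
    rw [filtration_two_mul_add_one]
    obtain ⟨y, hy, rfl⟩ := Ideal.mem_span_singleton_mul.1 ha
    rw [𝓢.σ₁_natCast_mul _ y (hN hy)]
    exact Ideal.mul_mem_mul (Ideal.mem_span_singleton_self _)
      ⟨(𝓢.mem_σ₁Comap.1 (h1 hy)).2, (𝓢.mem_σ₁Comap.1 (h2 hy)).2⟩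
  · rw [filtration_two_mul_add_one] at ha
    rw [show 2 * k + 1 + 1 = 2 * (k + 1) by ring, filtration_two_mul, span_pow_succ_mul]
    obtain ⟨y, hy, rfl⟩ := Ideal.mem_span_singleton_mul.1 ha
    rw [𝓢.σ₁_natCast_mul _ y (hN hy.1)]
    exact Ideal.mul_mem_mul (Ideal.mem_span_singleton_self _) (𝓢.mem_σ₁Comap.1 hy.2).2

/-- `σ₁ (σ₁ (p z)) = p σ₁ (σ₁ z)`, where stability of `N` keeps `σ₁ z` inside `Fil S`. -/
theorem p_mul_mem_σ₁Comap_σ₁Comap {N : Ideal 𝓢.S} (hN : N ≤ 𝓢.Fil) (h1 : N ≤ 𝓢.σ₁Comap N)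
    {z : 𝓢.S} (hz : z ∈ N) :
    (p : 𝓢.S) * z ∈ 𝓢.σ₁Comap (𝓢.σ₁Comap (Ideal.span {(p : 𝓢.S)})) := by
  obtain ⟨hzF, hσz⟩ := 𝓢.mem_σ₁Comap.1 (h1 hz)
  refine 𝓢.mem_σ₁Comap.2 ⟨𝓢.Fil.mul_mem_left _ hzF, ?_⟩
  rw [𝓢.σ₁_natCast_mul p z hzF]
  refine 𝓢.mem_σ₁Comap.2 ⟨𝓢.Fil.mul_mem_left _ (hN hσz), ?_⟩
  rw [𝓢.σ₁_natCast_mul p _ (hN hσz)]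
  exact Ideal.mul_mem_right _ _ (Ideal.mem_span_singleton_self _)

theorem filtration_le_span_pow (N : Ideal 𝓢.S) (k : ℕ) :
    𝓢.filtration N (2 * k) ≤ Ideal.span {(p : 𝓢.S)} ^ k := by
  rw [filtration_two_mul, Ideal.span_singleton_pow, Nat.cast_pow]
  exact Ideal.mul_le_left

end Frame

/-! ### Generators of the kernel of the envelope, and `σ₁` on divided powers. -/

namespace IsFrobeniusBase

variable {p : ℕ} [hp : Fact p.Prime] {W R : Type u} [CommRing W] [CommRing R] {σ : W →+* W}
  (h : IsFrobeniusBase p σ) (q : W →+* R) (hR : (p : R) = 0)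

open PDEnvelope

/-- `σ₁ (i^{[n]}) = (p n)! / (p · n!) · i^{[p n]}` if `σ i = i ^ p`. -/
theorem σ₁_γ_of_σ_eq_pow (n : ℕ) (hn : n ≠ 0) (i : RingHom.ker q) (hi : σ i = (i : W) ^ p)
    (hγ : γ p _ n i ∈ RingHom.ker (h.toR q hR)) :
    h.σ₁ q hR ⟨γ p _ n i, hγ⟩ =
      ((p ^ (n - 1) * ((p - 1)! ^ n * Nat.uniformBell n p) : ℕ) : PDEnvelope p (RingHom.ker q)) *
        γ p _ (p * n) i := by
  -- With `δ i = 0` the element `s i` is just `(p - 1)! i^{[p]}`.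
  have hδ : h.δ (i : W) = 0 := by
    apply h.p_cancel
    have := h.σ_eq (i : W)
    rw [hi] at this
    linear_combination -this
  obtain ⟨N, hN1, hN2⟩ := γ_pow (p := p) q i n
  -- The integer `(pn)! / (p!)^n` contains the factor `n!` that cancels the denominator of `p^(n-1)
  -- / n!`. Writing the coefficient in this way keeps the power `p^(n-1)` visible.
  have hN : N = Nat.uniformBell n p * n ! := by
    apply Nat.eq_of_mul_eq_mul_right (pow_pos (Nat.factorial_pos p) n)
    rw [hN1, mul_comm p n, ← Nat.uniformBell_mul_eq n hp.out.ne_zero]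
    ring
  have hc := congrArg (of p (RingHom.ker q)) (h.factorial_mul_coeff hn)
  rw [map_mul, map_natCast, map_pow, map_natCast] at hc
  rw [h.σ₁_γ q hR n hn, s, hδ, map_zero, add_zero, mul_pow, hN2, hN]
  push_cast
  linear_combination ((((p - 1)! : ℕ) : PDEnvelope p (RingHom.ker q)) ^ n *
    (Nat.uniformBell n p : PDEnvelope p (RingHom.ker q)) * γ p _ (p * n) i) * hc

/-- If the kernel `I` of `W → R` is generated by a set `E` and `p`, then the kernel of the map from
the divided power envelope to `R` is generated by `p` and the divided powers of elements of `E`. -/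
theorem ker_toR_le_of_span (E : Set (RingHom.ker q))
    (hE : Submodule.span W (insert (pKer q hR) E) = ⊤) :
    RingHom.ker (h.toR q hR) ≤
      Ideal.span {x | ∃ n ≠ 0, ∃ i ∈ E, x = γ p (RingHom.ker q) n i} ⊔
        Ideal.span {(p : PDEnvelope p (RingHom.ker q))} := by
  set K := Ideal.span {x | ∃ n ≠ 0, ∃ i ∈ E, x = γ p (RingHom.ker q) n i} ⊔
    Ideal.span {(p : PDEnvelope p (RingHom.ker q))} with hK
  have hpK : (p : PDEnvelope p (RingHom.ker q)) ∈ K :=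
    Submodule.mem_sup_right (Ideal.mem_span_singleton_self _)
  have hKker : K ≤ RingHom.ker (h.toR q hR) := by
    refine sup_le (Ideal.span_le.2 ?_) ?_
    · rintro _ ⟨n, hn, i, _, rfl⟩
      rw [SetLike.mem_coe, RingHom.mem_ker, toR_γ, if_neg hn]
    · rw [Ideal.span_singleton_le_iff_mem, RingHom.mem_ker, map_natCast, hR]
  -- Positive divided powers of sums and multiples expand into terms that each contain a positive
  -- divided power of a generator, and those of `p` itself are divisible by `p`.
  have hγ : ∀ i : RingHom.ker q, ∀ n ≠ 0, γ p (RingHom.ker q) n i ∈ K := by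
    intro i
    have hi : i ∈ Submodule.span W (insert (pKer q hR) E) := by rw [hE]; trivial
    induction hi using Submodule.span_induction with
    | mem i hi =>
      intro n hn
      rcases hi with rfl | hi
      · rw [γ_p (i := pKer q hR) rfl (h.factorial_mul_dpowP n), dpowP, if_neg hn, map_mul,
          map_natCast]
        exact K.mul_mem_right _ hpK
      · exact Submodule.mem_sup_left (Ideal.subset_span ⟨n, hn, i, hi, rfl⟩)
    | zero =>
      intro n hn
      have : γ p (RingHom.ker q) n ((0 : W) • (0 : RingHom.ker q)) = 0 := by
        rw [γ_smul, map_zero, zero_pow hn, zero_mul]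
      rw [zero_smul] at this
      rw [this]
      exact zero_mem _
    | add i j _ _ hi hj =>
      intro n hn
      rw [γ_add]
      refine sum_mem fun k hk => ?_
      rw [Finset.HasAntidiagonal.mem_antidiagonal] at hk
      by_cases h1 : k.1 = 0
      · exact K.mul_mem_left _ (hj _ (by omega))
      · exact K.mul_mem_right _ (hi _ h1)
    | smul w i _ hi =>
      intro n hn
      rw [γ_smul]
      exact K.mul_mem_left _ (hi n hn)
  -- The envelope is `W + K`. An element of `W` that maps to zero in `R` lies in the original ideal,
  -- so it is its own first divided power and belongs to `K`.
  have h1 : ∀ x : PDEnvelope p (RingHom.ker q), ∃ w, x - of p _ w ∈ K := by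
    intro x
    induction x using PDEnvelope.induction with
    | of w => exact ⟨w, by rw [sub_self]; exact zero_mem _⟩
    | add x y hx hy =>
      obtain ⟨v, hv⟩ := hx
      obtain ⟨w, hw⟩ := hy
      refine ⟨v + w, ?_⟩
      rw [map_add, add_sub_add_comm]
      exact add_mem hv hw
    | mul x n i hx =>
      by_cases hn : n = 0
      · rw [hn, γ_zero, mul_one]
        exact hx
      · refine ⟨0, ?_⟩
        rw [map_zero, sub_zero]
        exact K.mul_mem_left _ (hγ i n hn)
  intro x hx
  obtain ⟨w, hw⟩ := h1 x
  have hw0 : q w = 0 := by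
    have h2 := RingHom.mem_ker.1 (hKker hw)
    rwa [map_sub, RingHom.mem_ker.1 hx, toR_of, zero_sub, neg_eq_zero] at h2
  have h3 := hγ ⟨w, hw0⟩ 1 one_ne_zero
  rw [γ_one] at h3
  simpa using add_mem hw h3

end IsFrobeniusBase

/-! ### Divided powers of Teichmüller elements in `A_cris(R)`. -/

namespace Acris

variable (p : ℕ) [hp : Fact p.Prime] (R : Type u) [CommRing R] [CharP R p]

theorem frame_isNormalized : (Acris.frame p R).IsNormalized where
  p_mem := by
    change toR p R (p : Acris p R) = 0
    rw [map_natCast, CharP.cast_eq_zero]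
  σ₁_p := by
    refine AdicCompletion.ext_evalₐ fun n => ?_
    refine (Completion.evalₐ_mapσ₁ _ _ _ (AcrisPre.pKer p R) rfl
      ((Winf.isFrobeniusBase p R).σ₁_p _ _ _ rfl) ⟨(p : Acris p R), _⟩ n (AcrisPre.pKer p R) ?_).trans ?_
    · rw [map_natCast]
      exact (map_natCast _ _).symm
    · rw [(Winf.isFrobeniusBase p R).σ₁_p _ _ _ rfl, map_one]
      exact (map_one (AdicCompletion.evalₐ (Ideal.span {(p : AcrisPre p R)}) n)).symm

/-- Modulo `p` the completion is the envelope modulo `p`, where the kernel to `R` is already known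
to be nil. -/
theorem Fil_le_radical :
    (Acris.frame p R).Fil ≤ (Ideal.span {(p : (Acris.frame p R).S)}).radical := by
  intro (x : Acris p R) hx
  obtain ⟨d, hd⟩ := Completion.exists_rep
    ((Winf.isFrobeniusBase p R).toR (Winf.toR p R) (CharP.cast_eq_zero R p))
    (CharP.cast_eq_zero R p) ⟨x, hx⟩ 0
  obtain ⟨N, hN⟩ := (Winf.isFrobeniusBase p R).ker_toR_le_radical (Winf.toR p R)
    (CharP.cast_eq_zero R p) d.2
  refine ⟨N, ?_⟩
  have h1 : x ^ N ∈ Ideal.span {(p : Acris p R)} := by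
    rw [Completion.span_p_eq_ker, RingHom.mem_ker, map_pow]
    change AdicCompletion.evalOneₐ _ x ^ N = 0
    rw [Completion.evalOneₐ_eq x d hd, ← map_pow]
    exact Ideal.Quotient.eq_zero_iff_mem.2 hN
  exact h1

theorem frame_σ₁_algebraMap
    (d : RingHom.ker ((Winf.isFrobeniusBase p R).toR (Winf.toR p R) (CharP.cast_eq_zero R p)))
    (hd : algebraMap (AcrisPre p R) (Acris p R) d ∈ (Acris.frame p R).Fil) :
    (Acris.frame p R).σ₁ ⟨algebraMap (AcrisPre p R) (Acris p R) d, hd⟩ =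
      algebraMap (AcrisPre p R) (Acris p R)
        ((Winf.isFrobeniusBase p R).σ₁ (Winf.toR p R) (CharP.cast_eq_zero R p) d) := by
  refine AdicCompletion.ext_evalₐ fun n => ?_
  rw [Completion.evalₐ_algebraMap]
  exact Completion.evalₐ_mapσ₁ _ _ _ (AcrisPre.pKer p R) rfl
    ((Winf.isFrobeniusBase p R).σ₁_p _ _ _ rfl) ⟨_, hd⟩ n d (Completion.evalₐ_algebraMap _ _)

/-- The Teichmüller representative of an element of the kernel of `R♭ → R`. -/
def teichmullerKer (a : RingHom.ker (Perfection.coeff R p 0)) : RingHom.ker (Winf.toR p R) :=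
  ⟨WittVector.teichmuller p (a : Perfection R p), by
    have : WittVector.constantCoeff (WittVector.teichmuller p (a : Perfection R p)) = a :=
      WittVector.teichmuller_coeff_zero p _
    rw [RingHom.mem_ker, Winf.toR, RingHom.comp_apply, this]
    exact a.2⟩

/-- The divided power `[a]^{[n]}` in `A_cris(R)`. -/
def teichmullerDp (n : ℕ) (a : RingHom.ker (Perfection.coeff R p 0)) : Acris p R :=
  algebraMap (AcrisPre p R) (Acris p R) (PDEnvelope.γ p _ n (teichmullerKer p R a))

theorem teichmullerDp_mem_Fil {n : ℕ} (hn : n ≠ 0) (a : RingHom.ker (Perfection.coeff R p 0)) :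
    teichmullerDp p R n a ∈ (Acris.frame p R).Fil := by
  change toR p R (teichmullerDp p R n a) = 0
  rw [teichmullerDp, Lift.acris_toR_algebraMap, IsFrobeniusBase.toR_γ, if_neg hn]

/-- Frobenius sends `[a]` to `[a]^p`, so the correction term `δ [a]` vanishes; the integer factor is
`(pn)! / (p n!)`. -/
theorem frame_σ₁_teichmullerDp {n : ℕ} (hn : n ≠ 0)
    (a : RingHom.ker (Perfection.coeff R p 0)) :
    (Acris.frame p R).σ₁ ⟨teichmullerDp p R n a, teichmullerDp_mem_Fil p R hn a⟩ =
      ((p ^ (n - 1) * ((p - 1)! ^ n * Nat.uniformBell n p) : ℕ) : Acris p R) *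
        teichmullerDp p R (p * n) a := by
  have h1 : PDEnvelope.γ p _ n (teichmullerKer p R a) ∈
      RingHom.ker ((Winf.isFrobeniusBase p R).toR (Winf.toR p R) (CharP.cast_eq_zero R p)) := by
    rw [RingHom.mem_ker, IsFrobeniusBase.toR_γ, if_neg hn]
  have h2 : WittVector.frobenius (teichmullerKer p R a : Winf p R) =
      (teichmullerKer p R a : Winf p R) ^ p := by
    change WittVector.frobenius (WittVector.teichmuller p (a : Perfection R p)) =
      WittVector.teichmuller p (a : Perfection R p) ^ p
    rw [WittVector.frobenius_eq_map_frobenius, WittVector.map_teichmuller, frobenius_def, map_pow]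
  refine (frame_σ₁_algebraMap p R ⟨_, h1⟩ _).trans ?_
  rw [(Winf.isFrobeniusBase p R).σ₁_γ_of_σ_eq_pow (Winf.toR p R) (CharP.cast_eq_zero R p) n hn
    (teichmullerKer p R a) h2 h1, map_mul, map_natCast]
  rfl

/-- One application of `σ₁` may contribute only a unit, namely when `n = 1`, but it raises the
exponent from `n` to `p n`. The second application then contributes the factor `p^(pn-1)`. -/
theorem teichmullerDp_mem_σ₁Comap {n : ℕ} (hn : n ≠ 0)
    (a : RingHom.ker (Perfection.coeff R p 0)) :
    teichmullerDp p R n a ∈ (Acris.frame p R).σ₁Comap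
      ((Acris.frame p R).σ₁Comap (Ideal.span {(p : (Acris.frame p R).S)})) := by
  refine (Frame.mem_σ₁Comap _).2 ⟨teichmullerDp_mem_Fil p R hn a, ?_⟩
  rw [frame_σ₁_teichmullerDp p R hn]
  refine Ideal.mul_mem_left _ _ ?_
  have hpn : p * n ≠ 0 := mul_ne_zero hp.out.ne_zero hn
  refine (Frame.mem_σ₁Comap _).2 ⟨teichmullerDp_mem_Fil p R hpn a, ?_⟩
  rw [frame_σ₁_teichmullerDp p R hpn]
  refine Ideal.mul_mem_right _ _ ?_
  -- This makes the exponent `p n - 1` positive.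
  have h2 : 2 ≤ p * n := le_trans hp.out.two_le (Nat.le_mul_of_pos_right p (Nat.pos_of_ne_zero hn))
  obtain ⟨c, hc⟩ : p ∣ p ^ (p * n - 1) * ((p - 1)! ^ (p * n) * Nat.uniformBell (p * n) p) :=
    Dvd.dvd.mul_right (dvd_pow_self p (by omega)) _
  rw [hc, Nat.cast_mul]
  exact Ideal.mul_mem_right _ _ (Ideal.mem_span_singleton_self _)

end Acris

/-! ### The kernel of `A_cris(R) → A` for a straight lift. -/

namespace Lift

variable {p : ℕ} [hp : Fact p.Prime] {R A : Type u} [CommRing R] [CommRing A] [CharP R p]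
  (L : Lift p R A)

/-- The frame homomorphism from `A_cris(R)` to a lift of `R`. -/
def acrisFrameHom (ϰ : Acris p R →+* A) (hϰ : ∀ x, L.π (ϰ x) = Acris.toR p R x) :
    FrameHom (Acris.frame p R) L.frame :=
  have map_Fil : ∀ a : Acris p R, a ∈ (Acris.frame p R).Fil → ϰ a ∈ Ideal.span {(p : A)} :=
    fun a ha => by
      rw [← L.ker_eq, RingHom.mem_ker, hϰ]
      exact ha
  have map_σ : ∀ x : Acris p R, L.σ (ϰ x) = ϰ ((Acris.frame p R).σ x) := fun x => by
    let τ : Acris p R →+* Acris p R := (Acris.frame p R).σ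
    -- Both composites induce the `p`-th power of the projection to `R`, and homomorphisms that
    -- agree modulo `p` are equal.
    refine RingHom.congr_fun (f := L.σ.comp ϰ) (g := ϰ.comp τ) (L.acris_hom_ext fun x => ?_) x
    rw [RingHom.comp_apply, RingHom.comp_apply, L.π_σ, hϰ, hϰ]
    obtain ⟨y, hy⟩ : ∃ y : Acris p R, y * p = τ x - x ^ p :=
      Ideal.mem_span_singleton'.1 ((Acris.frame p R).frobenius_lift x)
    have h1 : τ x = x ^ p + y * p := by rw [hy]; ring
    rw [h1, map_add, map_pow, map_mul, map_natCast, CharP.cast_eq_zero R p, mul_zero, add_zero]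
  { toRingHom := ϰ
    map_Fil := map_Fil
    map_σ := map_σ
    u := 1
    map_σ₁ := fun a => by
      -- On both sides `p σ₁ = σ`, so compatibility with `σ₁`, with unit `1`, follows from that with
      -- `σ`.
      apply L.p_cancel
      let b : Acris p R := (Acris.frame p R).σ₁ a
      have h1 : (p : Acris p R) * b = (Acris.frame p R).σ (a : (Acris.frame p R).S) :=
        (Acris.frame_isNormalized p R).p_mul_σ₁ a
      have h2 : (p : A) * ϰ b = L.σ (ϰ (a : (Acris.frame p R).S)) := by
        refine Eq.trans ?_ (map_σ _).symm
        refine Eq.trans ?_ (congrArg ϰ h1)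
        rw [map_mul, map_natCast]
      refine (L.p_mul_σ₁ ⟨ϰ (a : (Acris.frame p R).S), map_Fil _ a.2⟩).trans (h2.symm.trans ?_)
      rw [Units.val_one, one_mul]
      rfl }

/-- For a straight lift, `σ₁` is topologically nilpotent on the kernel of `A_cris(R) → A`. -/
theorem ker_le_σ₁Comap (ϰ : Acris p R →+* A) (hϰ : ∀ x, L.π (ϰ x) = Acris.toR p R x)
    (hstraight : Ideal.span {a : Perfection R p | a ∈ RingHom.ker (Perfection.coeff R p 0) ∧
      ϰ (algebraMap (AcrisPre p R) _ (PDEnvelope.of p _ (WittVector.teichmuller p a))) = 0} =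
        RingHom.ker (Perfection.coeff R p 0))
    (h1 : RingHom.ker ϰ ≤ (Acris.frame p R).σ₁Comap (RingHom.ker ϰ)) :
    RingHom.ker ϰ ≤ (Acris.frame p R).σ₁Comap
      ((Acris.frame p R).σ₁Comap (Ideal.span {(p : Acris p R)})) := by
  set T := (Acris.frame p R).σ₁Comap ((Acris.frame p R).σ₁Comap (Ideal.span {(p : Acris p R)}))
    with hT
  let E : Set (RingHom.ker (Winf.toR p R)) :=
    {i | ∃ a : RingHom.ker (Perfection.coeff R p 0), i = Acris.teichmullerKer p R a ∧
      ϰ (algebraMap (AcrisPre p R) _ (PDEnvelope.of p _ (i : Winf p R))) = 0}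
  -- Modulo `p` the kernel of `W(R♭) → R` becomes `J`, and straightness says that the elements `a`
  -- in question generate `J`.
  have hE : Submodule.span (Winf p R)
      (insert (IsFrobeniusBase.pKer (Winf.toR p R) (CharP.cast_eq_zero R p)) E) = ⊤ := by
    have hcc : Function.Surjective (WittVector.constantCoeff : Winf p R →+* Perfection R p) :=
      fun x => ⟨WittVector.teichmuller p x, WittVector.teichmuller_coeff_zero p x⟩
    rw [eq_top_iff]
    rintro ⟨w, hw⟩ -
    have hw0 : WittVector.constantCoeff w ∈ RingHom.ker (Perfection.coeff R p 0) := hw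
    rw [← hstraight] at hw0
    obtain ⟨i, hi, hiw⟩ : ∃ i ∈ Submodule.span (Winf p R)
        (insert (IsFrobeniusBase.pKer (Winf.toR p R) (CharP.cast_eq_zero R p)) E),
        WittVector.constantCoeff (i : Winf p R) = WittVector.constantCoeff w := by
      generalize WittVector.constantCoeff w = b at hw0
      induction hw0 using Submodule.span_induction with
      | mem a ha =>
        exact ⟨Acris.teichmullerKer p R ⟨a, ha.1⟩,
          Submodule.subset_span (Set.mem_insert_of_mem _ ⟨⟨a, ha.1⟩, rfl, ha.2⟩),
          WittVector.teichmuller_coeff_zero p a⟩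
      | zero => exact ⟨0, zero_mem _, map_zero _⟩
      | add x y _ _ hx hy =>
        obtain ⟨i, hi, hix⟩ := hx
        obtain ⟨j, hj, hjy⟩ := hy
        exact ⟨i + j, add_mem hi hj, by rw [Submodule.coe_add, map_add, hix, hjy]⟩
      | smul c x _ hx =>
        obtain ⟨i, hi, hix⟩ := hx
        obtain ⟨c, rfl⟩ := hcc c
        exact ⟨c • i, Submodule.smul_mem _ _ hi, by
          rw [Submodule.coe_smul, smul_eq_mul, map_mul, hix, smul_eq_mul]⟩
    have h2 : w - i ∈ Ideal.span {(p : Winf p R)} := by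
      rw [← WittVector.ker_constantCoeff, RingHom.mem_ker, map_sub, hiw, sub_self]
    obtain ⟨c, hc⟩ := Ideal.mem_span_singleton'.1 h2
    have h3 : (⟨w, hw⟩ : RingHom.ker (Winf.toR p R)) =
        i + c • IsFrobeniusBase.pKer (Winf.toR p R) (CharP.cast_eq_zero R p) := Subtype.ext (by
      change w = (i : Winf p R) + c * p
      rw [hc]
      ring)
    rw [h3]
    exact add_mem hi (Submodule.smul_mem _ _ (Submodule.subset_span (Set.mem_insert _ _)))
  have hK := (Winf.isFrobeniusBase p R).ker_toR_le_of_span (Winf.toR p R)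
    (CharP.cast_eq_zero R p) E hE
  have hFil : RingHom.ker ϰ ≤ (Acris.frame p R).Fil := fun x hx => by
    change Acris.toR p R x = 0
    rw [← hϰ, RingHom.mem_ker.1 hx, map_zero]
  -- `n!` times the image of `[a]^{[n]}` is the `n`-th power of the image of `[a]`, which is zero.
  have hdp : ∀ n ≠ 0, ∀ i ∈ E,
      algebraMap (AcrisPre p R) (Acris p R) (PDEnvelope.γ p _ n i) ∈ RingHom.ker ϰ ⊓ T := by
    rintro n hn i ⟨a, rfl, ha⟩
    refine ⟨?_, Acris.teichmullerDp_mem_σ₁Comap p R hn a⟩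
    apply L.isFrobeniusBase.natCast_cancel (Nat.factorial_ne_zero n)
    rw [← map_natCast (ϰ.comp (algebraMap (AcrisPre p R) (Acris p R))), ← RingHom.comp_apply,
      ← map_mul, PDEnvelope.factorial_mul_γ, map_pow, mul_zero]
    exact (congrArg (· ^ n) ha).trans (zero_pow hn)
  have hG : ∀ d ∈ Ideal.span {x | ∃ n ≠ 0, ∃ i ∈ E, x = PDEnvelope.γ p (RingHom.ker (Winf.toR p R)) n i},
      algebraMap (AcrisPre p R) (Acris p R) d ∈ RingHom.ker ϰ ⊓ T := by
    intro d hd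
    have : Ideal.span {x | ∃ n ≠ 0, ∃ i ∈ E, x = PDEnvelope.γ p (RingHom.ker (Winf.toR p R)) n i} ≤
        Ideal.comap (algebraMap (AcrisPre p R) (Acris p R)) (RingHom.ker ϰ ⊓ T) := by
      refine Ideal.span_le.2 ?_
      rintro _ ⟨n, hn, i, hi, rfl⟩
      exact hdp n hn i hi
    exact this hd
  intro x hx
  -- A representative of `x` modulo `p` suffices: together with the multiple of `p` in `d`, the
  -- remainder is collected into `p z`.
  obtain ⟨d, hd⟩ := Completion.exists_rep
    ((Winf.isFrobeniusBase p R).toR (Winf.toR p R) (CharP.cast_eq_zero R p))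
    (CharP.cast_eq_zero R p) ⟨x, hFil hx⟩ 0
  obtain ⟨y, hy⟩ := Completion.exists_eq_add_mul x d hd
  obtain ⟨g, hg, e, he, hge⟩ := Submodule.mem_sup.1 (hK d.2)
  obtain ⟨c, rfl⟩ := Ideal.mem_span_singleton'.1 he
  have hgN := hG g hg
  let z : Acris p R := algebraMap (AcrisPre p R) (Acris p R) c + y
  have hxz : x = algebraMap (AcrisPre p R) (Acris p R) g + p * z := by
    rw [hy, ← hge, map_add, map_mul, map_natCast]
    ring
  -- Both `x` and the combination of divided powers lie in the kernel, so `p ϰ(z) = 0`.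
  have hz : z ∈ RingHom.ker ϰ := by
    apply L.torsionFree
    have := RingHom.mem_ker.1 hx
    rw [hxz, map_add, RingHom.mem_ker.1 hgN.1, zero_add, map_mul, map_natCast] at this
    exact this
  rw [hxz]
  refine add_mem hgN.2 ?_
  exact Frame.p_mul_mem_σ₁Comap_σ₁Comap hFil h1 hz

theorem acrisFrameHom_isThickening (ψ : Winf p R →+* A) (hψ : Function.Surjective ψ)
    (ϰ : Acris p R →+* A) (hϰ : ∀ x, L.π (ϰ x) = Acris.toR p R x)
    (hϰψ : ∀ w, ϰ (algebraMap (AcrisPre p R) _ (PDEnvelope.of p _ w)) = ψ w)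
    (hstraight : Ideal.span {a : Perfection R p | a ∈ RingHom.ker (Perfection.coeff R p 0) ∧
      WittVector.teichmuller p a ∈ RingHom.ker ψ} = RingHom.ker (Perfection.coeff R p 0)) :
    (L.acrisFrameHom ϰ hϰ).IsThickening ((Acris.frame p R).filtration (RingHom.ker ϰ)) := by
  let N : Ideal (Acris.frame p R).S := RingHom.ker ϰ
  have hN : N ≤ (Acris.frame p R).Fil := fun x hx =>
    (hϰ x).symm.trans ((congrArg L.π hx).trans (map_zero L.π))
  -- The kernel is stable under `σ₁` because `ϰ` intertwines the maps `σ₁` of the two frames.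
  have h1 : N ≤ (Acris.frame p R).σ₁Comap N := by
    intro x hx
    refine (Frame.mem_σ₁Comap _).2 ⟨hN hx, ?_⟩
    have h2 := (L.acrisFrameHom ϰ hϰ).map_σ₁ ⟨x, hN hx⟩
    have h3 : (⟨(L.acrisFrameHom ϰ hϰ).toRingHom x,
        (L.acrisFrameHom ϰ hϰ).map_Fil x (hN hx)⟩ : L.frame.Fil) = 0 := Subtype.ext hx
    rw [h3, map_zero] at h2
    change ϰ _ = 0
    refine Eq.trans ?_ h2.symm
    exact (one_mul _).symm
  -- `σ₁ ∘ σ₁` maps `N` into `N` and into multiples of `p`. As `A` has no `p`-torsion, a multiple of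
  -- `p` in `N` is `p` times an element of `N`.
  have h2 : N ≤ (Acris.frame p R).σ₁Comap ((Acris.frame p R).σ₁Comap
      (Ideal.span {(p : (Acris.frame p R).S)} * N)) := by
    intro x hx
    obtain ⟨hxF, hσx⟩ := (Frame.mem_σ₁Comap _).1 (L.ker_le_σ₁Comap ϰ hϰ
      (by simpa only [hϰψ, RingHom.mem_ker] using hstraight) h1 hx)
    refine (Frame.mem_σ₁Comap _).2 ⟨hxF, ?_⟩
    obtain ⟨hσxF, hσσx⟩ := (Frame.mem_σ₁Comap _).1 hσx
    refine (Frame.mem_σ₁Comap _).2 ⟨hσxF, ?_⟩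
    obtain ⟨_, h3⟩ := (Frame.mem_σ₁Comap _).1 (h1 ((Frame.mem_σ₁Comap _).1 (h1 hx)).2)
    obtain ⟨y, hy⟩ : ∃ y : Acris p R, y * p = (Acris.frame p R).σ₁ ⟨_, hσxF⟩ :=
      Ideal.mem_span_singleton'.1 hσσx
    have h4 : ϰ y = 0 := by
      apply L.torsionFree
      have h5 : ϰ (y * p) = 0 := by rw [hy]; exact h3
      rwa [map_mul, map_natCast, mul_comm] at h5
    rw [← hy]
    exact Ideal.mem_span_singleton_mul.2 ⟨y, h4, mul_comm (p : Acris p R) y⟩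
  exact
    { surjective := fun a => by
        obtain ⟨w, rfl⟩ := hψ a
        exact ⟨_, hϰψ w⟩
      u_eq_one := rfl
      mem_Fil := fun a ha => (hϰ a).symm.trans
        ((L.π_eq_zero_iff _).2 (Ideal.mem_span_singleton.1 ha))
      isNormalized := Acris.frame_isNormalized p R
      isAdicComplete := Completion.isAdicComplete p (AcrisPre p R)
      isHausdorff := L.isAdicComplete.toIsHausdorff
      ker_le_radical := le_trans hN (Acris.Fil_le_radical p R)
      filtration_zero := by
        have := Frame.filtration_two_mul (𝓢 := Acris.frame p R) N 0
        rw [pow_zero, Nat.cast_one, Ideal.span_singleton_one, Ideal.top_mul] at this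
        exact this
      filtration_antitone := Frame.filtration_antitone hN h1
      filtration_le_Fil := fun k => (Frame.filtration_le_self N k).trans hN
      σ₁_mem := fun k a ha => Frame.σ₁_mem_filtration hN h1 h2 k a ha _
      filtration_le := Frame.filtration_le_span_pow N }

end Lift

end Lau

end

/-! ### The main theorem. -/

theorem mainTheorem7 (p : ℕ) [Fact p.Prime] (R : Type u) [CommRing R] [CharP R p]
    (hR : Function.Surjective (frobenius R p)) (A : Type u) [CommRing A]
    (L : Lau.Lift p R A) (hL : L.IsStraight) :
    ∃ ϰ : Lau.FrameHom (Lau.Acris.frame p R) L.frame,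
      (∀ x : Lau.Acris p R, L.π (ϰ.toRingHom x) = Lau.Acris.toR p R x) ∧
      (∀ f : Lau.Acris p R →+* A, (∀ x, L.π (f x) = Lau.Acris.toR p R x) → f = ϰ.toRingHom) ∧
      ϰ.IsCrystalline := by
  obtain ⟨ψ, hψ, hψπ, hstraight⟩ := hL
  obtain ⟨ϰ, hϰψ, hϰ⟩ := L.exists_acris_hom ψ hψπ
  exact ⟨L.acrisFrameHom ϰ hϰ, hϰ, fun f hf => L.acris_hom_ext fun x => (hf x).trans (hϰ x).symm,
    (L.acrisFrameHom_isThickening ψ hψ ϰ hϰ hϰψ hstraight).isCrystalline⟩
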